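/- **Channel model.** Let $M_1,M_2$ be integer-valued random variables with an arbitrary joint law and $0\le M_k\le n_k$. In the two-user fading deterministic MAC, user $k\in\{1,2\}$ sends in every channel use a vector $x_k=(x_k^1,\dots,x_k^{n_k})\in\{0,1\}^{n_k}$, most significant bit first. Fading levels $(m_1,m_2)$ are drawn with the law of $(M_1,M_2)$, independently of the inputs and i.i.d. over time. With $\hat m=\max(m_1,m_2)$, the receiver observes $m_1$, $m_2$ and the vector $y=(y^1,\dots,y^{\hat m})$, $$y^i=x_1^{\,i-(\hat m-m_1)}\oplus x_2^{\,i-(\hat m-m_2)},\qquad x_k^j=0\ \text{ for } j\le 0 ,$$ where $\oplus$ is addition in $GF(2)$. The transmitters do not know the realizations of the fading levels. The capacity region of a MAC is the closure of the set of rate pairs $(R_1,R_2)$, in bits per channel use and with $R_1,R_2\ge 0$, for which there are block codes of length $N$ with $\lceil 2^{NR_1}\rceil$ and $\lceil 2^{NR_2}\rceil$ messages and average error probability tending to $0$ as $N\to\infty$. **Theorem.** (i) The capacity region of the fading deterministic MAC is the set of all $(R_1,R_2)$ with $R_1,R_2\ge 0$ and $$R_1\le E[M_1],\qquad R_2\le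 E[M_2],\qquad R_1+R_2\le E[\max(M_1,M_2)].$$ (ii) Let $H_1,H_2\ge 0$ be random gains, jointly distributed with $M_1,M_2$, let $\mathrm{SNR}_k=H_k^2$, and suppose that for each $k$ either $M_k=\lceil\frac12\log_2(1+\mathrm{SNR}_k)\rceil$ or $M_k=\max(0,\lceil\frac12\log_2\mathrm{SNR}_k\rceil)$ (which is $0$ for $\mathrm{SNR}_k=0$). Then the region in (i) lies within $1.5$ bits of the capacity region of the fading Gaussian MAC $Y=H_1X_1+H_2X_2+Z$, where $Z\sim\mathcal N(0,1)$ is independent of the gains, noise and gains are i.i.d. over time and independent of the inputs, the gains are known to the receiver only, and every codeword has average power at most $1$: for every rate pair $(R_1,R_2)$ in either of the two regions there is a rate pair $(R_1',R_2')$ in the other one with $|R_1-R_1'|+|R_2-R_2'|\le 1.5$. In particular each of $R_1$, $R_2$ and $R_1+R_2$ changes by at most $1.5$ bits. -/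

import Mathlib

open MeasureTheory ProbabilityTheory Filter

namespace FadingMAC

/-- A block code of length `n` for a two-user multiple access channel with input alphabets
`X₁`, `X₂` and receiver alphabet `Y`. User `k` has the messages `Fin Kₖ`, and every codeword of
user `k` has to lie in the set `Aₖ` of admissible input words. The encoders see only their own
message, the decoder sees only the received word. -/
structure Code {X₁ X₂ : Type*} (Y : Type*) [MeasurableSpace Y] (n : ℕ)
    (A₁ : Set (Fin n → X₁)) (A₂ : Set (Fin n → X₂)) (K₁ K₂ : ℕ) where
  enc₁ : Fin K₁ → Fin n → X₁
  enc₂ : Fin K₂ → Fin n → X₂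
  enc₁_mem : ∀ w, enc₁ w ∈ A₁
  enc₂_mem : ∀ w, enc₂ w ∈ A₂
  dec : (Fin n → Y) → Fin K₁ × Fin K₂
  dec_measurable : Measurable dec

/-- The average probability of error of a code over the memoryless channel whose single-use output
law for the inputs `x₁`, `x₂` is `W x₁ x₂`; the two messages are independent and uniform. -/
noncomputable def Code.avgError {X₁ X₂ Y : Type*} [MeasurableSpace Y]
    (W : X₁ → X₂ → Measure Y) {n : ℕ} {A₁ : Set (Fin n → X₁)} {A₂ : Set (Fin n → X₂)}
    {K₁ K₂ : ℕ} (c : Code Y n A₁ A₂ K₁ K₂) : ℝ :=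
  (∑ w : Fin K₁ × Fin K₂,
    (Measure.pi fun t : Fin n => W (c.enc₁ w.1 t) (c.enc₂ w.2 t)).real {y | c.dec y ≠ w})
      / ((K₁ : ℝ) * (K₂ : ℝ))

/-- The rate pair `R` (in bits per channel use) is achievable: for large block lengths `n` there
are codes with `⌈2 ^ (n Rₖ)⌉` messages for user `k` and arbitrarily small average error. -/
def Achievable {X₁ X₂ Y : Type*} [MeasurableSpace Y] (W : X₁ → X₂ → Measure Y)
    (A₁ : (n : ℕ) → Set (Fin n → X₁)) (A₂ : (n : ℕ) → Set (Fin n → X₂)) (R : ℝ × ℝ) : Prop :=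
  0 ≤ R.1 ∧ 0 ≤ R.2 ∧ ∀ ε : ℝ, 0 < ε → ∀ᶠ n : ℕ in atTop,
    ∃ c : Code Y n (A₁ n) (A₂ n) ⌈(2 : ℝ) ^ ((n : ℝ) * R.1)⌉₊ ⌈(2 : ℝ) ^ ((n : ℝ) * R.2)⌉₊,
      c.avgError W ≤ ε

/-- The capacity region: the closure of the set of achievable rate pairs. -/
def capacityRegion {X₁ X₂ Y : Type*} [MeasurableSpace Y] (W : X₁ → X₂ → Measure Y)
    (A₁ : (n : ℕ) → Set (Fin n → X₁)) (A₂ : (n : ℕ) → Set (Fin n → X₂)) : Set (ℝ × ℝ) :=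
  closure {R | Achievable W A₁ A₂ R}

/-- The `j`-th most significant bit of `x`, counted from `1`; it is `0` for `j ≤ 0`. -/
def bit {n : ℕ} (x : Fin n → ZMod 2) (j : ℤ) : ZMod 2 :=
  if h : 1 ≤ j ∧ j ≤ n then x ⟨(j - 1).toNat, by omega⟩ else 0

/-- The output vector, of length `max m₁ m₂`, for the fading levels `m₁`, `m₂`: its `i`-th most
significant bit is the sum in `GF(2)` of the bits `i - (max m₁ m₂ - mₖ)` of the inputs. The
index `i : Fin _` starts from `0`, hence the shift by one. -/
def received {n₁ n₂ : ℕ} (m₁ m₂ : ℕ) (x₁ : Fin n₁ → ZMod 2) (x₂ : Fin n₂ → ZMod 2) :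
    Fin (max m₁ m₂) → ZMod 2 := fun i =>
  bit x₁ (((i : ℕ) : ℤ) + 1 - ((max m₁ m₂ : ℕ) - (m₁ : ℤ))) +
    bit x₂ (((i : ℕ) : ℤ) + 1 - ((max m₁ m₂ : ℕ) - (m₂ : ℤ)))

/-- What the receiver of the deterministic model sees in one channel use: both fading levels, and
an output vector of length equal to their maximum. -/
abbrev DetOutput : Type := Σ m : ℕ × ℕ, (Fin (max m.1 m.2) → ZMod 2)

/-- The law of the receiver's observation in one use of the fading deterministic channel. -/
noncomputable def detLaw {Ω : Type*} [MeasurableSpace Ω] (P : Measure Ω) (n₁ n₂ : ℕ)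
    (M₁ M₂ : Ω → ℕ) (x₁ : Fin n₁ → ZMod 2) (x₂ : Fin n₂ → ZMod 2) : Measure DetOutput :=
  P.map fun ω => ⟨(M₁ ω, M₂ ω), received (M₁ ω) (M₂ ω) x₁ x₂⟩

/-- The capacity region of the fading deterministic channel: fading levels i.i.d. over time with
the joint law of `(M₁, M₂)` under `P`, known to the receiver only; no constraint on codewords. -/
noncomputable def detCapacityRegion {Ω : Type*} [MeasurableSpace Ω] (P : Measure Ω) (n₁ n₂ : ℕ)
    (M₁ M₂ : Ω → ℕ) : Set (ℝ × ℝ) :=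
  capacityRegion (detLaw P n₁ n₂ M₁ M₂) (fun _ => Set.univ) (fun _ => Set.univ)

/-- The law of the receiver's observation `(H₁ x₁ + H₂ x₂ + Z, H₁, H₂)` in one use of the fading
Gaussian channel, with `Z` standard normal and independent of the gains. -/
noncomputable def gaussianLaw {Ω : Type*} [MeasurableSpace Ω] (P : Measure Ω)
    (H₁ H₂ : Ω → ℝ) (x₁ x₂ : ℝ) : Measure (ℝ × ℝ × ℝ) :=
  (P.prod (gaussianReal 0 1)).map fun p =>
    (H₁ p.1 * x₁ + H₂ p.1 * x₂ + p.2, H₁ p.1, H₂ p.1)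

/-- The words of length `n` of average power at most `1`. -/
def unitPower (n : ℕ) : Set (Fin n → ℝ) := {x | ∑ t, x t ^ 2 ≤ (n : ℝ)}

/-- The capacity region of the fading Gaussian channel: gains i.i.d. over time with the joint law
of `(H₁, H₂)` under `P`, known to the receiver only; unit average power for both users. -/
noncomputable def gaussianCapacityRegion {Ω : Type*} [MeasurableSpace Ω] (P : Measure Ω)
    (H₁ H₂ : Ω → ℝ) : Set (ℝ × ℝ) :=
  capacityRegion (gaussianLaw P H₁ H₂) unitPower unitPower

/-- `M` is the number of bit levels above the noise for the gain `H`, with `SNR = H ^ 2`: the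
ceiling of `½ lg (1 + SNR)`, or else that of `½ lg SNR` (taken as `0` when negative). -/
def IsBitLevel {Ω : Type*} (H : Ω → ℝ) (M : Ω → ℕ) : Prop :=
  (∀ ω, M ω = ⌈1 / 2 * Real.logb 2 (1 + H ω ^ 2)⌉₊) ∨
    (∀ ω, M ω = ⌈1 / 2 * Real.logb 2 (H ω ^ 2)⌉₊)

/-- Every rate pair of either region is matched by one of the other region such that the
deviations of the two rates add up to at most `δ`; thus each of the rates `R₁`, `R₂` and the sum
rate `R₁ + R₂` changes by at most `δ`. -/
def WithinBits (δ : ℝ) (A B : Set (ℝ × ℝ)) : Prop :=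
  (∀ R ∈ A, ∃ R' ∈ B, |R.1 - R'.1| + |R.2 - R'.2| ≤ δ) ∧
    (∀ R ∈ B, ∃ R' ∈ A, |R.1 - R'.1| + |R.2 - R'.2| ≤ δ)

end FadingMAC

/-!
The capacity regions rest on two general facts about memoryless channels, a converse and a random
coding bound, neither of which needs typical sets or a law of large numbers. Write `Sₖ = Hₖ ^ 2`.

*Converse.* Suppose that every output law `W x` has a density at most `exp ℓ` with respect to a
fixed auxiliary law, and that the expectations of `ℓ` along a codeword add up to at most `n * C`
(`InformationLE`). Outside an event that Markov's inequality bounds by `(n * C + 1) / γ`, the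
likelihood ratio of a codeword is at most `exp γ`, and the decoding sets are disjoint; hence the
probability of correct decoding of `K` messages is at most `(n * C + 1) / γ + exp γ / K`. This
stays away from `1` as soon as the rate exceeds `C`, so vanishing error forces the rate to be at
most `C` (`Achievable.left_le`, `Achievable.right_le`, `Achievable.add_le`). For the two individual
bounds the word of the other user is held fixed. In the deterministic channel the auxiliary law is
the output law under uniform bits, which gives exactly `E[M₁]`, `E[M₂]` and `E[max]`. In the
Gaussian channel it is the law with a suitable centre and with variance `1 + 2 S₁ + 2 S₂`, which
gives `E[½ lg (1 + 2 S₁ + 2 S₂)]`, or the same with only the user's own gain for an individual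
bound; the doubled gains are absorbed by the slack of `3 / 2` bits.

*Achievability.* Codewords are drawn i.i.d., and the receiver maximises a product of per-letter
scores. Conditionally on the gains, the expected score ratio of a wrong and the right codeword is at
most a product of factors `exp (-c)` (`scoreRatio`), so that the error probability is at most the
expectation of `min 1 (K * ∏ exp (-c))`, summed over the three ways in which the message pair can
be wrong, plus the probability that a codeword is not admissible. Since
`min 1 x ≤ x ^ θ` for `θ ∈ [0, 1]`, this decays exponentially when `log K / n` is below `E[c]`
(`achievable_of_scoreRatio`). In the deterministic channel the score is the indicator of
consistency with the observation, and `c` is `log 2` times the number of visible bits: the bounds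
of the converse. In the Gaussian channel the score is the square root of the likelihood, and
Gaussian inputs of power `ρ < 1`, whose words rarely violate the power constraint, give
`c = ½ log (1 + ρ S / 2)`.

*Comparison.* The bit levels satisfy `4 ^ M ≥ max 1 S` and `M ≤ ½ lg (1 + S / 2) + 3 / 2`, so each
of the three bounds of the deterministic region exceeds that of the Gaussian inner region by at
most `3 / 2`, and each bound of the Gaussian outer region exceeds the deterministic one by at most
`3 / 2`. In a polymatroid, relaxing all bounds by `δ` moves no point by more than `δ` in `ℓ¹`
(`exists_mem_rateRegion_of_slack`).
-/

namespace FadingMAC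

/-! ### Product measures -/

lemma lintegral_pi_prod {ι : Type*} [Fintype ι] {X : ι → Type*} [∀ i, MeasurableSpace (X i)]
    (μ : (i : ι) → Measure (X i)) [∀ i, IsProbabilityMeasure (μ i)]
    {f : (i : ι) → X i → ENNReal} (hf : ∀ i, Measurable (f i)) :
    ∫⁻ x, ∏ i, f i (x i) ∂Measure.pi μ = ∏ i, ∫⁻ x, f i x ∂μ i := by
  rw [lintegral_prod_eq_prod_lintegral_of_indepFun Finset.univ
    (fun i (x : (i : ι) → X i) => f i (x i)) (iIndepFun_pi fun i => (hf i).aemeasurable)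
    fun i => (hf i).comp (measurable_pi_apply i)]
  exact Finset.prod_congr rfl fun i _ =>
    (measurePreserving_eval μ i).lintegral_comp (hf i)

lemma pi_eq_withDensity {ι : Type*} [Fintype ι] {X : ι → Type*} [∀ i, MeasurableSpace (X i)]
    (μ ν : (i : ι) → Measure (X i)) [∀ i, IsProbabilityMeasure (μ i)]
    [∀ i, IsProbabilityMeasure (ν i)] {f : (i : ι) → X i → ENNReal} (hf : ∀ i, Measurable (f i))
    (h : ∀ i, μ i = (ν i).withDensity (f i)) :
    Measure.pi μ = (Measure.pi ν).withDensity fun x => ∏ i, f i (x i) := by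
  classical
  refine Measure.pi_eq fun s hs => ?_
  rw [withDensity_apply _ (.univ_pi hs), ← lintegral_indicator (.univ_pi hs)]
  have : ∀ x, (Set.univ.pi s).indicator (fun x : (i : ι) → X i => ∏ i, f i (x i)) x =
      ∏ i, (s i).indicator (f i) (x i) := by
    intro x
    by_cases hx : x ∈ Set.univ.pi s
    · rw [Set.indicator_of_mem hx]
      exact Finset.prod_congr rfl fun i _ => (Set.indicator_of_mem (hx i trivial) _).symm
    · rw [Set.indicator_of_notMem hx]
      obtain ⟨i, hi⟩ : ∃ i, x i ∉ s i := by simpa [Set.mem_pi] using hx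
      exact (Finset.prod_eq_zero (Finset.mem_univ i) (Set.indicator_of_notMem hi _)).symm
  simp_rw [this]
  rw [lintegral_pi_prod ν fun i => (hf i).indicator (hs i)]
  refine Finset.prod_congr rfl fun i _ => ?_
  rw [lintegral_indicator (hs i), h i, withDensity_apply _ (hs i)]

/-! ### A weak converse from Markov's inequality -/

/-- If `μ` has density at most `exp L` with respect to a probability measure, the negative part of
the log-likelihood ratio `L` has mean at most `1` under `μ`; so a bound on the mean of `L` bounds
the mean of its positive part, to which Markov's inequality applies. -/
lemma measureReal_log_likelihood_ge_le {Y : Type*} [MeasurableSpace Y] {μ ν : Measure Y}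
    [IsProbabilityMeasure μ] [IsProbabilityMeasure ν] {L : Y → ℝ} (hL : Measurable L)
    (hμ : μ ≤ ν.withDensity fun y => ENNReal.ofReal (Real.exp (L y))) (hint : Integrable L μ)
    {D γ : ℝ} (hD : ∫ y, L y ∂μ ≤ D) (hγ : 0 < γ) :
    μ.real {y | γ ≤ L y} ≤ (D + 1) / γ := by
  have hneg : ∫ y, max (-L y) 0 ∂μ ≤ 1 := by
    have h1 : ∫⁻ y, ENNReal.ofReal (Real.exp (-L y)) ∂μ ≤ 1 := by
      calc ∫⁻ y, ENNReal.ofReal (Real.exp (-L y)) ∂μ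
          ≤ ∫⁻ y, ENNReal.ofReal (Real.exp (-L y))
              ∂(ν.withDensity fun y => ENNReal.ofReal (Real.exp (L y))) :=
            lintegral_mono' hμ le_rfl
        _ = ∫⁻ _, 1 ∂ν := by
            rw [lintegral_withDensity_eq_lintegral_mul _ (by fun_prop) (by fun_prop)]
            refine lintegral_congr fun y => ?_
            rw [Pi.mul_apply, ← ENNReal.ofReal_mul (Real.exp_pos _).le, ← Real.exp_add]
            simp
        _ = 1 := by simp
    rw [integral_eq_lintegral_of_nonneg_ae (ae_of_all _ fun y => le_max_right (-L y) 0)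
      (hL.neg.max measurable_const).aestronglyMeasurable]
    refine ENNReal.toReal_le_of_le_ofReal zero_le_one ?_
    rw [ENNReal.ofReal_one]
    refine le_trans (lintegral_mono fun y => ENNReal.ofReal_le_ofReal ?_) h1
    exact max_le (by linarith [Real.add_one_le_exp (-L y)]) (Real.exp_pos _).le
  have hpos : ∫ y, max (L y) 0 ∂μ ≤ D + 1 := by
    have h2 : ∀ y, max (L y) 0 = L y + max (-L y) 0 := fun y => by
      rcases le_total 0 (L y) with h | h
      · rw [max_eq_left h, max_eq_right (by linarith)]; ring
      · rw [max_eq_right h, max_eq_left (by linarith)]; ring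
    simp_rw [h2]
    rw [integral_add hint (by simpa using hint.neg.pos_part)]
    linarith
  have hM := mul_meas_ge_le_integral_of_nonneg (μ := μ) (ae_of_all _ fun y => le_max_right (L y) 0)
    hint.pos_part γ
  rw [le_div_iff₀ hγ, mul_comm]
  refine le_trans (mul_le_mul_of_nonneg_left (measureReal_mono fun y hy => ?_) hγ.le)
    (hM.trans hpos)
  exact le_max_of_le_left (show γ ≤ L y from hy)

/-- Total probability of correct decoding, when every message law `μ w` is compared with one
reference law `ν` that does not depend on the message. -/
lemma sum_measureReal_decoding_le {Y W : Type*} [MeasurableSpace Y] [Fintype W]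
    {μ : W → Measure Y} {ν : Measure Y} [∀ w, IsProbabilityMeasure (μ w)] [IsProbabilityMeasure ν]
    {L : W → Y → ℝ} (hL : ∀ w, Measurable (L w))
    (hμ : ∀ w, μ w ≤ ν.withDensity fun y => ENNReal.ofReal (Real.exp (L w y)))
    (hint : ∀ w, Integrable (L w) (μ w)) {D γ : ℝ} (hD : ∀ w, ∫ y, L w y ∂μ w ≤ D) (hγ : 0 < γ)
    {A : W → Set Y} (hA : ∀ w, MeasurableSet (A w)) (hdisj : Pairwise (Function.onFun Disjoint A)) :
    ∑ w, (μ w).real (A w) ≤ Fintype.card W * ((D + 1) / γ) + Real.exp γ := by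
  have hw : ∀ w, (μ w).real (A w) ≤ (D + 1) / γ + Real.exp γ * ν.real (A w) := by
    intro w
    have hS : MeasurableSet {y | L w y ≤ γ} := measurableSet_le (hL w) measurable_const
    have h1 : (μ w).real (A w ∩ {y | L w y ≤ γ}) ≤ Real.exp γ * ν.real (A w) := by
      refine ENNReal.toReal_le_of_le_ofReal (by positivity) ?_
      calc μ w (A w ∩ {y | L w y ≤ γ})
          ≤ (ν.withDensity fun y => ENNReal.ofReal (Real.exp (L w y)))
              (A w ∩ {y | L w y ≤ γ}) := hμ w _
        _ = ∫⁻ y in A w ∩ {y | L w y ≤ γ}, ENNReal.ofReal (Real.exp (L w y)) ∂ν :=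
            withDensity_apply _ ((hA w).inter hS)
        _ ≤ ∫⁻ _ in A w ∩ {y | L w y ≤ γ}, ENNReal.ofReal (Real.exp γ) ∂ν :=
            setLIntegral_mono' ((hA w).inter hS) fun y hy =>
              ENNReal.ofReal_le_ofReal (Real.exp_le_exp.2 hy.2)
        _ ≤ ENNReal.ofReal (Real.exp γ) * ν (A w) := by
            rw [setLIntegral_const]
            gcongr
            exact Set.inter_subset_left
        _ = ENNReal.ofReal (Real.exp γ * ν.real (A w)) := by
            rw [ENNReal.ofReal_mul (Real.exp_pos _).le, ofReal_measureReal]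
    have h2 := measureReal_log_likelihood_ge_le (hL w) (hμ w) (hint w) (hD w) hγ
    calc (μ w).real (A w) ≤ (μ w).real ({y | γ ≤ L w y} ∪ (A w ∩ {y | L w y ≤ γ})) :=
          measureReal_mono fun y hy => (le_total γ (L w y)).imp id fun h => ⟨hy, h⟩
      _ ≤ _ := (measureReal_union_le _ _).trans (add_le_add h2 h1)
  have hν : ∑ w, ν.real (A w) ≤ 1 := by
    rw [← measureReal_biUnion_finset (fun i _ j _ hij => hdisj hij) fun w _ => hA w]
    exact measureReal_le_one
  calc ∑ w, (μ w).real (A w) ≤ ∑ w, ((D + 1) / γ + Real.exp γ * ν.real (A w)) :=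
        Finset.sum_le_sum fun w _ => hw w
    _ = Fintype.card W * ((D + 1) / γ) + Real.exp γ * ∑ w, ν.real (A w) := by
        rw [Finset.sum_add_distrib, ← Finset.mul_sum]; simp
    _ ≤ _ := by
        have := mul_le_mul_of_nonneg_left hν (Real.exp_pos γ).le
        linarith

/-- `sum_measureReal_decoding_le` for memoryless laws, with single-letter log-likelihood ratios
`ℓ w t`. -/
lemma sum_pi_measureReal_decoding_le {Y W ι : Type*} [MeasurableSpace Y] [Fintype W] [Fintype ι]
    {μ : W → ι → Measure Y} {ν : ι → Measure Y} [∀ w t, IsProbabilityMeasure (μ w t)]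
    [∀ t, IsProbabilityMeasure (ν t)] {f : W → ι → Y → ENNReal} {ℓ : W → ι → Y → ℝ}
    (hf : ∀ w t, Measurable (f w t)) (hℓ : ∀ w t, Measurable (ℓ w t))
    (hμ : ∀ w t, μ w t = (ν t).withDensity (f w t))
    (hle : ∀ w t y, f w t y ≤ ENNReal.ofReal (Real.exp (ℓ w t y)))
    (hint : ∀ w t, Integrable (ℓ w t) (μ w t)) {D γ : ℝ}
    (hD : ∀ w, ∑ t, ∫ y, ℓ w t y ∂μ w t ≤ D) (hγ : 0 < γ)
    {A : W → Set (ι → Y)} (hA : ∀ w, MeasurableSet (A w))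
    (hdisj : Pairwise (Function.onFun Disjoint A)) :
    ∑ w, (Measure.pi (μ w)).real (A w) ≤ Fintype.card W * ((D + 1) / γ) + Real.exp γ := by
  have hint' : ∀ w t, Integrable (fun y : ι → Y => ℓ w t (y t)) (Measure.pi (μ w)) :=
    fun w t => (measurePreserving_eval (μ w) t).integrable_comp_of_integrable (hint w t)
  refine sum_measureReal_decoding_le (ν := Measure.pi ν) (L := fun w y => ∑ t, ℓ w t (y t))
    (fun w => by fun_prop) (fun w => ?_)
    (fun w => integrable_finsetSum _ fun t _ => hint' w t) (fun w => ?_) hγ hA hdisj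
  · rw [pi_eq_withDensity (μ w) ν (hf w) (hμ w)]
    refine withDensity_mono (ae_of_all _ fun y => ?_)
    beta_reduce
    rw [Real.exp_sum, ENNReal.ofReal_prod_of_nonneg fun t _ => (Real.exp_pos _).le]
    exact Finset.prod_le_prod' fun t _ => hle w t _
  · rw [integral_finsetSum _ fun t _ => hint' w t]
    refine le_of_eq_of_le (Finset.sum_congr rfl fun t _ => ?_) (hD w)
    rw [← (measurePreserving_eval (μ w) t).map_eq,
      integral_map (measurable_pi_apply t).aemeasurable]
    exact (hℓ w t).aestronglyMeasurable

/-- A family of channels `V t`, one for each channel use, has information at most `D` (in nats)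
over the input words in `A`: all output laws `V t x` have densities `f t x` with respect to a
reference law `ν t`, and upper bounds `ℓ t x` of the log-densities whose means add up to at most
`D` for each word in `A`. -/
def InformationLE {X Y : Type*} [MeasurableSpace Y] {n : ℕ} (V : Fin n → X → Measure Y)
    (A : Set (Fin n → X)) (D : ℝ) : Prop :=
  ∃ (ν : Fin n → Measure Y) (f : Fin n → X → Y → ENNReal) (ℓ : Fin n → X → Y → ℝ),
    (∀ t, IsProbabilityMeasure (ν t)) ∧ (∀ t x, Measurable (f t x)) ∧
    (∀ t x, Measurable (ℓ t x)) ∧ (∀ t x, V t x = (ν t).withDensity (f t x)) ∧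
    (∀ t x y, f t x y ≤ ENNReal.ofReal (Real.exp (ℓ t x y))) ∧
    (∀ t x, Integrable (ℓ t x) (V t x)) ∧
    ∀ x ∈ A, ∑ t, ∫ y, ℓ t (x t) y ∂V t (x t) ≤ D

lemma InformationLE.sum_measureReal_decoding_le {X Y M : Type*} [MeasurableSpace Y] [Fintype M]
    {n : ℕ} {V : Fin n → X → Measure Y} [∀ t x, IsProbabilityMeasure (V t x)]
    {A : Set (Fin n → X)} {D : ℝ} (h : InformationLE V A D) {enc : M → Fin n → X}
    (henc : ∀ w, enc w ∈ A) {S : M → Set (Fin n → Y)} (hS : ∀ w, MeasurableSet (S w))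
    (hdisj : Pairwise (Function.onFun Disjoint S)) {γ : ℝ} (hγ : 0 < γ) :
    ∑ w, (Measure.pi fun t => V t (enc w t)).real (S w) ≤
      Fintype.card M * ((D + 1) / γ) + Real.exp γ := by
  obtain ⟨ν, f, ℓ, hν, hf, hℓ, hV, hle, hint, hD⟩ := h
  exact sum_pi_measureReal_decoding_le (μ := fun w t => V t (enc w t)) (ν := ν)
    (fun w t => hf t (enc w t)) (fun w t => hℓ t (enc w t)) (fun w t => hV t _)
    (fun w t => hle t _) (fun w t => hint t _) (fun w => hD _ (henc w)) hγ hS hdisj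

section Code

variable {X₁ X₂ Y : Type*} [MeasurableSpace Y] {n : ℕ} {A₁ : Set (Fin n → X₁)}
  {A₂ : Set (Fin n → X₂)} {K₁ K₂ : ℕ}

lemma Code.measurableSet_dec (c : Code Y n A₁ A₂ K₁ K₂) (w : Fin K₁ × Fin K₂) :
    MeasurableSet {y | c.dec y = w} :=
  c.dec_measurable (measurableSet_singleton w)

lemma Code.pairwise_disjoint_dec (c : Code Y n A₁ A₂ K₁ K₂) {M : Type*}
    {φ : M → Fin K₁ × Fin K₂} (hφ : Function.Injective φ) :
    Pairwise (Function.onFun Disjoint fun w => {y | c.dec y = φ w}) := fun _ _ hij =>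
  Set.disjoint_left.2 fun _ hi hj => hij (hφ (Eq.trans (Eq.symm hi) hj))

variable {W : X₁ → X₂ → Measure Y} [∀ x₁ x₂, IsProbabilityMeasure (W x₁ x₂)]

lemma Code.one_sub_avgError (c : Code Y n A₁ A₂ K₁ K₂) (h₁ : 0 < K₁) (h₂ : 0 < K₂) :
    1 - c.avgError W = (∑ w : Fin K₁ × Fin K₂,
      (Measure.pi fun t : Fin n => W (c.enc₁ w.1 t) (c.enc₂ w.2 t)).real {y | c.dec y = w})
        / ((K₁ : ℝ) * (K₂ : ℝ)) := by
  have hc : ∀ w : Fin K₁ × Fin K₂,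
      (Measure.pi fun t : Fin n => W (c.enc₁ w.1 t) (c.enc₂ w.2 t)).real {y | c.dec y ≠ w} =
      1 - (Measure.pi fun t : Fin n => W (c.enc₁ w.1 t) (c.enc₂ w.2 t)).real
        {y | c.dec y = w} := fun w => by
    exact probReal_compl_eq_one_sub (c.dec_measurable (measurableSet_singleton w))
  have h₁' : (K₁ : ℝ) ≠ 0 := by positivity
  have h₂' : (K₂ : ℝ) ≠ 0 := by positivity
  rw [Code.avgError, Finset.sum_congr rfl fun w _ => hc w, Finset.sum_sub_distrib]
  simp only [Finset.sum_const, Finset.card_univ, Fintype.card_prod, Fintype.card_fin, nsmul_eq_mul,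
    Nat.cast_mul, mul_one]
  field_simp
  ring

/-- User `1` sees the channel left by a fixed word of user `2`. -/
lemma Code.one_sub_avgError_le_of_left (c : Code Y n A₁ A₂ K₁ K₂) (h₁ : 0 < K₁) (h₂ : 0 < K₂)
    {D : ℝ} (hD : ∀ x₂ ∈ A₂, InformationLE (fun t x₁ => W x₁ (x₂ t)) A₁ D) {γ : ℝ} (hγ : 0 < γ) :
    1 - c.avgError W ≤ (D + 1) / γ + Real.exp γ / K₁ := by
  rw [c.one_sub_avgError h₁ h₂, div_le_iff₀ (by positivity), Fintype.sum_prod_type_right]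
  have h : ∀ w₂ : Fin K₂, ∑ w₁ : Fin K₁,
      (Measure.pi fun t : Fin n => W (c.enc₁ w₁ t) (c.enc₂ w₂ t)).real {y | c.dec y = (w₁, w₂)} ≤
        K₁ * ((D + 1) / γ) + Real.exp γ := fun w₂ => by
    simpa using (hD _ (c.enc₂_mem w₂)).sum_measureReal_decoding_le c.enc₁_mem
      (fun w₁ => c.measurableSet_dec (w₁, w₂))
      (c.pairwise_disjoint_dec (Prod.mk_left_injective w₂)) hγ
  refine (Finset.sum_le_sum fun w₂ _ => h w₂).trans (le_of_eq ?_)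
  have h₁' : (K₁ : ℝ) ≠ 0 := by positivity
  simp only [Finset.sum_const, Finset.card_univ, Fintype.card_fin, nsmul_eq_mul]
  field_simp

lemma Code.one_sub_avgError_le_of_right (c : Code Y n A₁ A₂ K₁ K₂) (h₁ : 0 < K₁) (h₂ : 0 < K₂)
    {D : ℝ} (hD : ∀ x₁ ∈ A₁, InformationLE (fun t x₂ => W (x₁ t) x₂) A₂ D) {γ : ℝ} (hγ : 0 < γ) :
    1 - c.avgError W ≤ (D + 1) / γ + Real.exp γ / K₂ := by
  rw [c.one_sub_avgError h₁ h₂, div_le_iff₀ (by positivity), Fintype.sum_prod_type]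
  have h : ∀ w₁ : Fin K₁, ∑ w₂ : Fin K₂,
      (Measure.pi fun t : Fin n => W (c.enc₁ w₁ t) (c.enc₂ w₂ t)).real {y | c.dec y = (w₁, w₂)} ≤
        K₂ * ((D + 1) / γ) + Real.exp γ := fun w₁ => by
    simpa using (hD _ (c.enc₁_mem w₁)).sum_measureReal_decoding_le c.enc₂_mem
      (fun w₂ => c.measurableSet_dec (w₁, w₂))
      (c.pairwise_disjoint_dec (Prod.mk_right_injective w₁)) hγ
  refine (Finset.sum_le_sum fun w₁ _ => h w₁).trans (le_of_eq ?_)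
  have h₂' : (K₂ : ℝ) ≠ 0 := by positivity
  simp only [Finset.sum_const, Finset.card_univ, Fintype.card_fin, nsmul_eq_mul]
  field_simp

/-- The words of the pair of users, as words over the product alphabet. -/
def jointWords (A₁ : Set (Fin n → X₁)) (A₂ : Set (Fin n → X₂)) : Set (Fin n → X₁ × X₂) :=
  {x | (fun t => (x t).1) ∈ A₁ ∧ (fun t => (x t).2) ∈ A₂}

lemma Code.one_sub_avgError_le_of_joint (c : Code Y n A₁ A₂ K₁ K₂) (h₁ : 0 < K₁) (h₂ : 0 < K₂)
    {D : ℝ} (hD : InformationLE (fun (_ : Fin n) (x : X₁ × X₂) => W x.1 x.2) (jointWords A₁ A₂) D)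
    {γ : ℝ} (hγ : 0 < γ) :
    1 - c.avgError W ≤ (D + 1) / γ + Real.exp γ / (K₁ * K₂) := by
  rw [c.one_sub_avgError h₁ h₂, div_le_iff₀ (by positivity)]
  have h := hD.sum_measureReal_decoding_le (M := Fin K₁ × Fin K₂)
    (enc := fun w t => (c.enc₁ w.1 t, c.enc₂ w.2 t))
    (fun w => ⟨c.enc₁_mem w.1, c.enc₂_mem w.2⟩) c.measurableSet_dec
    (c.pairwise_disjoint_dec Function.injective_id) hγ
  refine h.trans (le_of_eq ?_)
  have h₁' : (K₁ : ℝ) ≠ 0 := by positivity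
  have h₂' : (K₂ : ℝ) ≠ 0 := by positivity
  simp only [Fintype.card_prod, Fintype.card_fin, Nat.cast_mul]
  field_simp

end Code

/-! ### Converse bounds for achievable rates -/

/-- If the probability of correct decoding tends to `1`, the choice `γ = n (C + δ)` with
`C + 2 δ = r` bounds it by a quantity with limit `C / (C + δ) < 1`. -/
lemma rate_le_of_eventually {C r : ℝ} (hC : 0 ≤ C)
    (h : ∀ ε : ℝ, 0 < ε → ∀ᶠ n : ℕ in atTop, ∀ γ : ℝ, 0 < γ →
      1 - ε ≤ (n * C + 1) / γ + Real.exp γ / Real.exp (n * r)) : r ≤ C := by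
  by_contra! hlt
  set δ := (r - C) / 2 with hδ
  have hδ0 : 0 < δ := by linarith
  have hr : r = C + 2 * δ := by linarith
  have hCδ : 0 < C + δ := by linarith
  have hlim : Tendsto (fun n : ℕ => C / (C + δ) + 1 / (C + δ) * (n : ℝ)⁻¹ +
      Real.exp (-δ) ^ n) atTop (nhds (C / (C + δ) + 1 / (C + δ) * 0 + 0)) :=
    (tendsto_const_nhds.add (tendsto_const_nhds.mul tendsto_inv_atTop_nhds_zero_nat)).add
      (tendsto_pow_atTop_nhds_zero_of_lt_one (Real.exp_pos _).le
        (Real.exp_lt_one_iff.2 (by linarith)))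
  have hfrac : C / (C + δ) < 1 := by rw [div_lt_one hCδ]; linarith
  have key : 1 - (1 - C / (C + δ)) / 2 ≤ C / (C + δ) + 1 / (C + δ) * 0 + 0 := by
    refine ge_of_tendsto hlim ?_
    filter_upwards [h ((1 - C / (C + δ)) / 2) (by linarith), eventually_gt_atTop 0] with n hn hn0
    have hn0' : (0 : ℝ) < n := by exact_mod_cast hn0
    refine (hn (n * (C + δ)) (by positivity)).trans (le_of_eq ?_)
    rw [← Real.exp_sub, ← Real.exp_nat_mul]
    congr 1
    · field_simp
    · congr 1
      rw [hr]; ring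
  linarith

lemma exp_le_natCeil_two_rpow (n : ℕ) (r : ℝ) :
    Real.exp (n * (r * Real.log 2)) ≤ ⌈(2 : ℝ) ^ ((n : ℝ) * r)⌉₊ := by
  rw [← mul_assoc, mul_comm, ← Real.rpow_def_of_pos two_pos]
  exact Nat.le_ceil _

section Rates

variable {X₁ X₂ Y : Type*} [MeasurableSpace Y] {W : X₁ → X₂ → Measure Y}
  [∀ x₁ x₂, IsProbabilityMeasure (W x₁ x₂)] {A₁ : (n : ℕ) → Set (Fin n → X₁)}
  {A₂ : (n : ℕ) → Set (Fin n → X₂)} {R : ℝ × ℝ} {C : ℝ}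

lemma natCeil_two_rpow_pos (n : ℕ) (r : ℝ) : 0 < ⌈(2 : ℝ) ^ ((n : ℝ) * r)⌉₊ :=
  Nat.ceil_pos.2 (by positivity)

lemma Achievable.left_le (hR : Achievable W A₁ A₂ R) (hC : 0 ≤ C)
    (h : ∀ n, ∀ x₂ ∈ A₂ n, InformationLE (fun t x₁ => W x₁ (x₂ t)) (A₁ n) (n * C)) :
    R.1 * Real.log 2 ≤ C := by
  refine rate_le_of_eventually hC fun ε hε => ?_
  filter_upwards [hR.2.2 ε hε] with n ⟨c, hc⟩ γ hγ
  have h1 := c.one_sub_avgError_le_of_left (natCeil_two_rpow_pos _ _) (natCeil_two_rpow_pos _ _)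
    (h n) hγ
  have h2 := div_le_div_of_nonneg_left (Real.exp_pos γ).le (Real.exp_pos _)
    (exp_le_natCeil_two_rpow n R.1)
  linarith

lemma Achievable.right_le (hR : Achievable W A₁ A₂ R) (hC : 0 ≤ C)
    (h : ∀ n, ∀ x₁ ∈ A₁ n, InformationLE (fun t x₂ => W (x₁ t) x₂) (A₂ n) (n * C)) :
    R.2 * Real.log 2 ≤ C := by
  refine rate_le_of_eventually hC fun ε hε => ?_
  filter_upwards [hR.2.2 ε hε] with n ⟨c, hc⟩ γ hγ
  have h1 := c.one_sub_avgError_le_of_right (natCeil_two_rpow_pos _ _) (natCeil_two_rpow_pos _ _)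
    (h n) hγ
  have h2 := div_le_div_of_nonneg_left (Real.exp_pos γ).le (Real.exp_pos _)
    (exp_le_natCeil_two_rpow n R.2)
  linarith

lemma Achievable.add_le (hR : Achievable W A₁ A₂ R) (hC : 0 ≤ C)
    (h : ∀ n, InformationLE (fun (_ : Fin n) (x : X₁ × X₂) => W x.1 x.2)
      (jointWords (A₁ n) (A₂ n)) (n * C)) :
    (R.1 + R.2) * Real.log 2 ≤ C := by
  refine rate_le_of_eventually hC fun ε hε => ?_
  filter_upwards [hR.2.2 ε hε] with n ⟨c, hc⟩ γ hγ
  have h1 := c.one_sub_avgError_le_of_joint (natCeil_two_rpow_pos _ _) (natCeil_two_rpow_pos _ _)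
    (h n) hγ
  have h3 : Real.exp (n * ((R.1 + R.2) * Real.log 2)) ≤
      ⌈(2 : ℝ) ^ ((n : ℝ) * R.1)⌉₊ * ⌈(2 : ℝ) ^ ((n : ℝ) * R.2)⌉₊ := by
    rw [add_mul, mul_add, Real.exp_add]
    exact mul_le_mul (exp_le_natCeil_two_rpow n R.1) (exp_le_natCeil_two_rpow n R.2)
      (Real.exp_pos _).le (Nat.cast_nonneg _)
  have h2 := div_le_div_of_nonneg_left (Real.exp_pos γ).le (Real.exp_pos _) h3
  linarith

end Rates

/-! ### Converse bounds for the fading Gaussian channel -/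

section GaussianConverse

variable {Ω : Type*} [MeasurableSpace Ω] {P : Measure Ω} {H₁ H₂ : Ω → ℝ}

lemma gaussianReal_eq_withDensity (a c : ℝ) {v : ℝ} (hv : 0 < v) :
    gaussianReal a 1 = (gaussianReal c v.toNNReal).withDensity fun y => ENNReal.ofReal
      (Real.exp (1 / 2 * Real.log v - (y - a) ^ 2 / 2 + (y - c) ^ 2 / (2 * v))) := by
  have hv' : v.toNNReal ≠ 0 := by simpa using hv
  rw [gaussianReal_of_var_ne_zero a one_ne_zero, gaussianReal_of_var_ne_zero c hv',
    ← withDensity_mul _ (by fun_prop) (by fun_prop)]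
  congr 1
  ext y
  rw [Pi.mul_apply, gaussianPDF, gaussianPDF, ← ENNReal.ofReal_mul (gaussianPDFReal_nonneg _ _ _),
    gaussianPDFReal, gaussianPDFReal, Real.coe_toNNReal v hv.le]
  congr 1
  have h1 : √(2 * Real.pi * v) = √(2 * Real.pi) * Real.exp (1 / 2 * Real.log v) := by
    rw [Real.sqrt_mul (by positivity), Real.sqrt_eq_rpow v, Real.rpow_def_of_pos hv,
      mul_comm (1 / 2)]
  rw [h1, mul_inv, ← Real.exp_neg, NNReal.coe_one, mul_one, mul_assoc, mul_assoc, ← Real.exp_add,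
    ← Real.exp_add]
  congr 2
  field_simp
  ring

/-- The law of `(a + s Z, H₁, H₂)`, where `a` and `s` are functions of the gains. -/
lemma lintegral_map_gaussian (hH₁ : Measurable H₁) (hH₂ : Measurable H₂) {a s : ℝ × ℝ → ℝ}
    (ha : Measurable a) (hs : Measurable s) {F : ℝ × ℝ × ℝ → ENNReal} (hF : Measurable F) :
    ∫⁻ y, F y ∂((P.prod (gaussianReal 0 1)).map fun p =>
        (a (H₁ p.1, H₂ p.1) + s (H₁ p.1, H₂ p.1) * p.2, H₁ p.1, H₂ p.1)) =
      ∫⁻ ω, ∫⁻ y, F (y, H₁ ω, H₂ ω)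
        ∂(gaussianReal (a (H₁ ω, H₂ ω)) (s (H₁ ω, H₂ ω) ^ 2).toNNReal) ∂P := by
  rw [lintegral_map hF (by fun_prop), lintegral_prod _ (by fun_prop)]
  refine lintegral_congr fun ω => ?_
  have h : gaussianReal (a (H₁ ω, H₂ ω)) (s (H₁ ω, H₂ ω) ^ 2).toNNReal =
      (gaussianReal 0 1).map fun z => a (H₁ ω, H₂ ω) + s (H₁ ω, H₂ ω) * z := by
    have hcomp := Measure.map_map (μ := gaussianReal 0 1) (g := fun z => a (H₁ ω, H₂ ω) + z)
      (f := fun z => s (H₁ ω, H₂ ω) * z) (by fun_prop) (by fun_prop)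
    rw [gaussianReal_map_const_mul, gaussianReal_map_const_add] at hcomp
    rw [Function.comp_def] at hcomp
    rw [← hcomp]
    congr 1
    · simp
    · ext; simp [sq_nonneg]
  rw [h, lintegral_map (by fun_prop) (by fun_prop)]

variable [IsProbabilityMeasure P]

lemma integrable_continuous_comp_of_bounded {B : ℝ} (hH₁ : Measurable H₁) (hH₂ : Measurable H₂)
    (hB₁ : ∀ ω, |H₁ ω| ≤ B) (hB₂ : ∀ ω, |H₂ ω| ≤ B) {F : ℝ × ℝ → ℝ} (hF : Continuous F) :
    Integrable (fun ω => F (H₁ ω, H₂ ω)) P := by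
  obtain ⟨C, hC⟩ := (isCompact_Icc.prod isCompact_Icc : IsCompact
    (Set.Icc (-B) B ×ˢ Set.Icc (-B) B)).exists_bound_of_continuousOn hF.continuousOn
  exact Integrable.of_bound (hF.measurable.comp (hH₁.prodMk hH₂)).aestronglyMeasurable C
    (ae_of_all _ fun ω => hC _ ⟨abs_le.1 (hB₁ ω), abs_le.1 (hB₂ ω)⟩)

lemma integral_quadratic_gaussian {φ₀ φ₁ φ₂ : Ω → ℝ} (h₀ : Integrable φ₀ P)
    (h₁ : Integrable φ₁ P) (h₂ : Integrable φ₂ P) :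
    Integrable (fun p : Ω × ℝ => φ₀ p.1 + φ₁ p.1 * p.2 + φ₂ p.1 * p.2 ^ 2)
      (P.prod (gaussianReal 0 1)) ∧
    ∫ p : Ω × ℝ, φ₀ p.1 + φ₁ p.1 * p.2 + φ₂ p.1 * p.2 ^ 2 ∂(P.prod (gaussianReal 0 1)) =
      ∫ ω, φ₀ ω ∂P + ∫ ω, φ₂ ω ∂P := by
  have hz1 : Integrable (fun z : ℝ => z) (gaussianReal 0 1) :=
    (memLp_id_gaussianReal 1).integrable le_rfl
  have hz2 : Integrable (fun z : ℝ => z ^ 2) (gaussianReal 0 1) :=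
    (memLp_id_gaussianReal 2).integrable_sq
  have hi2 : ∫ z, z ^ 2 ∂gaussianReal 0 1 = 1 := by
    have h := variance_fun_id_gaussianReal (μ := 0) (v := 1)
    rw [variance_eq_integral (by fun_prop), integral_id_gaussianReal] at h
    simpa using h
  have i0 : Integrable (fun p : Ω × ℝ => φ₀ p.1) (P.prod (gaussianReal 0 1)) := h₀.comp_fst _
  have i1 := h₁.mul_prod hz1
  have i2 := h₂.mul_prod hz2
  refine ⟨(i0.add i1).add i2, ?_⟩
  rw [integral_add (f := fun p : Ω × ℝ => φ₀ p.1 + φ₁ p.1 * p.2) (i0.add i1) i2,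
    integral_add i0 i1, integral_prod_mul φ₁ fun z => z,
    integral_prod_mul φ₂ fun z => z ^ 2, hi2, integral_id_gaussianReal, mul_zero, mul_one,
    add_zero, integral_fun_fst]
  simp

lemma isProbabilityMeasure_gaussianLaw (hH₁ : Measurable H₁) (hH₂ : Measurable H₂)
    (x₁ x₂ : ℝ) : IsProbabilityMeasure (gaussianLaw P H₁ H₂ x₁ x₂) :=
  Measure.isProbabilityMeasure_map (by fun_prop)

/-- The reference law replaces the signal by a fixed word `(c₁, c₂)` and the noise by a Gaussian of
variance `v = 1 + 2 g₁ H₁² + 2 g₂ H₂²`. Since `(H₁ u₁ + H₂ u₂)² ≤ 2 H₁² u₁² + 2 H₂² u₂²`, words at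
mean square distance at most `g₁`, `g₂` from `c₁`, `c₂` have information at most `E [log v] / 2`
per channel use. -/
lemma informationLE_gaussianLaw {B : ℝ} (hH₁ : Measurable H₁) (hH₂ : Measurable H₂)
    (hB₁ : ∀ ω, |H₁ ω| ≤ B) (hB₂ : ∀ ω, |H₂ ω| ≤ B) {X : Type*} {n : ℕ} {A : Set (Fin n → X)}
    (p q : Fin n → X → ℝ) (c₁ c₂ : Fin n → ℝ) {g₁ g₂ : ℝ} (hg₁ : 0 ≤ g₁) (hg₂ : 0 ≤ g₂)
    (hA₁ : ∀ x ∈ A, ∑ t, (p t (x t) - c₁ t) ^ 2 ≤ n * g₁)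
    (hA₂ : ∀ x ∈ A, ∑ t, (q t (x t) - c₂ t) ^ 2 ≤ n * g₂) :
    InformationLE (fun t x => gaussianLaw P H₁ H₂ (p t x) (q t x)) A
      (n * ∫ ω, 1 / 2 * Real.log (1 + 2 * g₁ * H₁ ω ^ 2 + 2 * g₂ * H₂ ω ^ 2) ∂P) := by
  set v : ℝ × ℝ → ℝ := fun h => 1 + 2 * g₁ * h.1 ^ 2 + 2 * g₂ * h.2 ^ 2 with hv
  have hv0 : ∀ h, 0 < v h := fun h => by positivity
  have hv0' : ∀ h, v h ≠ 0 := fun h => (hv0 h).ne'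
  have hvc : Continuous v := by fun_prop
  have hint : ∀ F : ℝ × ℝ → ℝ, Continuous F → Integrable (fun ω => F (H₁ ω, H₂ ω)) P :=
    fun F hF => integrable_continuous_comp_of_bounded hH₁ hH₂ hB₁ hB₂ hF
  set ℓ : Fin n → X → ℝ × ℝ × ℝ → ℝ := fun t x y => 1 / 2 * Real.log (v y.2) -
    (y.1 - (y.2.1 * p t x + y.2.2 * q t x)) ^ 2 / 2 +
    (y.1 - (y.2.1 * c₁ t + y.2.2 * c₂ t)) ^ 2 / (2 * v y.2) with hℓ
  have hℓm : ∀ t x, Measurable (ℓ t x) := fun t x => by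
    have := hvc.measurable
    fun_prop
  have hmap : ∀ t x, Measurable fun r : Ω × ℝ =>
      (H₁ r.1 * p t x + H₂ r.1 * q t x + r.2, H₁ r.1, H₂ r.1) := fun t x => by fun_prop
  -- along the channel law, `ℓ` is a quadratic polynomial in the noise with coefficients `φ₀ φ₁ φ₂`
  set φ₀ : Fin n → X → ℝ × ℝ → ℝ := fun t x h => 1 / 2 * Real.log (v h) +
    (h.1 * (p t x - c₁ t) + h.2 * (q t x - c₂ t)) ^ 2 / (2 * v h) with hφ₀
  set φ₁ : Fin n → X → ℝ × ℝ → ℝ := fun t x h =>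
    (h.1 * (p t x - c₁ t) + h.2 * (q t x - c₂ t)) / v h with hφ₁
  set φ₂ : ℝ × ℝ → ℝ := fun h => 1 / (2 * v h) - 1 / 2 with hφ₂
  have hlogc : Continuous fun h => Real.log (v h) := hvc.log hv0'
  have h2v : ∀ h, 2 * v h ≠ 0 := fun h => mul_ne_zero two_ne_zero (hv0' h)
  have hφ₀c : ∀ t x, Continuous (φ₀ t x) := fun t x =>
    (continuous_const.mul hlogc).add (Continuous.div (by fun_prop) (by fun_prop) h2v)
  have hφ₁c : ∀ t x, Continuous (φ₁ t x) := fun t x => Continuous.div (by fun_prop) hvc hv0'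
  have hφ₂c : Continuous φ₂ :=
    (Continuous.div continuous_const (by fun_prop) h2v).sub continuous_const
  have hquad : ∀ t x (r : Ω × ℝ),
      ℓ t x (H₁ r.1 * p t x + H₂ r.1 * q t x + r.2, H₁ r.1, H₂ r.1) =
      φ₀ t x (H₁ r.1, H₂ r.1) + φ₁ t x (H₁ r.1, H₂ r.1) * r.2 + φ₂ (H₁ r.1, H₂ r.1) * r.2 ^ 2 :=
    fun t x r => by
      have := hv0' (H₁ r.1, H₂ r.1)
      simp only [hℓ, hφ₀, hφ₁, hφ₂]
      field_simp
      ring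
  have hQ := fun t x => integral_quadratic_gaussian (hint _ (hφ₀c t x)) (hint _ (hφ₁c t x))
    (hint _ hφ₂c)
  refine ⟨fun t => (P.prod (gaussianReal 0 1)).map fun r =>
      ((H₁ r.1 * c₁ t + H₂ r.1 * c₂ t) + √(v (H₁ r.1, H₂ r.1)) * r.2, H₁ r.1, H₂ r.1),
    fun t x y => ENNReal.ofReal (Real.exp (ℓ t x y)), ℓ, fun t => ?_, fun t x => ?_, hℓm,
    fun t x => ?_, fun t x y => le_rfl, fun t x => ?_, fun x hx => ?_⟩
  · have := hvc.measurable
    exact Measure.isProbabilityMeasure_map (by fun_prop)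
  · have := hℓm t x
    fun_prop
  · have hexp : Measurable fun y => ENNReal.ofReal (Real.exp (ℓ t x y)) := by
      have := hℓm t x
      fun_prop
    ext S hS
    have h1 := lintegral_map_gaussian (P := P) hH₁ hH₂ (a := fun h => h.1 * p t x + h.2 * q t x)
      (s := fun _ => 1) (by fun_prop) (by fun_prop) (F := S.indicator 1)
      (measurable_one.indicator hS)
    have h2 := lintegral_map_gaussian (P := P) hH₁ hH₂
      (a := fun h => h.1 * c₁ t + h.2 * c₂ t) (s := fun h => √(v h)) (by fun_prop)
      hvc.measurable.sqrt (F := S.indicator fun y => ENNReal.ofReal (Real.exp (ℓ t x y)))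
      (hexp.indicator hS)
    simp only [gaussianLaw]
    rw [withDensity_apply _ hS, ← lintegral_indicator hS, h2,
      ← lintegral_indicator_one hS]
    simp only [one_mul] at h1
    rw [h1]
    refine lintegral_congr fun ω => ?_
    rw [Real.sq_sqrt (hv0 _).le, one_pow, Real.toNNReal_one, gaussianReal_eq_withDensity
      (H₁ ω * p t x + H₂ ω * q t x) (H₁ ω * c₁ t + H₂ ω * c₂ t) (hv0 (H₁ ω, H₂ ω)),
      lintegral_withDensity_eq_lintegral_mul _ (by fun_prop)
        (g := fun y => S.indicator 1 (y, H₁ ω, H₂ ω))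
        ((measurable_one.indicator hS).comp (by fun_prop))]
    refine lintegral_congr fun y => ?_
    by_cases hy : (y, H₁ ω, H₂ ω) ∈ S
    · simp [hy, hℓ]
    · simp [hy]
  · simp only [gaussianLaw]
    rw [integrable_map_measure (hℓm t x).aestronglyMeasurable (hmap t x).aemeasurable]
    exact (hQ t x).1.congr (ae_of_all _ fun r => (hquad t x r).symm)
  · have hmean : ∀ t x, ∫ y, ℓ t x y ∂gaussianLaw P H₁ H₂ (p t x) (q t x) ≤
        ∫ ω, 1 / 2 * Real.log (v (H₁ ω, H₂ ω)) ∂P + ∫ ω, φ₂ (H₁ ω, H₂ ω) ∂P +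
        ((∫ ω, H₁ ω ^ 2 / v (H₁ ω, H₂ ω) ∂P) * (p t x - c₁ t) ^ 2 +
        (∫ ω, H₂ ω ^ 2 / v (H₁ ω, H₂ ω) ∂P) * (q t x - c₂ t) ^ 2) := by
      intro t x
      have hc1 : Continuous fun h : ℝ × ℝ => h.1 ^ 2 / v h := Continuous.div (by fun_prop) hvc hv0'
      have hc2 : Continuous fun h : ℝ × ℝ => h.2 ^ 2 / v h := Continuous.div (by fun_prop) hvc hv0'
      have i0 := hint (fun h => 1 / 2 * Real.log (v h)) (by fun_prop)
      have i1 : Integrable (fun ω => H₁ ω ^ 2 / v (H₁ ω, H₂ ω) * (p t x - c₁ t) ^ 2) P :=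
        (hint _ hc1).mul_const _
      have i2 : Integrable (fun ω => H₂ ω ^ 2 / v (H₁ ω, H₂ ω) * (q t x - c₂ t) ^ 2) P :=
        (hint _ hc2).mul_const _
      have i12 : Integrable (fun ω => H₁ ω ^ 2 / v (H₁ ω, H₂ ω) * (p t x - c₁ t) ^ 2 +
        H₂ ω ^ 2 / v (H₁ ω, H₂ ω) * (q t x - c₂ t) ^ 2) P := i1.add i2
      have hφ₀le : ∫ ω, φ₀ t x (H₁ ω, H₂ ω) ∂P ≤ ∫ ω, 1 / 2 * Real.log (v (H₁ ω, H₂ ω)) ∂P +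
          ((∫ ω, H₁ ω ^ 2 / v (H₁ ω, H₂ ω) ∂P) * (p t x - c₁ t) ^ 2 +
          (∫ ω, H₂ ω ^ 2 / v (H₁ ω, H₂ ω) ∂P) * (q t x - c₂ t) ^ 2) := by
        rw [← integral_mul_const, ← integral_mul_const, ← integral_add i1 i2,
          ← integral_add i0 i12]
        refine integral_mono (hint _ (hφ₀c t x)) (i0.add i12) fun ω => ?_
        have hpos := hv0 (H₁ ω, H₂ ω)
        simp only [hφ₀, add_le_add_iff_left]
        rw [div_mul_eq_mul_div, div_mul_eq_mul_div, ← add_div, div_le_div_iff₀ (by positivity) hpos]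
        nlinarith [mul_nonneg hpos.le
          (sq_nonneg (H₁ ω * (p t x - c₁ t) - H₂ ω * (q t x - c₂ t)))]
      have heq : ∫ y, ℓ t x y ∂gaussianLaw P H₁ H₂ (p t x) (q t x) =
          ∫ ω, φ₀ t x (H₁ ω, H₂ ω) ∂P + ∫ ω, φ₂ (H₁ ω, H₂ ω) ∂P := by
        rw [← (hQ t x).2, gaussianLaw, integral_map (hmap t x).aemeasurable
          (hℓm t x).aestronglyMeasurable]
        exact integral_congr_ae (ae_of_all _ fun r => hquad t x r)
      linarith
    -- the normalisation of `v` makes the quadratic terms cancel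
    have hcancel : ∫ ω, φ₂ (H₁ ω, H₂ ω) ∂P + ((∫ ω, H₁ ω ^ 2 / v (H₁ ω, H₂ ω) ∂P) * g₁ +
        (∫ ω, H₂ ω ^ 2 / v (H₁ ω, H₂ ω) ∂P) * g₂) = 0 := by
      have hc1 : Continuous fun h : ℝ × ℝ => h.1 ^ 2 / v h := Continuous.div (by fun_prop) hvc hv0'
      have hc2 : Continuous fun h : ℝ × ℝ => h.2 ^ 2 / v h := Continuous.div (by fun_prop) hvc hv0'
      have i1 : Integrable (fun ω => H₁ ω ^ 2 / v (H₁ ω, H₂ ω) * g₁) P := (hint _ hc1).mul_const _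
      have i2 : Integrable (fun ω => H₂ ω ^ 2 / v (H₁ ω, H₂ ω) * g₂) P := (hint _ hc2).mul_const _
      have i12 : Integrable (fun ω => H₁ ω ^ 2 / v (H₁ ω, H₂ ω) * g₁ +
        H₂ ω ^ 2 / v (H₁ ω, H₂ ω) * g₂) P := i1.add i2
      rw [← integral_mul_const, ← integral_mul_const, ← integral_add i1 i2,
        ← integral_add (hint _ hφ₂c) i12, ← integral_zero Ω ℝ (μ := P)]
      refine integral_congr_ae (ae_of_all _ fun ω => ?_)
      have hne := hv0' (H₁ ω, H₂ ω)
      simp only [hφ₂]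
      field_simp
      simp only [hv]
      ring
    have hβ₁ : 0 ≤ ∫ ω, H₁ ω ^ 2 / v (H₁ ω, H₂ ω) ∂P :=
      integral_nonneg fun ω => div_nonneg (sq_nonneg _) (hv0 _).le
    have hβ₂ : 0 ≤ ∫ ω, H₂ ω ^ 2 / v (H₁ ω, H₂ ω) ∂P :=
      integral_nonneg fun ω => div_nonneg (sq_nonneg _) (hv0 _).le
    refine (Finset.sum_le_sum fun t _ => hmean t (x t)).trans ?_
    rw [Finset.sum_add_distrib, Finset.sum_add_distrib, Finset.sum_add_distrib, ← Finset.mul_sum,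
      ← Finset.mul_sum]
    simp only [Finset.sum_const, Finset.card_univ, Fintype.card_fin, nsmul_eq_mul]
    have e1 := mul_le_mul_of_nonneg_left (hA₁ x hx) hβ₁
    have e2 := mul_le_mul_of_nonneg_left (hA₂ x hx) hβ₂
    have e3 := congrArg (fun r => (n : ℝ) * r) hcancel
    simp only [mul_zero] at e3
    simp only [hv] at e1 e2 e3 ⊢
    nlinarith [e1, e2, e3]

end GaussianConverse

/-! ### The deterministic channel with uniform inputs -/

instance : DiscreteMeasurableSpace DetOutput where
  forall_measurableSet s := MeasurableSpace.measurableSet_iInf.2 fun m =>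
    (MeasurableSet.of_discrete : MeasurableSet (Sigma.mk m ⁻¹' s))

/-- The law of `n` independent fair bits. -/
noncomputable def uniformBits (n : ℕ) : Measure (Fin n → ZMod 2) :=
  Measure.pi fun _ => (PMF.uniformOfFintype (ZMod 2)).toMeasure

instance (n : ℕ) : IsProbabilityMeasure (uniformBits n) := by
  unfold uniformBits; infer_instance

lemma uniformBits_cylinder {n m : ℕ} (hm : m ≤ n) (v : Fin n → ZMod 2) :
    uniformBits n {x | ∀ i : Fin n, (i : ℕ) < m → x i = v i} = (2⁻¹ : ENNReal) ^ m := by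
  have hset : {x : Fin n → ZMod 2 | ∀ i : Fin n, (i : ℕ) < m → x i = v i} =
      Set.univ.pi fun i : Fin n => if (i : ℕ) < m then {v i} else Set.univ := by
    ext x
    simp only [Set.mem_ofPred_eq, Set.mem_pi, Set.mem_univ, forall_true_left]
    refine forall_congr' fun i => ?_
    by_cases h : (i : ℕ) < m <;> simp [h]
  have hval : ∀ i : Fin n, (PMF.uniformOfFintype (ZMod 2)).toMeasure
      (if (i : ℕ) < m then {v i} else Set.univ) = if (i : ℕ) < m then 2⁻¹ else 1 := fun i => by
    by_cases h : (i : ℕ) < m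
    · simp only [h, if_true]
      rw [PMF.toMeasure_apply_singleton _ _ (measurableSet_singleton _)]
      simp [ZMod.card]
    · simp only [h, if_false, measure_univ]
  rw [hset, uniformBits, Measure.pi_pi]
  simp_rw [hval]
  rw [Finset.prod_ite, Finset.prod_const, Finset.prod_const_one, mul_one]
  congr 1
  rw [Fin.card_filter_val_lt, min_eq_right hm]

lemma bit_natCast_add_one {n : ℕ} (x : Fin n → ZMod 2) (i : Fin n) :
    bit x (((i : ℕ) : ℤ) + 1) = x i := by
  unfold bit
  rw [dif_pos (by omega)]
  congr 1
  ext
  simp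

lemma bit_eq_zero {n : ℕ} (x : Fin n → ZMod 2) {j : ℤ} (hj : j ≤ 0) : bit x j = 0 := by
  unfold bit
  rw [dif_neg (by omega)]

lemma received_eq_iff {n₁ n₂ : ℕ} (m₁ m₂ : ℕ) (x₁ x₁' : Fin n₁ → ZMod 2)
    (x₂ x₂' : Fin n₂ → ZMod 2) : received m₁ m₂ x₁' x₂' = received m₁ m₂ x₁ x₂ ↔
      ∀ k : ℕ, k < max m₁ m₂ → bit x₁' (k + 1 - ((max m₁ m₂ : ℕ) - (m₁ : ℤ))) +
        bit x₂' (k + 1 - ((max m₁ m₂ : ℕ) - (m₂ : ℤ))) =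
        bit x₁ (k + 1 - ((max m₁ m₂ : ℕ) - (m₁ : ℤ))) +
        bit x₂ (k + 1 - ((max m₁ m₂ : ℕ) - (m₂ : ℤ))) := by
  rw [funext_iff]
  exact ⟨fun h k hk => h ⟨k, hk⟩, fun h i => h i i.2⟩

lemma received_eq_comm {n₁ n₂ : ℕ} (m₁ m₂ : ℕ) (x₁ x₁' : Fin n₁ → ZMod 2)
    (x₂ x₂' : Fin n₂ → ZMod 2) : received m₁ m₂ x₁' x₂' = received m₁ m₂ x₁ x₂ ↔
      received m₂ m₁ x₂' x₁' = received m₂ m₁ x₂ x₁ := by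
  rw [received_eq_iff, received_eq_iff, max_comm]
  simp only [add_comm (bit x₁' _), add_comm (bit x₁ _)]

/-- The received word pins down the `m₁` leading bits of user `1`, once the word of user `2` is
known or is the weaker one. -/
lemma received_eq_iff_left {n₁ n₂ m₁ m₂ : ℕ} (hm₁ : m₁ ≤ n₁) (x₁ x₁' : Fin n₁ → ZMod 2)
    (x₂ x₂' : Fin n₂ → ZMod 2) (h : x₂' = x₂ ∨ m₂ ≤ m₁) :
    received m₁ m₂ x₁' x₂' = received m₁ m₂ x₁ x₂ ↔ ∀ i : Fin n₁, (i : ℕ) < m₁ →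
      x₁' i = x₁ i + bit x₂ ((i : ℕ) + 1 + m₂ - m₁) - bit x₂' ((i : ℕ) + 1 + m₂ - m₁) := by
  rw [received_eq_iff]
  constructor
  · intro H i hi
    have h1 := H (i + (max m₁ m₂ - m₁)) (by omega)
    have e1 : (((i : ℕ) + (max m₁ m₂ - m₁) : ℕ) : ℤ) + 1 - ((max m₁ m₂ : ℕ) - (m₁ : ℤ)) =
        (i : ℕ) + 1 := by omega
    have e2 : (((i : ℕ) + (max m₁ m₂ - m₁) : ℕ) : ℤ) + 1 - ((max m₁ m₂ : ℕ) - (m₂ : ℤ)) =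
        (i : ℕ) + 1 + m₂ - m₁ := by omega
    rw [e1, e2, bit_natCast_add_one, bit_natCast_add_one] at h1
    rw [← h1, add_sub_cancel_right]
  · intro H k hk
    by_cases hj : max m₁ m₂ - m₁ ≤ k
    · have hi : k - (max m₁ m₂ - m₁) < n₁ := by omega
      have h1 := H ⟨k - (max m₁ m₂ - m₁), hi⟩ (by simp only; omega)
      have e1 : (k : ℤ) + 1 - ((max m₁ m₂ : ℕ) - (m₁ : ℤ)) =
          ((⟨k - (max m₁ m₂ - m₁), hi⟩ : Fin n₁) : ℕ) + 1 := by simp only; omega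
      have e2 : (k : ℤ) + 1 - ((max m₁ m₂ : ℕ) - (m₂ : ℤ)) =
          ((⟨k - (max m₁ m₂ - m₁), hi⟩ : Fin n₁) : ℕ) + 1 + m₂ - m₁ := by simp only; omega
      rw [e1, e2, bit_natCast_add_one, bit_natCast_add_one, h1, sub_add_cancel]
    · obtain rfl : x₂' = x₂ := h.resolve_right (by omega)
      rw [bit_eq_zero x₁' (by omega), bit_eq_zero x₁ (by omega)]

lemma uniformBits_received_left {n₁ n₂ m₁ m₂ : ℕ} (hm₁ : m₁ ≤ n₁) (x₁ : Fin n₁ → ZMod 2)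
    (x₂ x₂' : Fin n₂ → ZMod 2) (h : x₂' = x₂ ∨ m₂ ≤ m₁) :
    uniformBits n₁ {x₁' | received m₁ m₂ x₁' x₂' = received m₁ m₂ x₁ x₂} =
      (2⁻¹ : ENNReal) ^ m₁ := by
  simp_rw [received_eq_iff_left hm₁ x₁ _ x₂ x₂' h]
  exact uniformBits_cylinder hm₁ _

lemma uniformBits_received_right {n₁ n₂ m₁ m₂ : ℕ} (hm₂ : m₂ ≤ n₂) (x₁ x₁' : Fin n₁ → ZMod 2)
    (x₂ : Fin n₂ → ZMod 2) (h : x₁' = x₁ ∨ m₁ ≤ m₂) :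
    uniformBits n₂ {x₂' | received m₁ m₂ x₁' x₂' = received m₁ m₂ x₁ x₂} =
      (2⁻¹ : ENNReal) ^ m₂ := by
  simp_rw [received_eq_comm m₁ m₂]
  exact uniformBits_received_left hm₂ x₂ x₁ x₁' h

lemma uniformBits_prod_received {n₁ n₂ m₁ m₂ : ℕ} (hm₁ : m₁ ≤ n₁) (hm₂ : m₂ ≤ n₂)
    (x₁ : Fin n₁ → ZMod 2) (x₂ : Fin n₂ → ZMod 2) :
    ((uniformBits n₁).prod (uniformBits n₂))
      {x' | received m₁ m₂ x'.1 x'.2 = received m₁ m₂ x₁ x₂} = (2⁻¹ : ENNReal) ^ max m₁ m₂ := by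
  rcases le_total m₂ m₁ with h | h
  · rw [Measure.prod_apply_symm .of_discrete]
    refine (lintegral_congr fun x₂' => uniformBits_received_left hm₁ x₁ x₂ x₂' (.inr h)).trans ?_
    simp [max_eq_left h]
  · rw [Measure.prod_apply .of_discrete]
    refine (lintegral_congr fun x₁' => uniformBits_received_right hm₂ x₁ x₁' x₂ (.inr h)).trans ?_
    simp [max_eq_right h]

/-! ### Converse bounds for the fading deterministic channel -/

section DetConverse

variable {Ω : Type*} [MeasurableSpace Ω] {P : Measure Ω} [IsProbabilityMeasure P]
  {n₁ n₂ : ℕ} {M₁ M₂ : Ω → ℕ}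

lemma isProbabilityMeasure_detLaw (hM₁ : Measurable M₁) (hM₂ : Measurable M₂)
    (x₁ : Fin n₁ → ZMod 2) (x₂ : Fin n₂ → ZMod 2) :
    IsProbabilityMeasure (detLaw P n₁ n₂ M₁ M₂ x₁ x₂) := by
  have h : Measurable fun m : ℕ × ℕ => (⟨m, received m.1 m.2 x₁ x₂⟩ : DetOutput) := .of_discrete
  exact Measure.isProbabilityMeasure_map (h.comp (hM₁.prodMk hM₂)).aemeasurable

/-- The reference law is the output law for random inputs of law `ρ`. If such an input is mistaken
for the true one with probability `2 ^ (-e m)` in the fading state `m`, the true output law has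
density at most `2 ^ e m` with respect to it. -/
lemma informationLE_det {X : Type*} [MeasurableSpace X] [DiscreteMeasurableSpace X] [Countable X]
    {ρ : Measure X} [IsProbabilityMeasure ρ] {n : ℕ} {A : Set (Fin n → X)}
    (hM₁ : Measurable M₁) (hM₂ : Measurable M₂)
    (hle₁ : ∀ ω, M₁ ω ≤ n₁) (hle₂ : ∀ ω, M₂ ω ≤ n₂) (e : ℕ × ℕ → ℕ)
    (r : Fin n → (m : ℕ × ℕ) → X → (Fin (max m.1 m.2) → ZMod 2))
    (hr : ∀ t m x, m.1 ≤ n₁ → m.2 ≤ n₂ → ρ {x' | r t m x' = r t m x} = (2⁻¹ : ENNReal) ^ e m) :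
    InformationLE (fun t x => P.map fun ω => (⟨(M₁ ω, M₂ ω), r t (M₁ ω, M₂ ω) x⟩ : DetOutput)) A
      (n * ∫ ω, (e (M₁ ω, M₂ ω) : ℝ) * Real.log 2 ∂P) := by
  classical
  have hpair : Measurable fun ω => (M₁ ω, M₂ ω) := hM₁.prodMk hM₂
  have hmap : ∀ t x, Measurable fun ω => (⟨(M₁ ω, M₂ ω), r t (M₁ ω, M₂ ω) x⟩ : DetOutput) :=
    fun t x => (Measurable.of_discrete (f := fun m : ℕ × ℕ => (⟨m, r t m x⟩ : DetOutput))).comp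
      hpair
  have hmap2 : ∀ t, Measurable fun p : Ω × X =>
      (⟨(M₁ p.1, M₂ p.1), r t (M₁ p.1, M₂ p.1) p.2⟩ : DetOutput) := fun t =>
    (Measurable.of_discrete (f := fun q : (ℕ × ℕ) × X => (⟨q.1, r t q.1 q.2⟩ : DetOutput))).comp
      ((hpair.comp measurable_fst).prodMk measurable_snd)
  obtain ⟨B, hB⟩ : ∃ B : ℝ, ∀ ω, ‖(e (M₁ ω, M₂ ω) : ℝ) * Real.log 2‖ ≤ B := by
    obtain ⟨B, hB⟩ := (((Set.finite_Iic n₁).prod (Set.finite_Iic n₂)).image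
      fun m => ‖(e m : ℝ) * Real.log 2‖).bddAbove
    exact ⟨B, fun ω => hB ⟨(M₁ ω, M₂ ω), ⟨hle₁ ω, hle₂ ω⟩, rfl⟩⟩
  refine ⟨fun t => (P.prod ρ).map fun p => ⟨(M₁ p.1, M₂ p.1), r t (M₁ p.1, M₂ p.1) p.2⟩,
    fun t x y => if y.2 = r t y.1 x then 2 ^ e y.1 else 0, fun t x y => e y.1 * Real.log 2,
    fun t => Measure.isProbabilityMeasure_map (hmap2 t).aemeasurable,
    fun t x => .of_discrete, fun t x => .of_discrete, fun t x => ?_, fun t x y => ?_,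
    fun t x => ?_, fun x _ => ?_⟩
  · ext S hS
    have hprod := lintegral_prod (μ := P) (ν := ρ) _ ((Measurable.of_discrete (f := S.indicator
      fun y : DetOutput => if y.2 = r t y.1 x then (2 : ENNReal) ^ e y.1 else 0)).comp
        (hmap2 t)).aemeasurable
    simp only [Function.comp_apply] at hprod
    rw [withDensity_apply _ hS, ← lintegral_indicator hS, lintegral_map .of_discrete (hmap2 t),
      hprod, ← lintegral_indicator_one hS, lintegral_map .of_discrete (hmap t x)]
    refine lintegral_congr fun ω => ?_
    by_cases hω : (⟨(M₁ ω, M₂ ω), r t (M₁ ω, M₂ ω) x⟩ : DetOutput) ∈ S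
    · have h1 : ∀ x', S.indicator (fun y : DetOutput => if y.2 = r t y.1 x then
          (2 : ENNReal) ^ e y.1 else 0) ⟨(M₁ ω, M₂ ω), r t (M₁ ω, M₂ ω) x'⟩ =
          {x' | r t (M₁ ω, M₂ ω) x' = r t (M₁ ω, M₂ ω) x}.indicator
            (fun _ => (2 : ENNReal) ^ e (M₁ ω, M₂ ω)) x' := fun x' => by
        by_cases hx : r t (M₁ ω, M₂ ω) x' = r t (M₁ ω, M₂ ω) x
        · rw [Set.indicator_of_mem (by rw [hx]; exact hω), Set.indicator_of_mem (by exact hx),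
            if_pos hx]
        · rw [Set.indicator_apply, if_neg hx, ite_self, Set.indicator_of_notMem (by exact hx)]
      simp_rw [h1]
      rw [lintegral_indicator_const .of_discrete, hr _ _ _ (hle₁ ω) (hle₂ ω), ← mul_pow,
        ENNReal.mul_inv_cancel two_ne_zero ENNReal.ofNat_ne_top, one_pow, Set.indicator_of_mem hω,
        Pi.one_apply]
    · have h1 : ∀ x', S.indicator (fun y : DetOutput => if y.2 = r t y.1 x then
          (2 : ENNReal) ^ e y.1 else 0) ⟨(M₁ ω, M₂ ω), r t (M₁ ω, M₂ ω) x'⟩ = 0 := fun x' => by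
        by_cases hx : r t (M₁ ω, M₂ ω) x' = r t (M₁ ω, M₂ ω) x
        · rw [Set.indicator_of_notMem (by rw [hx]; exact hω)]
        · rw [Set.indicator_apply, if_neg hx, ite_self]
      simp_rw [h1]
      rw [lintegral_zero, Set.indicator_of_notMem hω]
  · beta_reduce
    split_ifs
    · rw [Real.exp_nat_mul, Real.exp_log two_pos, ENNReal.ofReal_pow zero_le_two,
        ENNReal.ofReal_ofNat]
    · exact zero_le
  · rw [integrable_map_measure (Measurable.of_discrete).aestronglyMeasurable
      (hmap t x).aemeasurable]
    exact Integrable.of_bound ((Measurable.of_discrete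
      (f := fun m : ℕ × ℕ => (e m : ℝ) * Real.log 2)).comp hpair).aestronglyMeasurable B
      (ae_of_all _ hB)
  · refine le_of_eq ?_
    have h1 : ∀ t, ∫ y : DetOutput, (e y.1 : ℝ) * Real.log 2
        ∂(P.map fun ω => (⟨(M₁ ω, M₂ ω), r t (M₁ ω, M₂ ω) (x t)⟩ : DetOutput)) =
        ∫ ω, (e (M₁ ω, M₂ ω) : ℝ) * Real.log 2 ∂P := fun t =>
      integral_map (hmap t _).aemeasurable (Measurable.of_discrete).aestronglyMeasurable
    simp_rw [h1]
    simp

end DetConverse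

/-! ### Random coding -/

section PairwiseError

variable {Ω X Y Z : Type*} [MeasurableSpace Ω] [MeasurableSpace X] [MeasurableSpace Y]
  [MeasurableSpace Z]

/-- The bound for the probability, given the fading state `ω`, that in one channel use the letter
`x'` has at least the score of the letter `x` sent: the mean over the noise `z` of the ratio of the
two scores. -/
noncomputable def scoreRatio (η : Measure Z) (g : X → Ω → Z → Y) (u : X → Y → NNReal)
    (x x' : X) (ω : Ω) : ENNReal :=
  ∫⁻ z, (u x' (g x ω z) / u x (g x ω z) : NNReal) ∂η

variable {P : Measure Ω} [IsProbabilityMeasure P] {η : Measure Z} [IsProbabilityMeasure η]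
  {g : X → Ω → Z → Y} {u : X → Y → NNReal}

lemma measurable_scoreRatio (hg : Measurable fun p : X × Ω × Z => g p.1 p.2.1 p.2.2)
    (hu : Measurable fun p : X × Y => u p.1 p.2) :
    Measurable fun p : X × X × Ω => scoreRatio η g u p.1 p.2.1 p.2.2 := by
  have h1 : Measurable fun q : (X × X × Ω) × Z => g q.1.1 q.1.2.2 q.2 :=
    hg.comp (f := fun q : (X × X × Ω) × Z => (q.1.1, q.1.2.2, q.2)) (by fun_prop)
  have h2 : Measurable fun q : (X × X × Ω) × Z => u q.1.2.1 (g q.1.1 q.1.2.2 q.2) :=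
    hu.comp (f := fun q : (X × X × Ω) × Z => (q.1.2.1, g q.1.1 q.1.2.2 q.2)) (by fun_prop)
  have h3 : Measurable fun q : (X × X × Ω) × Z => u q.1.1 (g q.1.1 q.1.2.2 q.2) :=
    hu.comp (f := fun q : (X × X × Ω) × Z => (q.1.1, g q.1.1 q.1.2.2 q.2)) (by fun_prop)
  exact (h2.div h3).coe_nnreal_ennreal.lintegral_prod_right'

/-- Union bound and Markov's inequality, applied to the product of the score ratios given the fading
states. -/
lemma pi_exists_score_le {M : Type*} [Fintype M] [DecidableEq M] {n : ℕ}
    (hg : Measurable fun p : X × Ω × Z => g p.1 p.2.1 p.2.2)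
    (hu : Measurable fun p : X × Y => u p.1 p.2) (hpos : ∀ x ω z, u x (g x ω z) ≠ 0)
    (x : M → Fin n → X) (w : M) :
    (Measure.pi fun t : Fin n => (P.prod η).map fun p => g (x w t) p.1 p.2)
        {y | ∃ w' ≠ w, ∏ t, u (x w t) (y t) ≤ ∏ t, u (x w' t) (y t)} ≤
      ∫⁻ ω, min 1 (∑ w' ∈ {w' | w' ≠ w}, ∏ t, scoreRatio η g u (x w t) (x w' t) (ω t))
        ∂(Measure.pi fun _ : Fin n => P) := by
  have hgx : ∀ a, Measurable fun p : Ω × Z => g a p.1 p.2 := fun a =>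
    hg.comp (measurable_const.prodMk measurable_id)
  have hux : ∀ a, Measurable (u a) := fun a => hu.comp (measurable_const.prodMk measurable_id)
  have hprob : ∀ t, IsProbabilityMeasure ((P.prod η).map fun p => g (x w t) p.1 p.2) :=
    fun t => Measure.isProbabilityMeasure_map (hgx _).aemeasurable
  have hS : MeasurableSet {y : Fin n → Y | ∃ w' ≠ w,
      ∏ t, u (x w t) (y t) ≤ ∏ t, u (x w' t) (y t)} := by
    have : {y : Fin n → Y | ∃ w' ≠ w, ∏ t, u (x w t) (y t) ≤ ∏ t, u (x w' t) (y t)} =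
        ⋃ w' ∈ {w' | w' ≠ w}, {y | ∏ t, u (x w t) (y t) ≤ ∏ t, u (x w' t) (y t)} := by
      ext y; simp
    rw [this]
    refine MeasurableSet.biUnion (Set.to_countable _) fun w' _ => ?_
    exact measurableSet_le
      (Finset.measurable_fun_prod _ fun t _ => (hux _).comp (measurable_pi_apply t))
      (Finset.measurable_fun_prod _ fun t _ => (hux _).comp (measurable_pi_apply t))
  have hmap : Measurable fun (s : Fin n → Ω × Z) t => g (x w t) (s t).1 (s t).2 :=
    measurable_pi_lambda _ fun t => (hgx _).comp (measurable_pi_apply t)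
  rw [← Measure.pi_map_pi (μ := fun _ : Fin n => P.prod η) fun t => (hgx (x w t)).aemeasurable,
    Measure.map_apply hmap hS]
  have harr := measurePreserving_arrowProdEquivProdArrow Ω Z (Fin n) (fun _ => P) (fun _ => η)
  rw [← harr.symm.measure_preimage (hmap hS).nullMeasurableSet,
    Measure.prod_apply ((harr.symm.measurable) (hmap hS))]
  refine lintegral_mono fun ω => le_min prob_le_one ?_
  set ρ : M → (Fin n → Z) → ENNReal := fun w' z => ∏ t,
    ((u (x w' t) (g (x w t) (ω t) (z t)) / u (x w t) (g (x w t) (ω t) (z t)) : NNReal) : ENNReal)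
    with hρ
  have hρ1 : ∀ w' t, Measurable fun z => ((u (x w' t) (g (x w t) (ω t) z) /
      u (x w t) (g (x w t) (ω t) z) : NNReal) : ENNReal) := fun w' t => by
    have hgz : Measurable fun z => g (x w t) (ω t) z :=
      (hgx (x w t)).comp (measurable_const.prodMk measurable_id)
    exact (((hux _).comp hgz).div ((hux _).comp hgz)).coe_nnreal_ennreal
  have hρm : ∀ w', Measurable (ρ w') := fun w' =>
    Finset.measurable_fun_prod _ fun t _ => (hρ1 w' t).comp (measurable_pi_apply t)
  calc _ ≤ (Measure.pi fun _ : Fin n => η)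
          (⋃ w' ∈ ({w' | w' ≠ w} : Finset M), {z | 1 ≤ ρ w' z}) := by
        refine measure_mono fun z hz => ?_
        obtain ⟨w', hw', hle⟩ := hz
        simp only [Set.mem_iUnion]
        refine ⟨w', by simpa using hw', ?_⟩
        have hle' : ∏ t, u (x w t) (g (x w t) (ω t) (z t)) ≤
          ∏ t, u (x w' t) (g (x w t) (ω t) (z t)) := hle
        have h1 : (1 : NNReal) ≤ ∏ t, (u (x w' t) (g (x w t) (ω t) (z t)) /
            u (x w t) (g (x w t) (ω t) (z t))) := by
          rw [Finset.prod_div_distrib, one_le_div]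
          · exact hle'
          · exact pos_iff_ne_zero.2 (Finset.prod_ne_zero_iff.2 fun t _ => hpos _ _ _)
        show (1 : ENNReal) ≤ ρ w' z
        simp only [hρ]
        exact_mod_cast h1
    _ ≤ ∑ w' ∈ {w' | w' ≠ w}, (Measure.pi fun _ : Fin n => η) {z | 1 ≤ ρ w' z} :=
        measure_biUnion_finset_le _ _
    _ ≤ ∑ w' ∈ {w' | w' ≠ w}, ∫⁻ z, ρ w' z ∂(Measure.pi fun _ : Fin n => η) := by
        refine Finset.sum_le_sum fun w' _ => ?_
        simpa using mul_meas_ge_le_lintegral (μ := Measure.pi fun _ : Fin n => η) (hρm w') 1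
    _ = _ := by
        refine Finset.sum_congr rfl fun w' _ => ?_
        exact lintegral_pi_prod (fun _ : Fin n => η) (fun t => hρ1 w' t)

end PairwiseError

section Codebook

variable {M X : Type*} [Fintype M] [MeasurableSpace X] {ν : Measure X} [IsProbabilityMeasure ν]
  {n : ℕ}

/-- The law of a codebook of words of length `n` for the messages `M`, with independent letters of
law `ν`. -/
noncomputable def codebook (M : Type*) [Fintype M] (n : ℕ) (ν : Measure X) :
    Measure (M → Fin n → X) :=
  Measure.pi fun _ => Measure.pi fun _ => ν

instance : IsProbabilityMeasure (codebook M n ν) := by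
  unfold codebook; infer_instance

lemma lintegral_codebook_single (w : M) {h : Fin n → X → ENNReal} (hh : ∀ t, Measurable (h t)) :
    ∫⁻ C, ∏ t, h t (C w t) ∂codebook M n ν = ∏ t, ∫⁻ x, h t x ∂ν := by
  rw [← lintegral_pi_prod (fun _ => ν) hh]
  exact (measurePreserving_eval (fun _ : M => Measure.pi fun _ : Fin n => ν) w).lintegral_comp
    (f := fun a => ∏ t, h t (a t)) (by fun_prop)

lemma lintegral_codebook_pair {w w' : M} (hw : w ≠ w') {h : Fin n → X → X → ENNReal}
    (hh : ∀ t, Measurable (Function.uncurry (h t))) :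
    ∫⁻ C, ∏ t, h t (C w t) (C w' t) ∂codebook M n ν = ∏ t, ∫⁻ x, ∫⁻ x', h t x x' ∂ν ∂ν := by
  have hind : IndepFun (fun C : M → Fin n → X => C w) (fun C => C w') (codebook M n ν) :=
    (iIndepFun_pi (μ := fun _ : M => Measure.pi fun _ : Fin n => ν) (X := fun _ a => a)
      fun _ => aemeasurable_id).indepFun hw
  have hmap := (indepFun_iff_map_prod_eq_prod_map_map (measurable_pi_apply w).aemeasurable
    (measurable_pi_apply w').aemeasurable).1 hind
  have he : ∀ v : M, (codebook M n ν).map (fun C => C v) = Measure.pi fun _ : Fin n => ν :=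
    fun v => (measurePreserving_eval (fun _ : M => Measure.pi fun _ : Fin n => ν) v).map_eq
  rw [he, he] at hmap
  have hm : Measurable fun p : (Fin n → X) × (Fin n → X) => ∏ t, h t (p.1 t) (p.2 t) :=
    Finset.measurable_fun_prod _ fun t _ =>
      (hh t).comp (f := fun p : (Fin n → X) × (Fin n → X) => (p.1 t, p.2 t)) (by fun_prop)
  have h1 : ∫⁻ C, ∏ t, h t (C w t) (C w' t) ∂codebook M n ν =
      ∫⁻ p, ∏ t, h t (p.1 t) (p.2 t)
        ∂((codebook M n ν).map fun C : M → Fin n → X => (C w, C w')) :=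
    (lintegral_map (g := fun C : M → Fin n → X => (C w, C w')) hm
      ((measurable_pi_apply w).prodMk (measurable_pi_apply w'))).symm
  rw [h1, hmap, lintegral_prod _ hm.aemeasurable]
  have h2 : ∀ a : Fin n → X, ∫⁻ a', ∏ t, h t (a t) (a' t) ∂(Measure.pi fun _ : Fin n => ν) =
      ∏ t, ∫⁻ x', h t (a t) x' ∂ν := fun a =>
    lintegral_pi_prod (fun _ => ν) fun t => (hh t).comp (measurable_const.prodMk measurable_id)
  simp_rw [h2]
  exact lintegral_pi_prod (fun _ => ν) fun t => (hh t).lintegral_prod_right'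

end Codebook

/-! ### Exponential decay without a law of large numbers -/

lemma exp_neg_le_quadratic {x : ℝ} (hx : 0 ≤ x) : Real.exp (-x) ≤ 1 - x + x ^ 2 / 2 := by
  have h1 := Real.quadratic_le_exp_of_nonneg hx
  have hq : 0 < 1 + x + x ^ 2 / 2 := by positivity
  rw [Real.exp_neg]
  refine (inv_anti₀ hq h1).trans ?_
  rw [inv_le_iff_one_le_mul₀ hq]
  nlinarith [sq_nonneg (x ^ 2)]

lemma min_one_le_rpow (x : ENNReal) {l : ℝ} (h0 : 0 ≤ l) (h1 : l ≤ 1) : min 1 x ≤ x ^ l := by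
  rcases le_total x 1 with hx | hx
  · refine (min_le_right _ _).trans ?_
    simpa using ENNReal.rpow_le_rpow_of_exponent_ge hx h1
  · refine (min_le_left _ _).trans ?_
    simpa using ENNReal.rpow_le_rpow hx h0

/-- A fractional power `l` of the union bound has a mean that factorises over the channel uses, and
for small `l > 0` the exponent `l (∫ c - r) - O(l²)` per channel use is positive. -/
lemma tendsto_lintegral_min_one {Ω : Type*} [MeasurableSpace Ω] {P : Measure Ω}
    [IsProbabilityMeasure P] {c : Ω → ℝ} (hc : Measurable c) (hc0 : ∀ ω, 0 ≤ c ω) {B : ℝ}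
    (hB : ∀ ω, c ω ≤ B) {N : ℕ → ℕ} {r : ℝ} (hN : ∀ n, (N n : ℝ) ≤ Real.exp (n * r))
    (hr : r < ∫ ω, c ω ∂P) :
    Tendsto (fun n => ∫⁻ ω, min 1 (N n * ∏ t, ENNReal.ofReal (Real.exp (-c (ω t))))
      ∂(Measure.pi fun _ : Fin n => P)) atTop (nhds 0) := by
  set m := ∫ ω, c ω ∂P with hm
  have hcint : Integrable c P := Integrable.of_bound hc.aestronglyMeasurable B
    (ae_of_all _ fun ω => by rw [Real.norm_of_nonneg (hc0 ω)]; exact hB ω)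
  obtain ⟨l, hl0, hl1, hl⟩ : ∃ l : ℝ, 0 < l ∧ l ≤ 1 ∧ l * B ^ 2 / 2 < m - r := by
    refine ⟨min 1 ((m - r) / (B ^ 2 + 1)), by
      have : 0 < m - r := by linarith
      positivity, min_le_left _ _, ?_⟩
    have h1 : min 1 ((m - r) / (B ^ 2 + 1)) * (B ^ 2 + 1) ≤ m - r :=
      (mul_le_mul_of_nonneg_right (min_le_right _ _) (by positivity)).trans
        (div_mul_cancel₀ _ (by positivity)).le
    have h2 : 0 < min 1 ((m - r) / (B ^ 2 + 1)) := by
      have : 0 < m - r := by linarith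
      positivity
    nlinarith [sq_nonneg B]
  set κ := l * (m - r) - l ^ 2 * B ^ 2 / 2 with hκ
  have hκ0 : 0 < κ := by
    have : κ = l * (m - r - l * B ^ 2 / 2) := by rw [hκ]; ring
    rw [this]
    exact mul_pos hl0 (by linarith)
  have hmean : ∫⁻ ω, ENNReal.ofReal (Real.exp (-c ω)) ^ l ∂P ≤
      ENNReal.ofReal (Real.exp (-(l * r) - κ)) := by
    have h1 : ∀ ω, ENNReal.ofReal (Real.exp (-c ω)) ^ l ≤
        ENNReal.ofReal (1 - l * c ω + l ^ 2 * B ^ 2 / 2) := fun ω => by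
      rw [ENNReal.ofReal_rpow_of_pos (Real.exp_pos _), ← Real.exp_mul]
      refine ENNReal.ofReal_le_ofReal ?_
      have h2 := exp_neg_le_quadratic (mul_nonneg hl0.le (hc0 ω))
      have h3 : (l * c ω) ^ 2 ≤ l ^ 2 * B ^ 2 := by
        rw [mul_pow]
        exact mul_le_mul_of_nonneg_left (pow_le_pow_left₀ (hc0 ω) (hB ω) 2) (sq_nonneg l)
      rw [show -c ω * l = -(l * c ω) by ring]
      linarith
    have hint : Integrable (fun ω => 1 - l * c ω + l ^ 2 * B ^ 2 / 2) P :=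
      ((integrable_const _).sub (hcint.const_mul l)).add (integrable_const _)
    refine (lintegral_mono h1).trans ?_
    rw [← ofReal_integral_eq_lintegral_ofReal hint (ae_of_all _ fun ω => ?_)]
    · refine ENNReal.ofReal_le_ofReal ?_
      have h4 : ∫ ω, (1 - l * c ω + l ^ 2 * B ^ 2 / 2) ∂P = 1 - l * m + l ^ 2 * B ^ 2 / 2 := by
        rw [integral_add (f := fun ω => 1 - l * c ω)
          ((integrable_const _).sub (hcint.const_mul l)) (integrable_const _),
          integral_sub (integrable_const _) (hcint.const_mul l), integral_const_mul]
        simp [hm]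
      rw [h4]
      have h5 := Real.add_one_le_exp (-(l * r) - κ)
      have h6 : -(l * r) - κ = - l * m + l ^ 2 * B ^ 2 / 2 := by rw [hκ]; ring
      linarith
    · have h2 := exp_neg_le_quadratic (mul_nonneg hl0.le (hc0 ω))
      have h3 : (l * c ω) ^ 2 ≤ l ^ 2 * B ^ 2 := by
        rw [mul_pow]
        exact mul_le_mul_of_nonneg_left (pow_le_pow_left₀ (hc0 ω) (hB ω) 2) (sq_nonneg l)
      have h4 := Real.exp_pos (-(l * c ω))
      simp only [Pi.zero_apply]
      linarith
  have hbound : ∀ n, ∫⁻ ω, min 1 (N n * ∏ t, ENNReal.ofReal (Real.exp (-c (ω t))))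
      ∂(Measure.pi fun _ : Fin n => P) ≤ ENNReal.ofReal (Real.exp (-κ) ^ n) := fun n => by
    have hmeas : Measurable fun ω => ENNReal.ofReal (Real.exp (-c ω)) ^ l := by fun_prop
    calc _ ≤ ∫⁻ ω, (N n : ENNReal) ^ l * ∏ t, ENNReal.ofReal (Real.exp (-c (ω t))) ^ l
            ∂(Measure.pi fun _ : Fin n => P) := lintegral_mono fun ω => by
          refine (min_one_le_rpow _ hl0.le hl1).trans (le_of_eq ?_)
          rw [ENNReal.mul_rpow_of_nonneg _ _ hl0.le, ENNReal.prod_rpow_of_nonneg hl0.le]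
      _ = (N n : ENNReal) ^ l * ∏ _t : Fin n, ∫⁻ ω, ENNReal.ofReal (Real.exp (-c ω)) ^ l ∂P := by
          rw [lintegral_const_mul _ (by fun_prop), lintegral_pi_prod _ fun _ => hmeas]
      _ ≤ ENNReal.ofReal (Real.exp (n * r)) ^ l *
            ∏ _t : Fin n, ENNReal.ofReal (Real.exp (-(l * r) - κ)) := by
          refine mul_le_mul' (ENNReal.rpow_le_rpow ?_ hl0.le)
            (Finset.prod_le_prod' fun _ _ => hmean)
          rw [← ENNReal.ofReal_natCast]
          exact ENNReal.ofReal_le_ofReal (hN n)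
      _ = _ := by
          rw [ENNReal.ofReal_rpow_of_pos (Real.exp_pos _), ← Real.exp_mul, Finset.prod_const,
            Finset.card_univ, Fintype.card_fin, ← ENNReal.ofReal_pow (Real.exp_pos _).le,
            ← ENNReal.ofReal_mul (Real.exp_pos _).le, ← Real.exp_nat_mul, ← Real.exp_nat_mul,
            ← Real.exp_add]
          congr 2
          ring
  refine tendsto_of_tendsto_of_tendsto_of_le_of_le tendsto_const_nhds ?_ (fun _ => zero_le) hbound
  rw [← ENNReal.ofReal_zero]
  exact ENNReal.tendsto_ofReal (tendsto_pow_atTop_nhds_zero_of_lt_one (Real.exp_pos _).le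
    (Real.exp_lt_one_iff.2 (by linarith)))

/-! ### Achievable rates from random coding -/

/-- The mean over the fading states of a union bound over `N` competitors, each of which wins with
probability at most `exp (-∑ t, c (ω t))`. -/
noncomputable def unionBound {Ω : Type*} [MeasurableSpace Ω] (P : Measure Ω) (c : Ω → ℝ)
    (n N : ℕ) : ENNReal :=
  ∫⁻ ω, min 1 (N * ∏ t, ENNReal.ofReal (Real.exp (-c (ω t)))) ∂(Measure.pi fun _ : Fin n => P)

lemma sum_ne_pair_le {A B : Type*} [Fintype A] [Fintype B] [DecidableEq A] [DecidableEq B]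
    (F : A × B → ENNReal) (w : A × B) :
    ∑ w' ∈ {w' | w' ≠ w}, F w' ≤ ∑ a ∈ {a | a ≠ w.1}, F (a, w.2) + ∑ b ∈ {b | b ≠ w.2}, F (w.1, b) +
      ∑ a ∈ {a | a ≠ w.1}, ∑ b ∈ {b | b ≠ w.2}, F (a, b) := by
  have hunion : ∀ s t : Finset (A × B), ∑ x ∈ s ∪ t, F x ≤ ∑ x ∈ s, F x + ∑ x ∈ t, F x :=
    fun s t => (Finset.sum_union_inter (f := F) (s₁ := s) (s₂ := t)) ▸ le_self_add
  set E₁ : Finset A := {a | a ≠ w.1} with hE₁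
  set E₂ : Finset B := {b | b ≠ w.2} with hE₂
  have hsub : ({w' | w' ≠ w} : Finset (A × B)) ⊆ (E₁ ×ˢ {w.2} ∪ {w.1} ×ˢ E₂) ∪ E₁ ×ˢ E₂ := by
    intro w' hw'
    simp only [Finset.mem_filter, Finset.mem_univ, true_and, ne_eq, Prod.ext_iff] at hw'
    simp only [Finset.mem_union, Finset.mem_product, hE₁, hE₂, Finset.mem_filter, Finset.mem_univ,
      true_and, Finset.mem_singleton]
    tauto
  refine (Finset.sum_le_sum_of_subset hsub).trans ((hunion _ _).trans ?_)
  refine add_le_add ((hunion _ _).trans (le_of_eq ?_)) (le_of_eq (Finset.sum_product _ _ _))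
  rw [Finset.sum_product, Finset.sum_product]
  simp

lemma min_one_add_le (a b : ENNReal) : min 1 (a + b) ≤ min 1 a + min 1 b := by
  rcases le_total 1 a with h | h
  · rw [min_eq_left h]
    exact (min_le_left _ _).trans le_self_add
  rcases le_total 1 b with h' | h'
  · rw [min_eq_left h']
    exact (min_le_left _ _).trans le_add_self
  · rw [min_eq_right h, min_eq_right h']
    exact min_le_right _ _

lemma lintegral_min_one_le {α : Type*} [MeasurableSpace α] {μ : Measure α} [IsProbabilityMeasure μ]
    (f : α → ENNReal) : ∫⁻ x, min 1 (f x) ∂μ ≤ min 1 (∫⁻ x, f x ∂μ) :=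
  le_min ((lintegral_mono fun _ => min_le_left _ _).trans (by simp))
    (lintegral_mono fun _ => min_le_right _ _)

section RandomCoding

variable {Ω X₁ X₂ Y Z : Type*} [MeasurableSpace Ω] [MeasurableSpace X₁] [MeasurableSpace X₂]
  [MeasurableSpace Y] [MeasurableSpace Z] {P : Measure Ω} [IsProbabilityMeasure P]
  {ν₁ : Measure X₁} {ν₂ : Measure X₂} [IsProbabilityMeasure ν₁] [IsProbabilityMeasure ν₂]

/-- A wrong message pair is wrong for user `1` only, for user `2` only, or for both; the three cases
are governed by the letter-wise bounds `exp (-c₁)`, `exp (-c₂)` and `exp (-c₁₂)`. -/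
lemma lintegral_codebooks_le {K₁ K₂ n : ℕ} {ρ : X₁ × X₂ → X₁ × X₂ → Ω → ENNReal}
    (hρ : Measurable fun p : (X₁ × X₂) × (X₁ × X₂) × Ω => ρ p.1 p.2.1 p.2.2) {c₁ c₂ c₁₂ : Ω → ℝ}
    (hc₁ : Measurable c₁) (hc₂ : Measurable c₂)
    (h₁ : ∀ ω, ∫⁻ x₁, ∫⁻ x₁', ∫⁻ x₂, ρ (x₁, x₂) (x₁', x₂) ω ∂ν₂ ∂ν₁ ∂ν₁ ≤
      ENNReal.ofReal (Real.exp (-c₁ ω)))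
    (h₂ : ∀ ω, ∫⁻ x₁, ∫⁻ x₂, ∫⁻ x₂', ρ (x₁, x₂) (x₁, x₂') ω ∂ν₂ ∂ν₂ ∂ν₁ ≤
      ENNReal.ofReal (Real.exp (-c₂ ω)))
    (h₁₂ : ∀ ω, ∫⁻ x₁, ∫⁻ x₁', ∫⁻ x₂, ∫⁻ x₂', ρ (x₁, x₂) (x₁', x₂') ω ∂ν₂ ∂ν₂ ∂ν₁ ∂ν₁ ≤
      ENNReal.ofReal (Real.exp (-c₁₂ ω)))
    (w : Fin K₁ × Fin K₂) :
    ∫⁻ C, ∫⁻ ω, min 1 (∑ w' ∈ {w' | w' ≠ w}, ∏ t,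
        ρ (C.1 w.1 t, C.2 w.2 t) (C.1 w'.1 t, C.2 w'.2 t) (ω t)) ∂(Measure.pi fun _ : Fin n => P)
        ∂((codebook (Fin K₁) n ν₁).prod (codebook (Fin K₂) n ν₂)) ≤
      unionBound P c₁ n (K₁ - 1) + unionBound P c₂ n (K₂ - 1) +
        unionBound P c₁₂ n ((K₁ - 1) * (K₂ - 1)) := by
  set 𝒞₁ := codebook (Fin K₁) n ν₁ with h𝒞₁
  set 𝒞₂ := codebook (Fin K₂) n ν₂ with h𝒞₂
  set F : ((Fin K₁ → Fin n → X₁) × (Fin K₂ → Fin n → X₂)) → (Fin n → Ω) → Fin K₁ × Fin K₂ →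
    ENNReal := fun C ω w' => ∏ t, ρ (C.1 w.1 t, C.2 w.2 t) (C.1 w'.1 t, C.2 w'.2 t) (ω t) with hF
  have hFm : ∀ w', Measurable fun p : ((Fin K₁ → Fin n → X₁) × (Fin K₂ → Fin n → X₂)) ×
      (Fin n → Ω) => F p.1 p.2 w' := fun w' => Finset.measurable_fun_prod _ fun t _ =>
    hρ.comp (f := fun p : ((Fin K₁ → Fin n → X₁) × (Fin K₂ → Fin n → X₂)) × (Fin n → Ω) =>
      ((p.1.1 w.1 t, p.1.2 w.2 t), (p.1.1 w'.1 t, p.1.2 w'.2 t), p.2 t)) (by fun_prop)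
  have hFω : ∀ ω w', Measurable fun C => F C ω w' := fun ω w' =>
    (hFm w').comp (measurable_id.prodMk measurable_const)
  have hcard : ∀ {K : ℕ} (v : Fin K), ((Finset.univ.filter fun a => a ≠ v).card) = K - 1 :=
    fun v => by rw [Finset.filter_ne' Finset.univ v, Finset.card_erase_of_mem (Finset.mem_univ v),
      Finset.card_univ, Fintype.card_fin]
  rw [lintegral_lintegral_swap ((measurable_const.min
    (Finset.measurable_fun_sum _ fun w' _ => hFm w')).aemeasurable)]
  have e₁ : ∀ ω, ∀ a ∈ Finset.univ.filter (fun a => a ≠ w.1),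
      ∫⁻ C, F C ω (a, w.2) ∂(𝒞₁.prod 𝒞₂) ≤ ∏ t, ENNReal.ofReal (Real.exp (-c₁ (ω t))) := by
    intro ω a ha
    have hne : w.1 ≠ a := (Finset.mem_filter.1 ha).2.symm
    rw [lintegral_prod _ (hFω ω _).aemeasurable]
    have hin : ∀ C₁ : Fin K₁ → Fin n → X₁, ∫⁻ C₂, F (C₁, C₂) ω (a, w.2) ∂𝒞₂ =
        ∏ t, ∫⁻ x₂, ρ (C₁ w.1 t, x₂) (C₁ a t, x₂) (ω t) ∂ν₂ := fun C₁ =>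
      lintegral_codebook_single w.2 (h := fun t x₂ => ρ (C₁ w.1 t, x₂) (C₁ a t, x₂) (ω t))
        fun t => hρ.comp (f := fun x₂ => ((C₁ w.1 t, x₂), (C₁ a t, x₂), ω t)) (by fun_prop)
    simp_rw [hin]
    rw [h𝒞₁, lintegral_codebook_pair hne
      (h := fun t x₁ x₁' => ∫⁻ x₂, ρ (x₁, x₂) (x₁', x₂) (ω t) ∂ν₂)
      fun t => Measurable.lintegral_prod_right' (f := fun q : (X₁ × X₁) × X₂ =>
        ρ (q.1.1, q.2) (q.1.2, q.2) (ω t)) (hρ.comp (f := fun q : (X₁ × X₁) × X₂ =>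
        ((q.1.1, q.2), (q.1.2, q.2), ω t)) (by fun_prop))]
    exact Finset.prod_le_prod' fun t _ => h₁ (ω t)
  have e₂ : ∀ ω, ∀ b ∈ Finset.univ.filter (fun b => b ≠ w.2),
      ∫⁻ C, F C ω (w.1, b) ∂(𝒞₁.prod 𝒞₂) ≤ ∏ t, ENNReal.ofReal (Real.exp (-c₂ (ω t))) := by
    intro ω b hb
    have hne : w.2 ≠ b := (Finset.mem_filter.1 hb).2.symm
    rw [lintegral_prod _ (hFω ω _).aemeasurable]
    have hin : ∀ C₁ : Fin K₁ → Fin n → X₁, ∫⁻ C₂, F (C₁, C₂) ω (w.1, b) ∂𝒞₂ =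
        ∏ t, ∫⁻ x₂, ∫⁻ x₂', ρ (C₁ w.1 t, x₂) (C₁ w.1 t, x₂') (ω t) ∂ν₂ ∂ν₂ := fun C₁ =>
      lintegral_codebook_pair hne (h := fun t x₂ x₂' => ρ (C₁ w.1 t, x₂) (C₁ w.1 t, x₂') (ω t))
        fun t => hρ.comp (f := fun q : X₂ × X₂ => ((C₁ w.1 t, q.1), (C₁ w.1 t, q.2), ω t))
          (by fun_prop)
    simp_rw [hin]
    rw [h𝒞₁, lintegral_codebook_single w.1
      (h := fun t x₁ => ∫⁻ x₂, ∫⁻ x₂', ρ (x₁, x₂) (x₁, x₂') (ω t) ∂ν₂ ∂ν₂)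
      fun t => Measurable.lintegral_prod_right' (f := fun q : X₁ × X₂ =>
        ∫⁻ x₂', ρ (q.1, q.2) (q.1, x₂') (ω t) ∂ν₂) (Measurable.lintegral_prod_right'
        (f := fun q : (X₁ × X₂) × X₂ => ρ (q.1.1, q.1.2) (q.1.1, q.2) (ω t))
        (hρ.comp (f := fun q : (X₁ × X₂) × X₂ => ((q.1.1, q.1.2), (q.1.1, q.2), ω t))
          (by fun_prop)))]
    exact Finset.prod_le_prod' fun t _ => h₂ (ω t)
  have e₁₂ : ∀ ω, ∀ a ∈ Finset.univ.filter (fun a => a ≠ w.1),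
      ∀ b ∈ Finset.univ.filter (fun b => b ≠ w.2),
      ∫⁻ C, F C ω (a, b) ∂(𝒞₁.prod 𝒞₂) ≤ ∏ t, ENNReal.ofReal (Real.exp (-c₁₂ (ω t))) := by
    intro ω a ha b hb
    have hne₁ : w.1 ≠ a := (Finset.mem_filter.1 ha).2.symm
    have hne₂ : w.2 ≠ b := (Finset.mem_filter.1 hb).2.symm
    rw [lintegral_prod _ (hFω ω _).aemeasurable]
    have hin : ∀ C₁ : Fin K₁ → Fin n → X₁, ∫⁻ C₂, F (C₁, C₂) ω (a, b) ∂𝒞₂ =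
        ∏ t, ∫⁻ x₂, ∫⁻ x₂', ρ (C₁ w.1 t, x₂) (C₁ a t, x₂') (ω t) ∂ν₂ ∂ν₂ := fun C₁ =>
      lintegral_codebook_pair hne₂ (h := fun t x₂ x₂' => ρ (C₁ w.1 t, x₂) (C₁ a t, x₂') (ω t))
        fun t => hρ.comp (f := fun q : X₂ × X₂ => ((C₁ w.1 t, q.1), (C₁ a t, q.2), ω t))
          (by fun_prop)
    simp_rw [hin]
    rw [h𝒞₁, lintegral_codebook_pair hne₁
      (h := fun t x₁ x₁' => ∫⁻ x₂, ∫⁻ x₂', ρ (x₁, x₂) (x₁', x₂') (ω t) ∂ν₂ ∂ν₂)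
      fun t => Measurable.lintegral_prod_right' (f := fun q : (X₁ × X₁) × X₂ =>
        ∫⁻ x₂', ρ (q.1.1, q.2) (q.1.2, x₂') (ω t) ∂ν₂) (Measurable.lintegral_prod_right'
        (f := fun q : ((X₁ × X₁) × X₂) × X₂ => ρ (q.1.1.1, q.1.2) (q.1.1.2, q.2) (ω t))
        (hρ.comp (f := fun q : ((X₁ × X₁) × X₂) × X₂ => ((q.1.1.1, q.1.2), (q.1.1.2, q.2), ω t))
          (by fun_prop)))]
    exact Finset.prod_le_prod' fun t _ => h₁₂ (ω t)
  have hω : ∀ ω, ∫⁻ C, min 1 (∑ w' ∈ {w' | w' ≠ w}, F C ω w') ∂(𝒞₁.prod 𝒞₂) ≤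
      min 1 ((K₁ - 1 : ℕ) * ∏ t, ENNReal.ofReal (Real.exp (-c₁ (ω t)))) +
      min 1 ((K₂ - 1 : ℕ) * ∏ t, ENNReal.ofReal (Real.exp (-c₂ (ω t)))) +
      min 1 (((K₁ - 1) * (K₂ - 1) : ℕ) * ∏ t, ENNReal.ofReal (Real.exp (-c₁₂ (ω t)))) := by
    intro ω
    have m₁ : Measurable fun C => ∑ a ∈ Finset.univ.filter (fun a => a ≠ w.1), F C ω (a, w.2) :=
      Finset.measurable_fun_sum _ fun a _ => hFω ω _
    have m₂ : Measurable fun C => ∑ b ∈ Finset.univ.filter (fun b => b ≠ w.2), F C ω (w.1, b) :=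
      Finset.measurable_fun_sum _ fun b _ => hFω ω _
    have s₁ : ∫⁻ C, ∑ a ∈ Finset.univ.filter (fun a => a ≠ w.1), F C ω (a, w.2) ∂(𝒞₁.prod 𝒞₂) ≤
        (K₁ - 1 : ℕ) * ∏ t, ENNReal.ofReal (Real.exp (-c₁ (ω t))) := by
      rw [lintegral_finsetSum _ fun a _ => hFω ω _]
      refine (Finset.sum_le_sum (e₁ ω)).trans (le_of_eq ?_)
      rw [Finset.sum_const, hcard, nsmul_eq_mul]
    have s₂ : ∫⁻ C, ∑ b ∈ Finset.univ.filter (fun b => b ≠ w.2), F C ω (w.1, b) ∂(𝒞₁.prod 𝒞₂) ≤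
        (K₂ - 1 : ℕ) * ∏ t, ENNReal.ofReal (Real.exp (-c₂ (ω t))) := by
      rw [lintegral_finsetSum _ fun a _ => hFω ω _]
      refine (Finset.sum_le_sum (e₂ ω)).trans (le_of_eq ?_)
      rw [Finset.sum_const, hcard, nsmul_eq_mul]
    have s₁₂ : ∫⁻ C, ∑ a ∈ Finset.univ.filter (fun a => a ≠ w.1),
        ∑ b ∈ Finset.univ.filter (fun b => b ≠ w.2), F C ω (a, b) ∂(𝒞₁.prod 𝒞₂) ≤
        ((K₁ - 1) * (K₂ - 1) : ℕ) * ∏ t, ENNReal.ofReal (Real.exp (-c₁₂ (ω t))) := by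
      rw [lintegral_finsetSum _ fun a _ => Finset.measurable_fun_sum _ fun b _ => hFω ω _]
      simp_rw [lintegral_finsetSum _ fun b _ => hFω ω _]
      refine (Finset.sum_le_sum fun a ha => Finset.sum_le_sum (e₁₂ ω a ha)).trans (le_of_eq ?_)
      rw [Finset.sum_const, Finset.sum_const, hcard, hcard, nsmul_eq_mul, nsmul_eq_mul, ← mul_assoc,
        Nat.cast_mul]
    calc _ ≤ ∫⁻ C, (min 1 (∑ a ∈ Finset.univ.filter (fun a => a ≠ w.1), F C ω (a, w.2)) +
            min 1 (∑ b ∈ Finset.univ.filter (fun b => b ≠ w.2), F C ω (w.1, b)) +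
            min 1 (∑ a ∈ Finset.univ.filter (fun a => a ≠ w.1),
              ∑ b ∈ Finset.univ.filter (fun b => b ≠ w.2), F C ω (a, b))) ∂(𝒞₁.prod 𝒞₂) :=
          lintegral_mono fun C => (min_le_min_left 1 (sum_ne_pair_le (F C ω) w)).trans
            ((min_one_add_le _ _).trans (add_le_add_left (min_one_add_le _ _) _))
      _ ≤ _ := by
          have m₁₂ : Measurable fun C =>
              min 1 (∑ a ∈ Finset.univ.filter (fun a => a ≠ w.1), F C ω (a, w.2)) +
              min 1 (∑ b ∈ Finset.univ.filter (fun b => b ≠ w.2), F C ω (w.1, b)) :=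
            (measurable_const.min m₁).add (measurable_const.min m₂)
          rw [lintegral_add_left m₁₂,
            lintegral_add_left (measurable_const.min m₁)]
          exact add_le_add (add_le_add
            ((lintegral_min_one_le _).trans (min_le_min_left 1 s₁))
            ((lintegral_min_one_le _).trans (min_le_min_left 1 s₂)))
            ((lintegral_min_one_le _).trans (min_le_min_left 1 s₁₂))
  refine (lintegral_mono hω).trans (le_of_eq ?_)
  have hm : ∀ {c : Ω → ℝ} (_ : Measurable c) (N : ℕ), Measurable fun ω : Fin n → Ω =>
      min 1 ((N : ENNReal) * ∏ t, ENNReal.ofReal (Real.exp (-c (ω t)))) := fun hc N => by fun_prop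
  have hm₁₂ : Measurable fun ω : Fin n → Ω =>
      min 1 (((K₁ - 1 : ℕ) : ENNReal) * ∏ t, ENNReal.ofReal (Real.exp (-c₁ (ω t)))) +
      min 1 (((K₂ - 1 : ℕ) : ENNReal) * ∏ t, ENNReal.ofReal (Real.exp (-c₂ (ω t)))) :=
    (hm hc₁ _).add (hm hc₂ _)
  rw [lintegral_add_left hm₁₂, lintegral_add_left (hm hc₁ _)]
  rfl

variable {η : Measure Z} [IsProbabilityMeasure η] {g : X₁ × X₂ → Ω → Z → Y}
  {u : X₁ × X₂ → Y → NNReal}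

/-- For fixed codebooks, the code that decodes to the message pair of strictly highest score and
replaces inadmissible words by an arbitrary admissible one. -/
lemma exists_code_of_codebooks {K₁ K₂ n : ℕ} {A₁ : Set (Fin n → X₁)} {A₂ : Set (Fin n → X₂)}
    (hg : Measurable fun p : (X₁ × X₂) × Ω × Z => g p.1 p.2.1 p.2.2)
    (hu : Measurable fun p : (X₁ × X₂) × Y => u p.1 p.2) (hpos : ∀ x ω z, u x (g x ω z) ≠ 0)
    (hK₁ : 0 < K₁) (hK₂ : 0 < K₂) (hA₁ : A₁.Nonempty) (hA₂ : A₂.Nonempty)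
    (C : (Fin K₁ → Fin n → X₁) × (Fin K₂ → Fin n → X₂)) :
    ∃ c : Code Y n A₁ A₂ K₁ K₂, ∀ w,
      (Measure.pi fun t : Fin n => (P.prod η).map fun p =>
          g (c.enc₁ w.1 t, c.enc₂ w.2 t) p.1 p.2) {y | c.dec y ≠ w} ≤
        ∫⁻ ω, min 1 (∑ w' ∈ {w' | w' ≠ w}, ∏ t, scoreRatio η g u
          (C.1 w.1 t, C.2 w.2 t) (C.1 w'.1 t, C.2 w'.2 t) (ω t)) ∂(Measure.pi fun _ : Fin n => P) +
        A₁ᶜ.indicator 1 (C.1 w.1) + A₂ᶜ.indicator 1 (C.2 w.2) := by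
  classical
  obtain ⟨a₁, ha₁⟩ := hA₁
  obtain ⟨a₂, ha₂⟩ := hA₂
  have : Nonempty (Fin K₁ × Fin K₂) := ⟨(⟨0, hK₁⟩, ⟨0, hK₂⟩)⟩
  set x : Fin K₁ × Fin K₂ → Fin n → X₁ × X₂ := fun w t => (C.1 w.1 t, C.2 w.2 t) with hx
  have hux : ∀ a, Measurable (u a) := fun a => hu.comp (measurable_const.prodMk measurable_id)
  set G : Fin K₁ × Fin K₂ → Set (Fin n → Y) := fun w =>
    {y | ∀ w' ≠ w, ∏ t, u (x w' t) (y t) < ∏ t, u (x w t) (y t)} with hG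
  have hGm : ∀ w, MeasurableSet (G w) := fun w => by
    have : G w = ⋂ w' ∈ {w' | w' ≠ w}, {y | ∏ t, u (x w' t) (y t) < ∏ t, u (x w t) (y t)} := by
      ext y; simp [hG]
    rw [this]
    refine MeasurableSet.biInter (Set.to_countable _) fun w' _ => ?_
    exact measurableSet_lt
      (Finset.measurable_fun_prod _ fun t _ => (hux _).comp (measurable_pi_apply t))
      (Finset.measurable_fun_prod _ fun t _ => (hux _).comp (measurable_pi_apply t))
  obtain ⟨dec, hdec, hdecG⟩ := exists_measurable_piecewise G hGm (fun w _ => w)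
    (fun w => measurable_const) fun w w' hne y hy =>
      absurd (hy.1 w' hne.symm) (lt_asymm (hy.2 w hne))
  refine ⟨⟨fun w => if C.1 w ∈ A₁ then C.1 w else a₁, fun w => if C.2 w ∈ A₂ then C.2 w else a₂,
    fun w => ?_, fun w => ?_, dec, hdec⟩, fun w => ?_⟩
  · split_ifs with h
    exacts [h, ha₁]
  · split_ifs with h
    exacts [h, ha₂]
  · have hprob : ∀ a, IsProbabilityMeasure ((P.prod η).map fun p => g a p.1 p.2) := fun a =>
      Measure.isProbabilityMeasure_map
        (hg.comp (measurable_const.prodMk measurable_id)).aemeasurable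
    by_cases h₁ : C.1 w.1 ∈ A₁
    · by_cases h₂ : C.2 w.2 ∈ A₂
      · simp only [h₁, h₂, if_true]
        refine le_trans ?_ (le_add_right (le_add_right
          (pi_exists_score_le (P := P) hg hu hpos x w)))
        refine measure_mono fun y hy => ?_
        by_contra hcon
        refine hy (hdecG w ?_)
        simpa [hG] using hcon
      · refine prob_le_one.trans ?_
        rw [Set.indicator_of_mem (s := A₂ᶜ) h₂]
        exact le_add_self
    · refine prob_le_one.trans (le_add_right ?_)
      rw [Set.indicator_of_mem (s := A₁ᶜ) h₁]
      exact le_add_self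

/-- The average over the random codebooks is met by some codebook. -/
lemma exists_code_avgError_le {K₁ K₂ n : ℕ} {A₁ : Set (Fin n → X₁)} {A₂ : Set (Fin n → X₂)}
    {W : X₁ → X₂ → Measure Y} (hW : ∀ x₁ x₂, W x₁ x₂ = (P.prod η).map fun p => g (x₁, x₂) p.1 p.2)
    (hg : Measurable fun p : (X₁ × X₂) × Ω × Z => g p.1 p.2.1 p.2.2)
    (hu : Measurable fun p : (X₁ × X₂) × Y => u p.1 p.2) (hpos : ∀ x ω z, u x (g x ω z) ≠ 0)
    {c₁ c₂ c₁₂ : Ω → ℝ} (hc₁ : Measurable c₁) (hc₂ : Measurable c₂)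
    (h₁ : ∀ ω, ∫⁻ x₁, ∫⁻ x₁', ∫⁻ x₂, scoreRatio η g u (x₁, x₂) (x₁', x₂) ω ∂ν₂ ∂ν₁ ∂ν₁ ≤
      ENNReal.ofReal (Real.exp (-c₁ ω)))
    (h₂ : ∀ ω, ∫⁻ x₁, ∫⁻ x₂, ∫⁻ x₂', scoreRatio η g u (x₁, x₂) (x₁, x₂') ω ∂ν₂ ∂ν₂ ∂ν₁ ≤
      ENNReal.ofReal (Real.exp (-c₂ ω)))
    (h₁₂ : ∀ ω, ∫⁻ x₁, ∫⁻ x₁', ∫⁻ x₂, ∫⁻ x₂',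
      scoreRatio η g u (x₁, x₂) (x₁', x₂') ω ∂ν₂ ∂ν₂ ∂ν₁ ∂ν₁ ≤
      ENNReal.ofReal (Real.exp (-c₁₂ ω)))
    (hK₁ : 0 < K₁) (hK₂ : 0 < K₂) (hA₁ : A₁.Nonempty) (hA₂ : A₂.Nonempty)
    (hmA₁ : MeasurableSet A₁) (hmA₂ : MeasurableSet A₂) :
    ∃ c : Code Y n A₁ A₂ K₁ K₂, ENNReal.ofReal (c.avgError W) ≤
      unionBound P c₁ n (K₁ - 1) + unionBound P c₂ n (K₂ - 1) +
        unionBound P c₁₂ n ((K₁ - 1) * (K₂ - 1)) +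
        (Measure.pi fun _ : Fin n => ν₁) A₁ᶜ + (Measure.pi fun _ : Fin n => ν₂) A₂ᶜ := by
  set T := unionBound P c₁ n (K₁ - 1) + unionBound P c₂ n (K₂ - 1) +
        unionBound P c₁₂ n ((K₁ - 1) * (K₂ - 1)) +
        (Measure.pi fun _ : Fin n => ν₁) A₁ᶜ + (Measure.pi fun _ : Fin n => ν₂) A₂ᶜ with hT
  set 𝒞₁ := codebook (Fin K₁) n ν₁
  set 𝒞₂ := codebook (Fin K₂) n ν₂
  have hρ := measurable_scoreRatio (η := η) hg hu
  set Φ : (Fin K₁ × Fin K₂) → ((Fin K₁ → Fin n → X₁) × (Fin K₂ → Fin n → X₂)) → ENNReal :=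
    fun w C => ∫⁻ ω, min 1 (∑ w' ∈ {w' | w' ≠ w}, ∏ t, scoreRatio η g u
          (C.1 w.1 t, C.2 w.2 t) (C.1 w'.1 t, C.2 w'.2 t) (ω t)) ∂(Measure.pi fun _ : Fin n => P)
    with hΦ
  have hΦm : ∀ w, Measurable (Φ w) := fun w => by
    refine Measurable.lintegral_prod_right' (f := fun p : ((Fin K₁ → Fin n → X₁) ×
      (Fin K₂ → Fin n → X₂)) × (Fin n → Ω) => min 1 (∑ w' ∈ {w' | w' ≠ w}, ∏ t, scoreRatio η g u
          (p.1.1 w.1 t, p.1.2 w.2 t) (p.1.1 w'.1 t, p.1.2 w'.2 t) (p.2 t))) ?_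
    refine measurable_const.min (Finset.measurable_fun_sum _ fun w' _ =>
      Finset.measurable_fun_prod _ fun t _ => ?_)
    exact hρ.comp (f := fun p : ((Fin K₁ → Fin n → X₁) × (Fin K₂ → Fin n → X₂)) × (Fin n → Ω) =>
      ((p.1.1 w.1 t, p.1.2 w.2 t), (p.1.1 w'.1 t, p.1.2 w'.2 t), p.2 t)) (by fun_prop)
  have hi₁ : ∀ w : Fin K₁ × Fin K₂, Measurable fun C : (Fin K₁ → Fin n → X₁) ×
      (Fin K₂ → Fin n → X₂) => A₁ᶜ.indicator (1 : (Fin n → X₁) → ENNReal) (C.1 w.1) := fun w =>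
    (measurable_one.indicator hmA₁.compl).comp (by fun_prop)
  have hi₂ : ∀ w : Fin K₁ × Fin K₂, Measurable fun C : (Fin K₁ → Fin n → X₁) ×
      (Fin K₂ → Fin n → X₂) => A₂ᶜ.indicator (1 : (Fin n → X₂) → ENNReal) (C.2 w.2) := fun w =>
    (measurable_one.indicator hmA₂.compl).comp (by fun_prop)
  have hI₁ : ∀ w : Fin K₁ × Fin K₂, ∫⁻ C, A₁ᶜ.indicator (1 : (Fin n → X₁) → ENNReal) (C.1 w.1)
      ∂(𝒞₁.prod 𝒞₂) = (Measure.pi fun _ : Fin n => ν₁) A₁ᶜ := fun w => by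
    rw [lintegral_prod _ (hi₁ w).aemeasurable]
    simp only [lintegral_const, measure_univ, mul_one]
    refine ((measurePreserving_eval (fun _ : Fin K₁ => Measure.pi fun _ : Fin n => ν₁)
      w.1).lintegral_comp (measurable_one.indicator hmA₁.compl)).trans ?_
    exact lintegral_indicator_one hmA₁.compl
  have hI₂ : ∀ w : Fin K₁ × Fin K₂, ∫⁻ C, A₂ᶜ.indicator (1 : (Fin n → X₂) → ENNReal) (C.2 w.2)
      ∂(𝒞₁.prod 𝒞₂) = (Measure.pi fun _ : Fin n => ν₂) A₂ᶜ := fun w => by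
    rw [lintegral_prod _ (hi₂ w).aemeasurable]
    simp only [lintegral_const, measure_univ, mul_one]
    refine ((measurePreserving_eval (fun _ : Fin K₂ => Measure.pi fun _ : Fin n => ν₂)
      w.2).lintegral_comp (measurable_one.indicator hmA₂.compl)).trans ?_
    exact lintegral_indicator_one hmA₂.compl
  have hw : ∀ w, ∫⁻ C, (Φ w C + A₁ᶜ.indicator 1 (C.1 w.1) + A₂ᶜ.indicator 1 (C.2 w.2))
      ∂(𝒞₁.prod 𝒞₂) ≤ T := fun w => by
    have hadd : Measurable fun C : (Fin K₁ → Fin n → X₁) × (Fin K₂ → Fin n → X₂) =>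
      Φ w C + A₁ᶜ.indicator (1 : (Fin n → X₁) → ENNReal) (C.1 w.1) := (hΦm w).add (hi₁ w)
    rw [lintegral_add_left hadd, lintegral_add_left (hΦm w), hI₁, hI₂, hT]
    gcongr
    exact lintegral_codebooks_le hρ hc₁ hc₂ h₁ h₂ h₁₂ w
  have hall : ∀ w, Measurable fun C : (Fin K₁ → Fin n → X₁) × (Fin K₂ → Fin n → X₂) =>
      Φ w C + A₁ᶜ.indicator (1 : (Fin n → X₁) → ENNReal) (C.1 w.1) +
        A₂ᶜ.indicator (1 : (Fin n → X₂) → ENNReal) (C.2 w.2) := fun w =>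
    ((hΦm w).add (hi₁ w)).add (hi₂ w)
  obtain ⟨C, hC⟩ := exists_le_lintegral (μ := 𝒞₁.prod 𝒞₂) (f := fun C => ∑ w, (Φ w C +
    A₁ᶜ.indicator 1 (C.1 w.1) + A₂ᶜ.indicator 1 (C.2 w.2)))
    (Finset.measurable_fun_sum _ fun w _ => hall w).aemeasurable
  rw [lintegral_finsetSum _ fun w _ => hall w] at hC
  obtain ⟨c, hc⟩ := exists_code_of_codebooks (P := P) (η := η) hg hu hpos hK₁ hK₂ hA₁ hA₂ C
  refine ⟨c, ?_⟩
  have hprob : ∀ a, IsProbabilityMeasure ((P.prod η).map fun p => g a p.1 p.2) := fun a =>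
    Measure.isProbabilityMeasure_map
      (hg.comp (measurable_const.prodMk measurable_id)).aemeasurable
  have hKK : (0 : ℝ) < K₁ * K₂ := by positivity
  rw [Code.avgError, ENNReal.ofReal_div_of_pos hKK]
  refine ENNReal.div_le_of_le_mul ?_
  simp only [hW]
  rw [ENNReal.ofReal_sum_of_nonneg fun _ _ => measureReal_nonneg]
  have hreal : ∀ w : Fin K₁ × Fin K₂, ENNReal.ofReal ((Measure.pi fun t : Fin n =>
      (P.prod η).map fun p => g (c.enc₁ w.1 t, c.enc₂ w.2 t) p.1 p.2).real {y | c.dec y ≠ w}) ≤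
      Φ w C + A₁ᶜ.indicator 1 (C.1 w.1) + A₂ᶜ.indicator 1 (C.2 w.2) := fun w => by
    have := fun t => hprob (c.enc₁ w.1 t, c.enc₂ w.2 t)
    rw [ofReal_measureReal]
    exact hc w
  refine (Finset.sum_le_sum fun w _ => hreal w).trans (hC.trans ?_)
  refine (Finset.sum_le_sum fun w _ => hw w).trans (le_of_eq ?_)
  rw [Finset.sum_const, Finset.card_univ, Fintype.card_prod, Fintype.card_fin, Fintype.card_fin,
    nsmul_eq_mul, mul_comm, ENNReal.ofReal_mul (Nat.cast_nonneg _), ENNReal.ofReal_natCast,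
    ENNReal.ofReal_natCast, Nat.cast_mul]

lemma natCeil_two_rpow_sub_one_le (n : ℕ) (r : ℝ) :
    ((⌈(2 : ℝ) ^ ((n : ℝ) * r)⌉₊ - 1 : ℕ) : ℝ) ≤ Real.exp (n * (r * Real.log 2)) := by
  rw [Nat.cast_sub (Nat.one_le_iff_ne_zero.2 (natCeil_two_rpow_pos n r).ne'), Nat.cast_one,
    ← mul_assoc, mul_comm (_ * r), ← Real.rpow_def_of_pos two_pos]
  have := Nat.ceil_lt_add_one (show (0 : ℝ) ≤ 2 ^ ((n : ℝ) * r) by positivity)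
  linarith

/-- Rates below the means of the pairwise exponents are achievable; the conditions on a rate drop
out when it is `0`, since then there is only one message. -/
theorem achievable_of_scoreRatio {A₁ : (n : ℕ) → Set (Fin n → X₁)}
    {A₂ : (n : ℕ) → Set (Fin n → X₂)}
    {W : X₁ → X₂ → Measure Y} (hW : ∀ x₁ x₂, W x₁ x₂ = (P.prod η).map fun p => g (x₁, x₂) p.1 p.2)
    (hg : Measurable fun p : (X₁ × X₂) × Ω × Z => g p.1 p.2.1 p.2.2)
    (hu : Measurable fun p : (X₁ × X₂) × Y => u p.1 p.2) (hpos : ∀ x ω z, u x (g x ω z) ≠ 0)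
    {c₁ c₂ c₁₂ : Ω → ℝ} (hc₁ : Measurable c₁) (hc₂ : Measurable c₂) (hc₁₂ : Measurable c₁₂)
    (hc₁0 : ∀ ω, 0 ≤ c₁ ω) (hc₂0 : ∀ ω, 0 ≤ c₂ ω) (hc₁₂0 : ∀ ω, 0 ≤ c₁₂ ω) {B : ℝ}
    (hc₁B : ∀ ω, c₁ ω ≤ B) (hc₂B : ∀ ω, c₂ ω ≤ B) (hc₁₂B : ∀ ω, c₁₂ ω ≤ B)
    (h₁ : ∀ ω, ∫⁻ x₁, ∫⁻ x₁', ∫⁻ x₂, scoreRatio η g u (x₁, x₂) (x₁', x₂) ω ∂ν₂ ∂ν₁ ∂ν₁ ≤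
      ENNReal.ofReal (Real.exp (-c₁ ω)))
    (h₂ : ∀ ω, ∫⁻ x₁, ∫⁻ x₂, ∫⁻ x₂', scoreRatio η g u (x₁, x₂) (x₁, x₂') ω ∂ν₂ ∂ν₂ ∂ν₁ ≤
      ENNReal.ofReal (Real.exp (-c₂ ω)))
    (h₁₂ : ∀ ω, ∫⁻ x₁, ∫⁻ x₁', ∫⁻ x₂, ∫⁻ x₂',
      scoreRatio η g u (x₁, x₂) (x₁', x₂') ω ∂ν₂ ∂ν₂ ∂ν₁ ∂ν₁ ≤
      ENNReal.ofReal (Real.exp (-c₁₂ ω)))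
    (hA₁ : ∀ n, (A₁ n).Nonempty) (hA₂ : ∀ n, (A₂ n).Nonempty)
    (hmA₁ : ∀ n, MeasurableSet (A₁ n)) (hmA₂ : ∀ n, MeasurableSet (A₂ n))
    (ht₁ : Tendsto (fun n => (Measure.pi fun _ : Fin n => ν₁) (A₁ n)ᶜ) atTop (nhds 0))
    (ht₂ : Tendsto (fun n => (Measure.pi fun _ : Fin n => ν₂) (A₂ n)ᶜ) atTop (nhds 0))
    {R : ℝ × ℝ} (hR₁ : 0 ≤ R.1) (hR₂ : 0 ≤ R.2)
    (hr₁ : R.1 = 0 ∨ R.1 * Real.log 2 < ∫ ω, c₁ ω ∂P)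
    (hr₂ : R.2 = 0 ∨ R.2 * Real.log 2 < ∫ ω, c₂ ω ∂P)
    (hr₁₂ : R.1 = 0 ∨ R.2 = 0 ∨ (R.1 + R.2) * Real.log 2 < ∫ ω, c₁₂ ω ∂P) :
    Achievable W A₁ A₂ R := by
  have hzero : ∀ (c : Ω → ℝ) (N : ℕ → ℕ), (∀ n, N n = 0) →
      Tendsto (fun n => unionBound P c n (N n)) atTop (nhds 0) := fun c N hN => by
    simp [unionBound, hN]
  have hN0 : ∀ r : ℝ, r = 0 → ∀ n : ℕ, ⌈(2 : ℝ) ^ ((n : ℝ) * r)⌉₊ - 1 = 0 := fun r hr n => by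
    simp [hr]
  have t₁ : Tendsto (fun n : ℕ => unionBound P c₁ n (⌈(2 : ℝ) ^ ((n : ℝ) * R.1)⌉₊ - 1)) atTop
      (nhds 0) := by
    rcases hr₁ with h | h
    · exact hzero _ _ (hN0 _ h)
    · exact tendsto_lintegral_min_one hc₁ hc₁0 hc₁B
        (fun n => natCeil_two_rpow_sub_one_le n R.1) h
  have t₂ : Tendsto (fun n : ℕ => unionBound P c₂ n (⌈(2 : ℝ) ^ ((n : ℝ) * R.2)⌉₊ - 1)) atTop
      (nhds 0) := by
    rcases hr₂ with h | h
    · exact hzero _ _ (hN0 _ h)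
    · exact tendsto_lintegral_min_one hc₂ hc₂0 hc₂B
        (fun n => natCeil_two_rpow_sub_one_le n R.2) h
  have t₁₂ : Tendsto (fun n : ℕ => unionBound P c₁₂ n ((⌈(2 : ℝ) ^ ((n : ℝ) * R.1)⌉₊ - 1) *
      (⌈(2 : ℝ) ^ ((n : ℝ) * R.2)⌉₊ - 1))) atTop (nhds 0) := by
    rcases hr₁₂ with h | h | h
    · exact hzero _ _ fun n => by rw [hN0 _ h, zero_mul]
    · exact hzero _ _ fun n => by rw [hN0 _ h, mul_zero]
    · refine tendsto_lintegral_min_one hc₁₂ hc₁₂0 hc₁₂B (fun n => ?_) h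
      rw [Nat.cast_mul, add_mul, mul_add, Real.exp_add]
      exact mul_le_mul (natCeil_two_rpow_sub_one_le n R.1) (natCeil_two_rpow_sub_one_le n R.2)
        (Nat.cast_nonneg _) (Real.exp_pos _).le
  have ht := (((t₁.add t₂).add t₁₂).add ht₁).add ht₂
  simp only [add_zero] at ht
  refine ⟨hR₁, hR₂, fun ε hε => ?_⟩
  filter_upwards [ht.eventually_le_const (ENNReal.ofReal_pos.2 hε)] with n hn
  obtain ⟨c, hc⟩ := exists_code_avgError_le hW hg hu hpos hc₁ hc₂ h₁ h₂ h₁₂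
    (natCeil_two_rpow_pos n R.1) (natCeil_two_rpow_pos n R.2) (hA₁ n) (hA₂ n) (hmA₁ n) (hmA₂ n)
  exact ⟨c, (ENNReal.ofReal_le_ofReal_iff hε.le).1 (hc.trans hn)⟩

end RandomCoding

/-! ### Regions of rate pairs -/

/-- The rate pairs bounded by `a₁` and `a₂` individually, and by `a₁₂` in sum. -/
def rateRegion (a₁ a₂ a₁₂ : ℝ) : Set (ℝ × ℝ) :=
  {R | 0 ≤ R.1 ∧ 0 ≤ R.2 ∧ R.1 ≤ a₁ ∧ R.2 ≤ a₂ ∧ R.1 + R.2 ≤ a₁₂}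

lemma isClosed_rateRegion (a₁ a₂ a₁₂ : ℝ) : IsClosed (rateRegion a₁ a₂ a₁₂) :=
  (isClosed_le continuous_const continuous_fst).inter <|
    (isClosed_le continuous_const continuous_snd).inter <|
    (isClosed_le continuous_fst continuous_const).inter <|
    (isClosed_le continuous_snd continuous_const).inter <|
    isClosed_le (continuous_fst.add continuous_snd) continuous_const

lemma mem_closure_of_forall_smul_mem {S : Set (ℝ × ℝ)} {R : ℝ × ℝ}
    (h : ∀ s : ℝ, 0 < s → s < 1 → s • R ∈ S) : R ∈ closure S := by
  have ht : Tendsto (fun s : ℝ => s • R) (nhdsWithin 1 (Set.Iio 1)) (nhds R) := by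
    have : Tendsto (fun s : ℝ => s • R) (nhds 1) (nhds ((1 : ℝ) • R)) :=
      (continuous_id.smul continuous_const).tendsto 1
    rw [one_smul] at this
    exact this.mono_left nhdsWithin_le_nhds
  refine mem_closure_of_tendsto ht ?_
  filter_upwards [self_mem_nhdsWithin, mem_nhdsWithin_of_mem_nhds (lt_mem_nhds zero_lt_one)]
    with s hs1 hs0 using h s hs0 hs1

/-- Shrinking a rate makes a bound strict unless the rate is `0`. -/
lemma smul_eq_zero_or_lt {r c s : ℝ} (hr : 0 ≤ r) (hrc : r ≤ c) (hs : s < 1) :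
    r = 0 ∨ s * r < c := by
  rcases hr.eq_or_lt with h | h
  · exact .inl h.symm
  · exact .inr (by nlinarith)

/-! ### The capacity region of the deterministic channel -/

section DetRegion

variable {Ω : Type*} {n₁ n₂ : ℕ} {M₁ M₂ : Ω → ℕ}

lemma two_inv_pow_eq_ofReal_exp (m : ℕ) :
    (2⁻¹ : ENNReal) ^ m = ENNReal.ofReal (Real.exp (-(m * Real.log 2))) := by
  rw [Real.exp_neg, Real.exp_nat_mul, Real.exp_log two_pos,
    ENNReal.ofReal_inv_of_pos (by positivity), ENNReal.ofReal_pow zero_le_two,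
    ENNReal.ofReal_ofNat, ENNReal.inv_pow]

/-- The observation of the deterministic channel, as a function of the inputs and the state; there
is no noise. -/
def detObservation (n₁ n₂ : ℕ) (M₁ M₂ : Ω → ℕ) (x : (Fin n₁ → ZMod 2) × (Fin n₂ → ZMod 2)) (ω : Ω)
    (_ : Unit) : DetOutput :=
  ⟨(M₁ ω, M₂ ω), received (M₁ ω) (M₂ ω) x.1 x.2⟩

/-- The score for the deterministic channel: `1` for inputs consistent with the observation, and `0`
for all others. -/
def detScore (n₁ n₂ : ℕ) (x : (Fin n₁ → ZMod 2) × (Fin n₂ → ZMod 2)) (y : DetOutput) : NNReal :=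
  if received y.1.1 y.1.2 x.1 x.2 = y.2 then 1 else 0

lemma scoreRatio_det (x x' : (Fin n₁ → ZMod 2) × (Fin n₂ → ZMod 2)) (ω : Ω) :
    scoreRatio (Measure.dirac ()) (detObservation n₁ n₂ M₁ M₂) (detScore n₁ n₂) x x' ω =
      {x' : (Fin n₁ → ZMod 2) × (Fin n₂ → ZMod 2) | received (M₁ ω) (M₂ ω) x'.1 x'.2 =
        received (M₁ ω) (M₂ ω) x.1 x.2}.indicator 1 x' := by
  unfold scoreRatio
  rw [lintegral_dirac]
  by_cases h : received (M₁ ω) (M₂ ω) x'.1 x'.2 = received (M₁ ω) (M₂ ω) x.1 x.2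
  · simp [detScore, detObservation, h]
  · simp [detScore, detObservation, h]

variable [MeasurableSpace Ω] {P : Measure Ω} [IsProbabilityMeasure P]

lemma achievable_det (hM₁ : Measurable M₁) (hM₂ : Measurable M₂)
    (hle₁ : ∀ ω, M₁ ω ≤ n₁) (hle₂ : ∀ ω, M₂ ω ≤ n₂) {R : ℝ × ℝ} (hR₁ : 0 ≤ R.1) (hR₂ : 0 ≤ R.2)
    (hr₁ : R.1 = 0 ∨ R.1 < ∫ ω, (M₁ ω : ℝ) ∂P) (hr₂ : R.2 = 0 ∨ R.2 < ∫ ω, (M₂ ω : ℝ) ∂P)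
    (hr₁₂ : R.1 = 0 ∨ R.2 = 0 ∨ R.1 + R.2 < ∫ ω, max (M₁ ω : ℝ) (M₂ ω) ∂P) :
    Achievable (detLaw P n₁ n₂ M₁ M₂) (fun _ => Set.univ) (fun _ => Set.univ) R := by
  have hlog : 0 < Real.log 2 := Real.log_pos one_lt_two
  have hm₁ : Measurable fun ω => (M₁ ω : ℝ) :=
    (measurable_from_top (f := fun m : ℕ => (m : ℝ))).comp hM₁
  have hm₂ : Measurable fun ω => (M₂ ω : ℝ) :=
    (measurable_from_top (f := fun m : ℕ => (m : ℝ))).comp hM₂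
  have hlt : ∀ {r : ℝ} {f : Ω → ℝ}, r < ∫ ω, f ω ∂P →
      r * Real.log 2 < ∫ ω, f ω * Real.log 2 ∂P := fun h => by
    rw [integral_mul_const]
    exact mul_lt_mul_of_pos_right h hlog
  have hb₁ : ∀ ω, (M₁ ω : ℝ) ≤ max (n₁ : ℝ) n₂ := fun ω =>
    le_max_of_le_left (by exact_mod_cast hle₁ ω)
  have hb₂ : ∀ ω, (M₂ ω : ℝ) ≤ max (n₁ : ℝ) n₂ := fun ω =>
    le_max_of_le_right (by exact_mod_cast hle₂ ω)
  have hmul : ∀ {a : ℝ}, a ≤ max (n₁ : ℝ) n₂ → a * Real.log 2 ≤ max (n₁ : ℝ) n₂ * Real.log 2 :=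
    fun h => mul_le_mul_of_nonneg_right h hlog.le
  refine achievable_of_scoreRatio (P := P) (η := Measure.dirac ()) (ν₁ := uniformBits n₁)
    (ν₂ := uniformBits n₂) (g := detObservation n₁ n₂ M₁ M₂) (u := detScore n₁ n₂)
    (c₁ := fun ω => M₁ ω * Real.log 2) (c₂ := fun ω => M₂ ω * Real.log 2)
    (c₁₂ := fun ω => max (M₁ ω : ℝ) (M₂ ω) * Real.log 2) (B := max (n₁ : ℝ) n₂ * Real.log 2)
    (fun x₁ x₂ => ?_) ?_ .of_discrete (fun x ω z => ?_) (hm₁.mul_const _) (hm₂.mul_const _)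
    ((hm₁.max hm₂).mul_const _) (fun ω => by positivity) (fun ω => by positivity)
    (fun ω => by positivity) (fun ω => hmul (hb₁ ω)) (fun ω => hmul (hb₂ ω))
    (fun ω => hmul (max_le (hb₁ ω) (hb₂ ω)))
    (fun ω => ?_) (fun ω => ?_) (fun ω => ?_) (fun _ => Set.univ_nonempty)
    (fun _ => Set.univ_nonempty) (fun _ => .univ) (fun _ => .univ) (by simp) (by simp) hR₁ hR₂
    (hr₁.imp id hlt) (hr₂.imp id hlt) (hr₁₂.imp id fun h => h.imp id hlt)
  · have hmap : Measurable fun ω => (⟨(M₁ ω, M₂ ω), received (M₁ ω) (M₂ ω) x₁ x₂⟩ : DetOutput) :=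
      (Measurable.of_discrete (f := fun m : ℕ × ℕ =>
        (⟨m, received m.1 m.2 x₁ x₂⟩ : DetOutput))).comp (hM₁.prodMk hM₂)
    have h := Measure.map_map (μ := P.prod (Measure.dirac ())) hmap measurable_fst
    rw [Measure.map_fst_prod, measure_univ, one_smul] at h
    exact h
  · exact (Measurable.of_discrete (f := fun q : ((Fin n₁ → ZMod 2) × (Fin n₂ → ZMod 2)) × ℕ × ℕ =>
      (⟨q.2, received q.2.1 q.2.2 q.1.1 q.1.2⟩ : DetOutput))).comp
      (f := fun p : ((Fin n₁ → ZMod 2) × (Fin n₂ → ZMod 2)) × Ω × Unit =>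
        (p.1, M₁ p.2.1, M₂ p.2.1)) (by fun_prop)
  · simp [detScore, detObservation]
  · simp_rw [scoreRatio_det]
    refine le_of_eq ?_
    have hin : ∀ x₁ : Fin n₁ → ZMod 2, ∫⁻ x₁', ∫⁻ x₂, {x' : (Fin n₁ → ZMod 2) × (Fin n₂ → ZMod 2) |
        received (M₁ ω) (M₂ ω) x'.1 x'.2 = received (M₁ ω) (M₂ ω) x₁ x₂}.indicator
          (1 : (Fin n₁ → ZMod 2) × (Fin n₂ → ZMod 2) → ENNReal) (x₁', x₂)
          ∂uniformBits n₂ ∂uniformBits n₁ =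
        (2⁻¹ : ENNReal) ^ M₁ ω := fun x₁ => by
      rw [lintegral_lintegral_swap (Measurable.of_discrete).aemeasurable]
      refine (lintegral_congr fun x₂ => (lintegral_indicator_one (s := {x₁' | received (M₁ ω) (M₂ ω)
        x₁' x₂ = received (M₁ ω) (M₂ ω) x₁ x₂}) .of_discrete).trans
          (uniformBits_received_left (hle₁ ω) x₁ x₂ x₂ (.inl rfl))).trans ?_
      simp
    simp_rw [hin]
    rw [lintegral_const, measure_univ, mul_one, two_inv_pow_eq_ofReal_exp]
  · simp_rw [scoreRatio_det]
    refine le_of_eq ?_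
    have hin : ∀ (x₁ : Fin n₁ → ZMod 2) (x₂ : Fin n₂ → ZMod 2),
        ∫⁻ x₂', {x' : (Fin n₁ → ZMod 2) × (Fin n₂ → ZMod 2) |
        received (M₁ ω) (M₂ ω) x'.1 x'.2 = received (M₁ ω) (M₂ ω) x₁ x₂}.indicator
          (1 : (Fin n₁ → ZMod 2) × (Fin n₂ → ZMod 2) → ENNReal) (x₁, x₂')
          ∂uniformBits n₂ = (2⁻¹ : ENNReal) ^ M₂ ω := fun x₁ x₂ =>
      (lintegral_indicator_one (s := {x₂' | received (M₁ ω) (M₂ ω)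
        x₁ x₂' = received (M₁ ω) (M₂ ω) x₁ x₂}) .of_discrete).trans
          (uniformBits_received_right (hle₂ ω) x₁ x₁ x₂ (.inl rfl))
    simp_rw [hin]
    simp [two_inv_pow_eq_ofReal_exp]
  · simp_rw [scoreRatio_det]
    refine le_of_eq ?_
    have hin : ∀ x₁ : Fin n₁ → ZMod 2, ∫⁻ x₁', ∫⁻ x₂, ∫⁻ x₂',
        {x' : (Fin n₁ → ZMod 2) × (Fin n₂ → ZMod 2) |
        received (M₁ ω) (M₂ ω) x'.1 x'.2 = received (M₁ ω) (M₂ ω) x₁ x₂}.indicator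
          (1 : (Fin n₁ → ZMod 2) × (Fin n₂ → ZMod 2) → ENNReal) (x₁', x₂')
            ∂uniformBits n₂ ∂uniformBits n₂ ∂uniformBits n₁ =
        (2⁻¹ : ENNReal) ^ max (M₁ ω) (M₂ ω) := fun x₁ => by
      rw [lintegral_lintegral_swap (Measurable.of_discrete).aemeasurable]
      have hprod : ∀ x₂ : Fin n₂ → ZMod 2, ∫⁻ x₁', ∫⁻ x₂',
          {x' : (Fin n₁ → ZMod 2) × (Fin n₂ → ZMod 2) |
          received (M₁ ω) (M₂ ω) x'.1 x'.2 = received (M₁ ω) (M₂ ω) x₁ x₂}.indicator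
          (1 : (Fin n₁ → ZMod 2) × (Fin n₂ → ZMod 2) → ENNReal) (x₁', x₂')
            ∂uniformBits n₂ ∂uniformBits n₁ =
          (2⁻¹ : ENNReal) ^ max (M₁ ω) (M₂ ω) := fun x₂ => by
        rw [← uniformBits_prod_received (hle₁ ω) (hle₂ ω) x₁ x₂,
          ← lintegral_indicator_one .of_discrete,
          lintegral_prod _ (Measurable.of_discrete).aemeasurable]
      simp_rw [hprod]
      simp
    simp_rw [hin]
    rw [lintegral_const, measure_univ, mul_one, two_inv_pow_eq_ofReal_exp, Nat.cast_max]

lemma detCapacityRegion_eq (hM₁ : Measurable M₁) (hM₂ : Measurable M₂)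
    (hle₁ : ∀ ω, M₁ ω ≤ n₁) (hle₂ : ∀ ω, M₂ ω ≤ n₂) :
    detCapacityRegion P n₁ n₂ M₁ M₂ =
      {R : ℝ × ℝ | 0 ≤ R.1 ∧ 0 ≤ R.2 ∧
        R.1 ≤ ∫ ω, (M₁ ω : ℝ) ∂P ∧
        R.2 ≤ ∫ ω, (M₂ ω : ℝ) ∂P ∧
        R.1 + R.2 ≤ ∫ ω, max (M₁ ω : ℝ) (M₂ ω : ℝ) ∂P} := by
  have hlog : 0 < Real.log 2 := Real.log_pos one_lt_two
  have hW := isProbabilityMeasure_detLaw (P := P) (n₁ := n₁) (n₂ := n₂) hM₁ hM₂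
  refine subset_antisymm (closure_minimal ?_ ?_) fun R hR => mem_closure_of_forall_smul_mem ?_
  · intro R hR
    have hdiv : ∀ {r : ℝ} {f : Ω → ℝ}, r * Real.log 2 ≤ ∫ ω, f ω * Real.log 2 ∂P →
        r ≤ ∫ ω, f ω ∂P := fun h => by
      rw [integral_mul_const] at h
      exact le_of_mul_le_mul_right h hlog
    refine ⟨hR.1, hR.2.1, hdiv (hR.left_le (integral_nonneg fun ω => by positivity) ?_),
      hdiv (hR.right_le (integral_nonneg fun ω => by positivity) ?_),
      hdiv (hR.add_le (integral_nonneg fun ω => by positivity) ?_)⟩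
    · exact fun n x₂ _ => informationLE_det (ρ := uniformBits n₁) hM₁ hM₂ hle₁ hle₂ (fun m => m.1)
        (fun t m x₁ => received m.1 m.2 x₁ (x₂ t)) fun t m x₁ h₁ _ =>
          uniformBits_received_left h₁ x₁ (x₂ t) (x₂ t) (.inl rfl)
    · exact fun n x₁ _ => informationLE_det (ρ := uniformBits n₂) hM₁ hM₂ hle₁ hle₂ (fun m => m.2)
        (fun t m x₂ => received m.1 m.2 (x₁ t) x₂) fun t m x₂ _ h₂ =>
          uniformBits_received_right h₂ (x₁ t) (x₁ t) x₂ (.inl rfl)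
    · intro n
      have h := informationLE_det (P := P) (A := jointWords (n := n) (Set.univ : Set (Fin n →
        Fin n₁ → ZMod 2)) (Set.univ : Set (Fin n → Fin n₂ → ZMod 2)))
        (ρ := (uniformBits n₁).prod (uniformBits n₂)) hM₁ hM₂ hle₁ hle₂
        (fun m => max m.1 m.2) (fun _ m x => received m.1 m.2 x.1 x.2) fun _ m x h₁ h₂ =>
          uniformBits_prod_received h₁ h₂ x.1 x.2
      simp only [Nat.cast_max] at h
      exact h
  · exact isClosed_rateRegion _ _ _
  · intro s hs0 hs1
    obtain ⟨h₁, h₂, hr₁, hr₂, hr₁₂⟩ := hR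
    refine achievable_det hM₁ hM₂ hle₁ hle₂ (mul_nonneg hs0.le h₁) (mul_nonneg hs0.le h₂) ?_ ?_ ?_
    · exact (smul_eq_zero_or_lt h₁ hr₁ hs1).imp (fun h => by simp [h]) fun h => by simpa using h
    · exact (smul_eq_zero_or_lt h₂ hr₂ hs1).imp (fun h => by simp [h]) fun h => by simpa using h
    · rcases smul_eq_zero_or_lt (add_nonneg h₁ h₂) hr₁₂ hs1 with h | h
      · exact .inl (by simp [show R.1 = 0 by linarith])
      · refine .inr (.inr ?_)
        simp only [Prod.smul_fst, Prod.smul_snd, smul_eq_mul]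
        linarith

end DetRegion

/-! ### Gaussian random codes -/

lemma lintegral_exp_mul_sq_gaussianReal (v : NNReal) {b : ℝ} (hb : 2 * b * v < 1) :
    ∫⁻ x, ENNReal.ofReal (Real.exp (b * x ^ 2)) ∂gaussianReal 0 v =
      ENNReal.ofReal (Real.exp (-(1 / 2 * Real.log (1 - 2 * b * v)))) := by
  by_cases hv : v = 0
  · simp [hv]
  have hv0 : (0 : ℝ) < v := NNReal.coe_pos.2 (pos_iff_ne_zero.2 hv)
  have hpos : 0 < 1 - 2 * b * v := by linarith
  rw [gaussianReal_of_var_ne_zero 0 hv,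
    lintegral_withDensity_eq_lintegral_mul _ (measurable_gaussianPDF 0 v) (by fun_prop)]
  have hc : 0 < (1 - 2 * b * v) / (2 * v) := by positivity
  have h1 : ∀ x : ℝ, (gaussianPDF 0 v * fun x => ENNReal.ofReal (Real.exp (b * x ^ 2))) x =
      ENNReal.ofReal ((√(2 * Real.pi * v))⁻¹ * Real.exp (-((1 - 2 * b * v) / (2 * v)) * x ^ 2)) :=
    fun x => by
      rw [Pi.mul_apply, gaussianPDF, ← ENNReal.ofReal_mul (gaussianPDFReal_nonneg _ _ _),
        gaussianPDFReal, mul_assoc, ← Real.exp_add]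
      congr 3
      field_simp
      ring
  simp_rw [h1]
  rw [← ofReal_integral_eq_lintegral_ofReal ((integrable_exp_neg_mul_sq hc).const_mul _)
    (ae_of_all _ fun x => by positivity), integral_const_mul, integral_gaussian,
    Real.exp_neg, mul_comm (1 / 2), ← Real.rpow_def_of_pos hpos, ← Real.sqrt_eq_rpow,
    ← Real.sqrt_inv, ← Real.sqrt_inv, ← Real.sqrt_mul (by positivity)]
  congr 2
  field_simp

/-- The difference of two independent letters, scaled by the gain, is Gaussian of twice the
variance. -/
lemma lintegral_gaussianReal_sub (v : NNReal) (h : ℝ) {F : ℝ → ENNReal} (hF : Measurable F) :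
    ∫⁻ x, ∫⁻ x', F (h * (x' - x)) ∂gaussianReal 0 v ∂gaussianReal 0 v =
      ∫⁻ d, F d ∂gaussianReal 0 (2 * v * (h ^ 2).toNNReal) := by
  have hmap : ∀ a : ℝ, (gaussianReal 0 v).map (fun x => a * x) =
      gaussianReal 0 ((a ^ 2).toNNReal * v) := fun a => by
    rw [gaussianReal_map_const_mul, mul_zero]
    congr 1
    ext
    simp [sq_nonneg]
  have hv : 2 * v * (h ^ 2).toNNReal = ((-h) ^ 2).toNNReal * v + (h ^ 2).toNNReal * v := by
    rw [neg_sq]; ring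
  have hconv := gaussianReal_conv_gaussianReal (m₁ := 0) (m₂ := 0)
    (v₁ := ((-h) ^ 2).toNNReal * v) (v₂ := (h ^ 2).toNNReal * v)
  rw [add_zero] at hconv
  rw [hv, ← hconv, Measure.lintegral_conv hF, ← hmap, lintegral_map (by fun_prop) (by fun_prop)]
  refine lintegral_congr fun x => ?_
  rw [← hmap, lintegral_map (by fun_prop) (by fun_prop)]
  refine lintegral_congr fun x' => ?_
  congr 1
  ring

section PowerConstraint

/-- A Chernoff bound: letters of variance `ρ < 1` violate the unit power constraint with
exponentially small probability. -/
lemma tendsto_pi_gaussianReal_compl_unitPower {ρ : NNReal} (hρ : ρ < 1) :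
    Tendsto (fun n => (Measure.pi fun _ : Fin n => gaussianReal 0 ρ) (unitPower n)ᶜ) atTop
      (nhds 0) := by
  have hρ0 : (0 : ℝ) ≤ ρ := ρ.2
  have hρ1 : (ρ : ℝ) < 1 := by exact_mod_cast hρ
  set s : ℝ := (1 - ρ) / 4 with hs
  have hs0 : 0 < s := by rw [hs]; linarith
  have hsρ : ρ < 1 - 2 * s * ρ := by rw [hs]; nlinarith
  have hpos : 0 < 1 - 2 * s * ρ := hρ0.trans_lt hsρ
  set κ : ℝ := s + 1 / 2 * Real.log (1 - 2 * s * ρ) with hκ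
  have hκ0 : 0 < κ := by
    have h1 := Real.one_sub_inv_le_log_of_pos hpos
    have h2 : 1 / 2 * (1 - (1 - 2 * s * ρ)⁻¹) = -(s * (ρ / (1 - 2 * s * ρ))) := by
      field_simp
      ring
    have h3 : s * (ρ / (1 - 2 * s * ρ)) < s * 1 :=
      mul_lt_mul_of_pos_left ((div_lt_one hpos).2 hsρ) hs0
    linarith
  have hbound : ∀ n, (Measure.pi fun _ : Fin n => gaussianReal 0 ρ) (unitPower n)ᶜ ≤
      ENNReal.ofReal (Real.exp (-κ) ^ n) := fun n => by
    have hm : Measurable fun x : ℝ => ENNReal.ofReal (Real.exp (-s) * Real.exp (s * x ^ 2)) := by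
      fun_prop
    calc (Measure.pi fun _ : Fin n => gaussianReal 0 ρ) (unitPower n)ᶜ
        ≤ (Measure.pi fun _ : Fin n => gaussianReal 0 ρ)
            {x | 1 ≤ ∏ t, ENNReal.ofReal (Real.exp (-s) * Real.exp (s * x t ^ 2))} := by
          refine measure_mono fun x hx => ?_
          have hx' : (n : ℝ) < ∑ t, x t ^ 2 := not_le.1 hx
          show (1 : ENNReal) ≤ ∏ t, ENNReal.ofReal (Real.exp (-s) * Real.exp (s * x t ^ 2))
          rw [← ENNReal.ofReal_prod_of_nonneg fun t _ => by positivity, ENNReal.one_le_ofReal,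
            Finset.prod_mul_distrib, Finset.prod_const, Finset.card_univ, Fintype.card_fin,
            ← Real.exp_nat_mul, ← Real.exp_sum, ← Real.exp_add, ← Finset.mul_sum]
          refine Real.one_le_exp ?_
          nlinarith
      _ ≤ ∫⁻ x, ∏ t, ENNReal.ofReal (Real.exp (-s) * Real.exp (s * x t ^ 2))
            ∂(Measure.pi fun _ : Fin n => gaussianReal 0 ρ) := by
          simpa using mul_meas_ge_le_lintegral (μ := Measure.pi fun _ : Fin n => gaussianReal 0 ρ)
            (Finset.measurable_fun_prod Finset.univ fun t _ => hm.comp (measurable_pi_apply t)) 1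
      _ = _ := by
          rw [lintegral_pi_prod (fun _ : Fin n => gaussianReal 0 ρ) fun _ => hm, Finset.prod_const,
            Finset.card_univ, Fintype.card_fin, ENNReal.ofReal_pow (Real.exp_pos _).le]
          congr 1
          simp_rw [ENNReal.ofReal_mul (Real.exp_pos (-s)).le]
          rw [lintegral_const_mul _ (by fun_prop),
            lintegral_exp_mul_sq_gaussianReal ρ (by linarith),
            ← ENNReal.ofReal_mul (Real.exp_pos _).le, ← Real.exp_add]
          congr 2
          rw [hκ]; ring
  refine tendsto_of_tendsto_of_tendsto_of_le_of_le tendsto_const_nhds ?_ (fun _ => zero_le) hbound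
  rw [← ENNReal.ofReal_zero]
  exact ENNReal.tendsto_ofReal (tendsto_pow_atTop_nhds_zero_of_lt_one (Real.exp_pos _).le
    (Real.exp_lt_one_iff.2 (by linarith)))

lemma measurableSet_unitPower (n : ℕ) : MeasurableSet (unitPower n) :=
  measurableSet_le (by fun_prop) measurable_const

lemma unitPower_nonempty (n : ℕ) : (unitPower n).Nonempty := ⟨0, by simp [unitPower]⟩

end PowerConstraint

section GaussianAchievability

variable {Ω : Type*} {H₁ H₂ : Ω → ℝ}

/-- The observation of the fading Gaussian channel, as a function of the inputs, the state and the
noise. -/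
def gaussianObservation (H₁ H₂ : Ω → ℝ) (x : ℝ × ℝ) (ω : Ω) (z : ℝ) : ℝ × ℝ × ℝ :=
  (H₁ ω * x.1 + H₂ ω * x.2 + z, H₁ ω, H₂ ω)

/-- The square root of the likelihood, up to a constant factor. -/
noncomputable def gaussianScore (x : ℝ × ℝ) (y : ℝ × ℝ × ℝ) : NNReal :=
  (Real.exp (-(y.1 - (y.2.1 * x.1 + y.2.2 * x.2)) ^ 2 / 4)).toNNReal

/-- The Bhattacharyya coefficient of two Gaussian laws of variance `1` whose means differ by
`H₁ (x₁' - x₁) + H₂ (x₂' - x₂)`. -/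
lemma scoreRatio_gaussian (x₁ x₂ x₁' x₂' : ℝ) (ω : Ω) :
    scoreRatio (gaussianReal 0 1) (gaussianObservation H₁ H₂) gaussianScore (x₁, x₂) (x₁', x₂') ω =
      ENNReal.ofReal (Real.exp (-(1 / 8) *
        (H₁ ω * (x₁' - x₁) + H₂ ω * (x₂' - x₂)) ^ 2)) := by
  set d := H₁ ω * (x₁' - x₁) + H₂ ω * (x₂' - x₂) with hd
  have h1 : ∀ z : ℝ, ((gaussianScore (x₁', x₂') (gaussianObservation H₁ H₂ (x₁, x₂) ω z) /
      gaussianScore (x₁, x₂) (gaussianObservation H₁ H₂ (x₁, x₂) ω z) : NNReal) : ENNReal) =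
      ENNReal.ofReal (Real.exp (-(d ^ 2 / 4)) * Real.exp (d / 2 * z)) := fun z => by
    rw [gaussianScore, gaussianScore, ← Real.toNNReal_div (Real.exp_pos _).le, ← Real.exp_sub,
      ← Real.exp_add]
    show ENNReal.ofReal _ = _
    congr 2
    simp only [gaussianObservation, hd]
    ring
  have hmgf : ∫ z, Real.exp (d / 2 * z) ∂gaussianReal 0 1 = Real.exp (d ^ 2 / 8) := by
    have h := congrFun (mgf_fun_id_gaussianReal (μ := 0) (v := 1)) (d / 2)
    rw [mgf] at h
    rw [h]
    congr 1
    simp only [NNReal.coe_one]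
    ring
  unfold scoreRatio
  simp_rw [h1]
  rw [← ofReal_integral_eq_lintegral_ofReal ((integrable_exp_mul_gaussianReal _).const_mul _)
    (ae_of_all _ fun z => by positivity), integral_const_mul, hmgf, ← Real.exp_add]
  congr 2
  ring

lemma lintegral_exp_neg_sq_gaussianReal (v : NNReal) {ρ S : ℝ} (hv : (v : ℝ) = 2 * ρ * S) :
    ∫⁻ d, ENNReal.ofReal (Real.exp (-(1 / 8) * d ^ 2)) ∂gaussianReal 0 v =
      ENNReal.ofReal (Real.exp (-(1 / 2 * Real.log (1 + ρ * (S / 2))))) := by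
  rw [lintegral_exp_mul_sq_gaussianReal v (by nlinarith [v.2])]
  congr 5
  rw [hv]; ring

variable [MeasurableSpace Ω] {P : Measure Ω} [IsProbabilityMeasure P]

/-- Gaussian codebooks of power `ρ` achieve the pairwise error exponents `½ log (1 + ρ S / 2)`, the
Bhattacharyya coefficients averaged over the codewords. -/
lemma achievable_gaussian {B : ℝ} (hH₁ : Measurable H₁) (hH₂ : Measurable H₂)
    (hB₁ : ∀ ω, H₁ ω ^ 2 ≤ B) (hB₂ : ∀ ω, H₂ ω ^ 2 ≤ B) {ρ : NNReal} (hρ : ρ < 1)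
    {R : ℝ × ℝ} (hR₁ : 0 ≤ R.1) (hR₂ : 0 ≤ R.2)
    (hr₁ : R.1 = 0 ∨
      R.1 * Real.log 2 < ∫ ω, 1 / 2 * Real.log (1 + ρ * (H₁ ω ^ 2 / 2)) ∂P)
    (hr₂ : R.2 = 0 ∨
      R.2 * Real.log 2 < ∫ ω, 1 / 2 * Real.log (1 + ρ * (H₂ ω ^ 2 / 2)) ∂P)
    (hr₁₂ : R.1 = 0 ∨ R.2 = 0 ∨ (R.1 + R.2) * Real.log 2 <
      ∫ ω, 1 / 2 * Real.log (1 + ρ * ((H₁ ω ^ 2 + H₂ ω ^ 2) / 2)) ∂P) :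
    Achievable (gaussianLaw P H₁ H₂) unitPower unitPower R := by
  have hρ0 : (0 : ℝ) ≤ ρ := ρ.2
  have hρ1 : (ρ : ℝ) < 1 := by exact_mod_cast hρ
  have hc0 : ∀ {S : ℝ}, 0 ≤ S → 0 ≤ 1 / 2 * Real.log (1 + ρ * (S / 2)) := fun {S} hS =>
    mul_nonneg (by norm_num) (Real.log_nonneg (by
      have : 0 ≤ (ρ : ℝ) * (S / 2) := mul_nonneg hρ0 (div_nonneg hS zero_le_two)
      linarith))
  have hcB : ∀ {S : ℝ}, 0 ≤ S → S ≤ 2 * B → 1 / 2 * Real.log (1 + ρ * (S / 2)) ≤ B :=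
      fun {S} hS h => by
    have h1 : 0 ≤ (ρ : ℝ) * (S / 2) := mul_nonneg hρ0 (div_nonneg hS zero_le_two)
    have h2 := Real.log_le_sub_one_of_pos (show 0 < 1 + ρ * (S / 2) by linarith)
    nlinarith
  have hexp : Measurable fun d : ℝ => ENNReal.ofReal (Real.exp (-(1 / 8) * d ^ 2)) := by fun_prop
  refine achievable_of_scoreRatio (P := P) (η := gaussianReal 0 1) (ν₁ := gaussianReal 0 ρ)
    (ν₂ := gaussianReal 0 ρ) (g := gaussianObservation H₁ H₂) (u := gaussianScore)
    (c₁ := fun ω => 1 / 2 * Real.log (1 + ρ * (H₁ ω ^ 2 / 2)))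
    (c₂ := fun ω => 1 / 2 * Real.log (1 + ρ * (H₂ ω ^ 2 / 2)))
    (c₁₂ := fun ω => 1 / 2 * Real.log (1 + ρ * ((H₁ ω ^ 2 + H₂ ω ^ 2) / 2))) (B := B)
    (fun x₁ x₂ => rfl) ?_ ?_ (fun x ω z => ?_) (by fun_prop) (by fun_prop) (by fun_prop)
    (fun ω => hc0 (sq_nonneg _)) (fun ω => hc0 (sq_nonneg _))
    (fun ω => hc0 (add_nonneg (sq_nonneg _) (sq_nonneg _)))
    (fun ω => hcB (sq_nonneg _) (by linarith [hB₁ ω, sq_nonneg (H₁ ω)]))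
    (fun ω => hcB (sq_nonneg _) (by linarith [hB₂ ω, sq_nonneg (H₂ ω)]))
    (fun ω => hcB (add_nonneg (sq_nonneg _) (sq_nonneg _)) (by linarith [hB₁ ω, hB₂ ω]))
    (fun ω => ?_) (fun ω => ?_) (fun ω => ?_) unitPower_nonempty unitPower_nonempty
    measurableSet_unitPower measurableSet_unitPower
    (tendsto_pi_gaussianReal_compl_unitPower hρ) (tendsto_pi_gaussianReal_compl_unitPower hρ)
    hR₁ hR₂ hr₁ hr₂ hr₁₂
  · unfold gaussianObservation
    fun_prop
  · unfold gaussianScore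
    fun_prop
  · simp [gaussianScore, Real.exp_pos]
  · simp_rw [scoreRatio_gaussian]
    simp only [sub_self, mul_zero, add_zero, lintegral_const, measure_univ, mul_one]
    rw [lintegral_gaussianReal_sub ρ (H₁ ω) hexp]
    exact (lintegral_exp_neg_sq_gaussianReal _ (by simp [sq_nonneg])).le
  · simp_rw [scoreRatio_gaussian]
    simp only [sub_self, mul_zero, zero_add, lintegral_const, measure_univ, mul_one]
    rw [lintegral_gaussianReal_sub ρ (H₂ ω) hexp]
    exact (lintegral_exp_neg_sq_gaussianReal _ (by simp [sq_nonneg])).le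
  · simp_rw [scoreRatio_gaussian]
    have hin : ∀ x₁ x₁' : ℝ, ∫⁻ x₂, ∫⁻ x₂', ENNReal.ofReal (Real.exp (-(1 / 8) *
        (H₁ ω * (x₁' - x₁) + H₂ ω * (x₂' - x₂)) ^ 2)) ∂gaussianReal 0 ρ ∂gaussianReal 0 ρ =
        ∫⁻ d₂, ENNReal.ofReal (Real.exp (-(1 / 8) * (H₁ ω * (x₁' - x₁) + d₂) ^ 2))
          ∂gaussianReal 0 (2 * ρ * (H₂ ω ^ 2).toNNReal) := fun x₁ x₁' =>
      lintegral_gaussianReal_sub ρ (H₂ ω) (F := fun d₂ => ENNReal.ofReal (Real.exp (-(1 / 8) *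
        (H₁ ω * (x₁' - x₁) + d₂) ^ 2))) (by fun_prop)
    simp_rw [hin]
    rw [lintegral_gaussianReal_sub ρ (H₁ ω) (F := fun d₁ => ∫⁻ d₂, ENNReal.ofReal (Real.exp
      (-(1 / 8) * (d₁ + d₂) ^ 2)) ∂gaussianReal 0 (2 * ρ * (H₂ ω ^ 2).toNNReal))
      (Measurable.lintegral_prod_right' (f := fun q : ℝ × ℝ => ENNReal.ofReal (Real.exp
        (-(1 / 8) * (q.1 + q.2) ^ 2))) (by fun_prop)),
      ← Measure.lintegral_conv hexp, gaussianReal_conv_gaussianReal, add_zero]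
    refine (lintegral_exp_neg_sq_gaussianReal _ ?_).le
    simp only [NNReal.coe_add, NNReal.coe_mul, NNReal.coe_ofNat, Real.coe_toNNReal _ (sq_nonneg _)]
    ring

end GaussianAchievability

/-! ### Comparison of the two regions -/

section Comparison

/-- A rate pair violating each bound by at most `δ` is at `ℓ¹`-distance at most `δ` from the
region: the rate of user 1 is lowered to its own bound, then that of user 2 as far as needed. The
bound `a₁₂ ≤ a₁ + a₂` is essential: without it, both rates may have to drop by `δ`. -/
lemma exists_mem_rateRegion_of_slack {a₁ a₂ a₁₂ δ : ℝ} (h₁ : 0 ≤ a₁) (h₂ : 0 ≤ a₂)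
    (h₁' : a₁ ≤ a₁₂) (hadd : a₁₂ ≤ a₁ + a₂) {R : ℝ × ℝ}
    (hR : R ∈ rateRegion (a₁ + δ) (a₂ + δ) (a₁₂ + δ)) (hδ : 0 ≤ δ) :
    ∃ R' ∈ rateRegion a₁ a₂ a₁₂, |R.1 - R'.1| + |R.2 - R'.2| ≤ δ := by
  obtain ⟨hR₁, hR₂, hr₁, hr₂, hr₁₂⟩ := hR
  have hm₁ : min R.1 a₁ ≤ R.1 := min_le_left _ _
  have hm₂ : min R.2 (min a₂ (a₁₂ - min R.1 a₁)) ≤ R.2 := min_le_left _ _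
  refine ⟨(min R.1 a₁, min R.2 (min a₂ (a₁₂ - min R.1 a₁))), ⟨le_min hR₁ h₁, ?_, min_le_right _ _,
    (min_le_right _ _).trans (min_le_left _ _), ?_⟩, ?_⟩
  · exact le_min hR₂ (le_min h₂ (by linarith [min_le_right R.1 a₁]))
  · have := (min_le_right R.2 (min a₂ (a₁₂ - min R.1 a₁))).trans (min_le_right _ _)
    dsimp only
    linarith
  · dsimp only
    rw [abs_of_nonneg (sub_nonneg.2 hm₁), abs_of_nonneg (sub_nonneg.2 hm₂)]
    rcases min_choice R.1 a₁ with e | e <;> rw [e] at hm₁ ⊢ <;>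
      [rcases min_cases R.2 (min a₂ (a₁₂ - R.1)) with ⟨e', -⟩ | ⟨e', -⟩;
       rcases min_cases R.2 (min a₂ (a₁₂ - a₁)) with ⟨e', -⟩ | ⟨e', -⟩] <;> rw [e'] <;>
      [skip; rcases min_choice a₂ (a₁₂ - R.1) with e'' | e'';
       skip; rcases min_choice a₂ (a₁₂ - a₁) with e'' | e''] <;> try rw [e'']
    all_goals linarith

variable {Ω : Type*} {H H₁ H₂ : Ω → ℝ} {M M₁ M₂ : Ω → ℕ}

lemma IsBitLevel.sq_le (h : IsBitLevel H M) (ω : Ω) : H ω ^ 2 ≤ 4 ^ M ω := by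
  have key : ∀ x : ℝ, 0 < x → 1 / 2 * Real.logb 2 x ≤ M ω → x ≤ 4 ^ M ω := fun x hx hxM => by
    have := (Real.logb_le_iff_le_rpow one_lt_two hx).1 (show Real.logb 2 x ≤ 2 * M ω by linarith)
    rwa [Real.rpow_mul zero_le_two, Real.rpow_natCast, Real.rpow_two,
      show (2 : ℝ) ^ 2 = 4 by norm_num] at this
  rcases h with h | h
  · have := key (1 + H ω ^ 2) (by positivity) (by rw [h ω]; exact Nat.le_ceil _)
    linarith
  · rcases (sq_nonneg (H ω)).eq_or_lt with h0 | h0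
    · rw [← h0]; positivity
    · exact key _ h0 (by rw [h ω]; exact Nat.le_ceil _)

/-- Rounding up costs at most one bit, and replacing `1 + S` by `1 + S / 2` at most another half. -/
lemma IsBitLevel.mul_log_le (h : IsBitLevel H M) (ω : Ω) :
    M ω * Real.log 2 ≤ 1 / 2 * Real.log (1 + H ω ^ 2 / 2) + 3 / 2 * Real.log 2 := by
  have hl : 0 < Real.log 2 := Real.log_pos one_lt_two
  have hM : (M ω : ℝ) ≤ 1 / 2 * Real.logb 2 (1 + H ω ^ 2) + 1 := by
    have h0 : 0 ≤ 1 / 2 * Real.logb 2 (1 + H ω ^ 2) :=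
      mul_nonneg (by norm_num) (Real.logb_nonneg one_lt_two (by linarith [sq_nonneg (H ω)]))
    have h1 : M ω ≤ ⌈1 / 2 * Real.logb 2 (1 + H ω ^ 2)⌉₊ := by
      rcases h with h | h
      · exact (h ω).le
      · rw [h ω]
        rcases (sq_nonneg (H ω)).eq_or_lt with hz | hz
        · simp [← hz]
        · refine Nat.ceil_mono (mul_le_mul_of_nonneg_left ?_ (by norm_num))
          exact Real.logb_le_logb_of_le one_lt_two hz (by linarith)
    exact (Nat.cast_le.2 h1).trans (Nat.ceil_lt_add_one h0).le
  have h2 : Real.log (1 + H ω ^ 2) ≤ Real.log 2 + Real.log (1 + H ω ^ 2 / 2) := by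
    rw [← Real.log_mul two_ne_zero (by positivity)]
    exact Real.log_le_log (by positivity) (by linarith)
  have h3 : Real.logb 2 (1 + H ω ^ 2) * Real.log 2 = Real.log (1 + H ω ^ 2) :=
    div_mul_cancel₀ _ hl.ne'
  nlinarith [mul_le_mul_of_nonneg_right hM hl.le]

/-- The constant `3 / 2` of the converse: `8 = 4 ^ (3 / 2)`. -/
lemma half_log_le_of_le_eight_mul {x : ℝ} {m : ℕ} (hx : 0 < x) (h : x ≤ 8 * 4 ^ m) :
    1 / 2 * Real.log x ≤ (m + 3 / 2) * Real.log 2 := by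
  have := Real.log_le_log hx h
  rw [Real.log_mul (by norm_num) (by positivity), Real.log_pow,
    show (8 : ℝ) = 2 ^ 3 by norm_num, show (4 : ℝ) = 2 ^ 2 by norm_num, Real.log_pow,
    Real.log_pow] at this
  push_cast at this
  linarith

variable [MeasurableSpace Ω] {P : Measure Ω} [IsProbabilityMeasure P]

lemma integrable_natCast_of_le {n : ℕ} (hM : Measurable M) (hle : ∀ ω, M ω ≤ n) :
    Integrable (fun ω => (M ω : ℝ)) P :=
  Integrable.of_bound (measurable_from_top.comp hM).aestronglyMeasurable n
    (ae_of_all _ fun ω => by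
      rw [Real.norm_of_nonneg (Nat.cast_nonneg _)]; exact_mod_cast hle ω)

/-- Outer bound on the Gaussian region. The auxiliary output law gives `½ lg (1 + 2 S)` in place of
`½ lg (1 + S)`, which is still at most `3 / 2` bits above the number of bit levels. -/
lemma gaussianCapacityRegion_subset {B : ℝ} (hH₁ : Measurable H₁) (hH₂ : Measurable H₂)
    (hB₁ : ∀ ω, |H₁ ω| ≤ B) (hB₂ : ∀ ω, |H₂ ω| ≤ B) (hL₁ : IsBitLevel H₁ M₁)
    (hL₂ : IsBitLevel H₂ M₂) (hI₁ : Integrable (fun ω => (M₁ ω : ℝ)) P)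
    (hI₂ : Integrable (fun ω => (M₂ ω : ℝ)) P) :
    gaussianCapacityRegion P H₁ H₂ ⊆ rateRegion (∫ ω, (M₁ ω : ℝ) ∂P + 3 / 2)
      (∫ ω, (M₂ ω : ℝ) ∂P + 3 / 2) (∫ ω, max (M₁ ω : ℝ) (M₂ ω : ℝ) ∂P + 3 / 2) := by
  have hW : ∀ x₁ x₂ : ℝ, IsProbabilityMeasure (gaussianLaw P H₁ H₂ x₁ x₂) :=
    isProbabilityMeasure_gaussianLaw hH₁ hH₂
  have hl : 0 < Real.log 2 := Real.log_pos one_lt_two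
  -- a bound in nats with the constant of the single-letter lemma is turned into one in bits
  have main : ∀ {r g₁ g₂ : ℝ} {M : Ω → ℝ}, 0 ≤ g₁ → 0 ≤ g₂ → Integrable M P →
      (∀ ω, 1 / 2 * Real.log (1 + 2 * g₁ * H₁ ω ^ 2 + 2 * g₂ * H₂ ω ^ 2) ≤
        (M ω + 3 / 2) * Real.log 2) →
      r * Real.log 2 ≤ ∫ ω, 1 / 2 * Real.log (1 + 2 * g₁ * H₁ ω ^ 2 + 2 * g₂ * H₂ ω ^ 2) ∂P →
      r ≤ ∫ ω, M ω ∂P + 3 / 2 := fun {r g₁ g₂ M} hg₁ hg₂ hM hle hr => by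
    refine le_of_mul_le_mul_right (hr.trans ((integral_mono (integrable_continuous_comp_of_bounded
      hH₁ hH₂ hB₁ hB₂ (F := fun p => 1 / 2 * Real.log (1 + 2 * g₁ * p.1 ^ 2 + 2 * g₂ * p.2 ^ 2))
      ?_) ((hM.add (integrable_const _)).mul_const _) hle).trans_eq ?_)) hl
    · refine continuous_const.mul (Continuous.log (by fun_prop) fun p => ?_)
      positivity
    · simp only [Pi.add_apply]
      rw [integral_mul_const, integral_add hM (integrable_const _)]
      simp
  have hnn : ∀ g₁ g₂ : ℝ, 0 ≤ g₁ → 0 ≤ g₂ → ∀ ω,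
      0 ≤ 1 / 2 * Real.log (1 + 2 * g₁ * H₁ ω ^ 2 + 2 * g₂ * H₂ ω ^ 2) := fun g₁ g₂ h₁ h₂ ω =>
    mul_nonneg (by norm_num) (Real.log_nonneg (by
      have : 0 ≤ 2 * g₁ * H₁ ω ^ 2 := by positivity
      have : 0 ≤ 2 * g₂ * H₂ ω ^ 2 := by positivity
      linarith))
  refine closure_minimal (fun R hR => ⟨hR.1, hR.2.1, ?_, ?_, ?_⟩) (isClosed_rateRegion _ _ _)
  · refine main (g₁ := 1) (g₂ := 0) zero_le_one le_rfl hI₁ (fun ω => half_log_le_of_le_eight_mul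
      (by positivity) ?_) (hR.left_le (integral_nonneg (hnn 1 0 zero_le_one le_rfl))
      fun n x₂ hx₂ => ?_)
    · have := hL₁.sq_le ω
      have : (1 : ℝ) ≤ 4 ^ M₁ ω := one_le_pow₀ (by norm_num)
      linarith
    · exact informationLE_gaussianLaw hH₁ hH₂ hB₁ hB₂ (fun _ x => x) (fun t _ => x₂ t)
        (fun _ => 0) x₂ zero_le_one le_rfl (fun x hx => by simpa [unitPower] using hx)
        (fun x hx => by simp)
  · refine main (g₁ := 0) (g₂ := 1) le_rfl zero_le_one hI₂ (fun ω => half_log_le_of_le_eight_mul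
      (by positivity) ?_) (hR.right_le (integral_nonneg (hnn 0 1 le_rfl zero_le_one))
      fun n x₁ hx₁ => ?_)
    · have := hL₂.sq_le ω
      have : (1 : ℝ) ≤ 4 ^ M₂ ω := one_le_pow₀ (by norm_num)
      linarith
    · exact informationLE_gaussianLaw hH₁ hH₂ hB₁ hB₂ (fun t _ => x₁ t) (fun _ x => x)
        x₁ (fun _ => 0) le_rfl zero_le_one (fun x hx => by simp)
        (fun x hx => by simpa [unitPower] using hx)
  · refine main (g₁ := 1) (g₂ := 1) zero_le_one zero_le_one (hI₁.sup hI₂) (fun ω => ?_)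
      (hR.add_le (integral_nonneg (hnn 1 1 zero_le_one zero_le_one)) fun n => ?_)
    · have h₁ := (hL₁.sq_le ω).trans
        (pow_le_pow_right₀ (by norm_num) (le_max_left (M₁ ω) (M₂ ω)))
      have h₂ := (hL₂.sq_le ω).trans
        (pow_le_pow_right₀ (by norm_num) (le_max_right (M₁ ω) (M₂ ω)))
      have h1 : (1 : ℝ) ≤ 4 ^ max (M₁ ω) (M₂ ω) := one_le_pow₀ (by norm_num)
      have := half_log_le_of_le_eight_mul (m := max (M₁ ω) (M₂ ω))
        (x := 1 + 2 * 1 * H₁ ω ^ 2 + 2 * 1 * H₂ ω ^ 2) (by positivity) (by linarith)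
      rwa [Nat.cast_max] at this
    · exact informationLE_gaussianLaw hH₁ hH₂ hB₁ hB₂ (fun _ (x : ℝ × ℝ) => x.1)
        (fun _ (x : ℝ × ℝ) => x.2) (fun _ => 0) (fun _ => 0) zero_le_one zero_le_one
        (fun x hx => by simpa [unitPower] using hx.1) (fun x hx => by simpa [unitPower] using hx.2)

/-- Inner bound on the Gaussian region, in nats. Random codes of power `ρ < 1` lose at most
`-½ log ρ`, which vanishes as `ρ → 1`. -/
lemma mem_gaussianCapacityRegion {B : ℝ} (hH₁ : Measurable H₁) (hH₂ : Measurable H₂)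
    (hB₁ : ∀ ω, |H₁ ω| ≤ B) (hB₂ : ∀ ω, |H₂ ω| ≤ B) {R : ℝ × ℝ} (hR₁ : 0 ≤ R.1) (hR₂ : 0 ≤ R.2)
    (h₁ : R.1 * Real.log 2 ≤ ∫ ω, 1 / 2 * Real.log (1 + H₁ ω ^ 2 / 2) ∂P)
    (h₂ : R.2 * Real.log 2 ≤ ∫ ω, 1 / 2 * Real.log (1 + H₂ ω ^ 2 / 2) ∂P)
    (h₁₂ : (R.1 + R.2) * Real.log 2 ≤
      ∫ ω, 1 / 2 * Real.log (1 + (H₁ ω ^ 2 + H₂ ω ^ 2) / 2) ∂P) :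
    R ∈ gaussianCapacityRegion P H₁ H₂ := by
  have hl : 0 < Real.log 2 := Real.log_pos one_lt_two
  refine mem_closure_of_forall_smul_mem fun s hs0 hs1 => ?_
  have hsq : ∀ {H : Ω → ℝ}, (∀ ω, |H ω| ≤ B) → ∀ ω, H ω ^ 2 ≤ B ^ 2 := fun hB ω =>
    sq_le_sq' (abs_le.1 (hB ω)).1 (abs_le.1 (hB ω)).2
  have ev : ∀ {Q : Prop} {r c : ℝ}, (Q ∨ r < c) →
      ∀ᶠ ρ in nhdsWithin (1 : ℝ) (Set.Iio 1), Q ∨ r < c + 1 / 2 * Real.log ρ := by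
    rintro Q r c (h | h)
    · exact .of_forall fun _ => .inl h
    · have : Tendsto (fun ρ : ℝ => c + 1 / 2 * Real.log ρ) (nhds 1) (nhds c) := by
        have := ((Real.continuousAt_log one_ne_zero).const_mul (1 / 2)).const_add c
        simpa [ContinuousAt] using this
      exact ((this.mono_left nhdsWithin_le_nhds).eventually (lt_mem_nhds h)).mono fun _ => .inr
  have pos : ∀ᶠ ρ in nhdsWithin (1 : ℝ) (Set.Iio 1), 0 < ρ :=
    nhdsWithin_le_nhds (lt_mem_nhds one_pos)
  obtain ⟨ρ, ⟨⟨⟨hρ₁, hρ₂⟩, hρ₁₂⟩, hρ0⟩, hρ1⟩ :=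
    ((((ev (smul_eq_zero_or_lt (mul_nonneg hR₁ hl.le) h₁ hs1)).and
      (ev (smul_eq_zero_or_lt (mul_nonneg hR₂ hl.le) h₂ hs1))).and
      (ev (smul_eq_zero_or_lt (mul_nonneg (add_nonneg hR₁ hR₂) hl.le) h₁₂ hs1))).and
      pos |>.and self_mem_nhdsWithin).exists
  lift ρ to NNReal using hρ0.le
  have loss : ∀ {F : ℝ × ℝ → ℝ}, Continuous F → (∀ p, 0 ≤ F p) →
      ∫ ω, 1 / 2 * Real.log (1 + F (H₁ ω, H₂ ω)) ∂P + 1 / 2 * Real.log ρ ≤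
        ∫ ω, 1 / 2 * Real.log (1 + ρ * F (H₁ ω, H₂ ω)) ∂P := fun {F} hF h0 => by
    have hI : ∀ r : ℝ, 0 ≤ r →
        Integrable (fun ω => 1 / 2 * Real.log (1 + r * F (H₁ ω, H₂ ω))) P := fun r hr =>
      integrable_continuous_comp_of_bounded hH₁ hH₂ hB₁ hB₂
        (F := fun p => 1 / 2 * Real.log (1 + r * F p))
        (continuous_const.mul (Continuous.log (by fun_prop) fun p => by
          have := mul_nonneg hr (h0 p); positivity))
    have hI1 := hI 1 zero_le_one
    simp only [one_mul] at hI1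
    have := integral_mono (hI1.add (integrable_const (1 / 2 * Real.log ρ))) (hI ρ ρ.2) fun ω => by
      have hp := h0 (H₁ ω, H₂ ω)
      have := Real.log_le_log (by positivity)
        (show (ρ : ℝ) * (1 + F (H₁ ω, H₂ ω)) ≤ 1 + ρ * F (H₁ ω, H₂ ω) by
          have : (ρ : ℝ) < 1 := hρ1
          linarith)
      rw [Real.log_mul hρ0.ne' (by positivity)] at this
      simp only [Pi.add_apply]
      linarith
    simp only [Pi.add_apply] at this
    rw [integral_add hI1 (integrable_const _)] at this
    simpa using this
  have l₁ := loss (F := fun p => p.1 ^ 2 / 2) (by fun_prop) fun p => by positivity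
  have l₂ := loss (F := fun p => p.2 ^ 2 / 2) (by fun_prop) fun p => by positivity
  have l₁₂ := loss (F := fun p => (p.1 ^ 2 + p.2 ^ 2) / 2) (by fun_prop) fun p => by positivity
  refine achievable_gaussian hH₁ hH₂ (hsq hB₁) (hsq hB₂) (ρ := ρ) (by exact_mod_cast hρ1)
    (mul_nonneg hs0.le hR₁) (mul_nonneg hs0.le hR₂) ?_ ?_ ?_
  · refine hρ₁.imp (fun h => ?_) fun h => ?_
    · simp [(mul_eq_zero.1 h).resolve_right hl.ne']
    · simp only [Prod.smul_fst, smul_eq_mul, mul_assoc]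
      exact h.trans_le l₁
  · refine hρ₂.imp (fun h => ?_) fun h => ?_
    · simp [(mul_eq_zero.1 h).resolve_right hl.ne']
    · simp only [Prod.smul_snd, smul_eq_mul, mul_assoc]
      exact h.trans_le l₂
  · refine hρ₁₂.imp (fun h => ?_) fun h => .inr ?_
    · have h0 := (mul_eq_zero.1 h).resolve_right hl.ne'
      simp [show R.1 = 0 by linarith]
    · simp only [Prod.smul_fst, Prod.smul_snd, smul_eq_mul, ← mul_add, mul_assoc]
      exact h.trans_le l₁₂

lemma withinBits_capacityRegions {n₁ n₂ : ℕ} (hM₁ : Measurable M₁) (hM₂ : Measurable M₂)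
    (hle₁ : ∀ ω, M₁ ω ≤ n₁) (hle₂ : ∀ ω, M₂ ω ≤ n₂) (hH₁ : Measurable H₁) (hH₂ : Measurable H₂)
    (hL₁ : IsBitLevel H₁ M₁) (hL₂ : IsBitLevel H₂ M₂) :
    WithinBits (3 / 2) (detCapacityRegion P n₁ n₂ M₁ M₂) (gaussianCapacityRegion P H₁ H₂) := by
  have hl : 0 < Real.log 2 := Real.log_pos one_lt_two
  have hI₁ := integrable_natCast_of_le (P := P) hM₁ hle₁
  have hI₂ := integrable_natCast_of_le (P := P) hM₂ hle₂
  have bound : ∀ {H : Ω → ℝ} {M : Ω → ℕ} {n : ℕ}, IsBitLevel H M → (∀ ω, M ω ≤ n) →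
      n ≤ max n₁ n₂ → ∀ ω, |H ω| ≤ 4 ^ max n₁ n₂ := fun {H M n} hL hle hn ω => by
    have h4 : H ω ^ 2 ≤ 4 ^ max n₁ n₂ :=
      (hL.sq_le ω).trans (pow_le_pow_right₀ (by norm_num) ((hle ω).trans hn))
    have h1 : (1 : ℝ) ≤ 4 ^ max n₁ n₂ := one_le_pow₀ (by norm_num)
    refine abs_le_of_sq_le_sq (h4.trans ?_) (by positivity)
    nlinarith
  have hB₁ := bound hL₁ hle₁ (le_max_left _ _)
  have hB₂ := bound hL₂ hle₂ (le_max_right _ _)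
  rw [detCapacityRegion_eq hM₁ hM₂ hle₁ hle₂]
  refine ⟨fun R hR => ?_, fun R hR => ?_⟩
  · have hint : ∀ {F : ℝ × ℝ → ℝ}, Continuous F → (∀ p, 0 ≤ F p) →
        Integrable (fun ω => 1 / 2 * Real.log (1 + F (H₁ ω, H₂ ω))) P := fun {F} hF h0 =>
      integrable_continuous_comp_of_bounded hH₁ hH₂ hB₁ hB₂
        (F := fun p => 1 / 2 * Real.log (1 + F p))
        (continuous_const.mul (Continuous.log (by fun_prop) fun p => by
          have := h0 p; positivity))
    have i₁ := hint (F := fun p => p.1 ^ 2 / 2) (by fun_prop) fun p => by positivity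
    have i₂ := hint (F := fun p => p.2 ^ 2 / 2) (by fun_prop) fun p => by positivity
    have i₁₂ := hint (F := fun p => (p.1 ^ 2 + p.2 ^ 2) / 2) (by fun_prop) fun p => by positivity
    have mono : ∀ {x y : ℝ}, 0 ≤ x → x ≤ y →
        1 / 2 * Real.log (1 + x) ≤ 1 / 2 * Real.log (1 + y) := fun hx hxy =>
      mul_le_mul_of_nonneg_left (Real.log_le_log (by positivity) (by linarith)) (by norm_num)
    have le₁ : ∀ ω, 1 / 2 * Real.log (1 + H₁ ω ^ 2 / 2) ≤
        1 / 2 * Real.log (1 + (H₁ ω ^ 2 + H₂ ω ^ 2) / 2) := fun ω =>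
      mono (by positivity) (by linarith [sq_nonneg (H₂ ω)])
    have le₂ : ∀ ω, 1 / 2 * Real.log (1 + H₂ ω ^ 2 / 2) ≤
        1 / 2 * Real.log (1 + (H₁ ω ^ 2 + H₂ ω ^ 2) / 2) := fun ω =>
      mono (by positivity) (by linarith [sq_nonneg (H₁ ω)])
    have nonneg : ∀ x : ℝ, 0 ≤ 1 / 2 * Real.log (1 + x ^ 2 / 2) := fun x =>
      mul_nonneg (by norm_num) (Real.log_nonneg (by linarith [sq_nonneg x]))
    have conv : ∀ {M f : Ω → ℝ}, Integrable M P → Integrable f P →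
        (∀ ω, M ω * Real.log 2 ≤ f ω + 3 / 2 * Real.log 2) →
        ∫ ω, M ω ∂P ≤ (∫ ω, f ω ∂P) / Real.log 2 + 3 / 2 := fun {M f} hM hf h => by
      have := integral_mono (hM.mul_const _) (hf.add (integrable_const (3 / 2 * Real.log 2))) h
      simp only [Pi.add_apply] at this
      rw [integral_mul_const, integral_add hf (integrable_const _), integral_const] at this
      simp only [probReal_univ, one_smul] at this
      rw [← sub_le_iff_le_add, le_div_iff₀ hl]
      linarith
    have c₁ := conv hI₁ i₁ hL₁.mul_log_le
    have c₂ := conv hI₂ i₂ hL₂.mul_log_le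
    have c₁₂ := conv (hI₁.sup hI₂) i₁₂ fun ω => by
      have h₁ := (hL₁.mul_log_le ω).trans (add_le_add_left (le₁ ω) _)
      have h₂ := (hL₂.mul_log_le ω).trans (add_le_add_left (le₂ ω) _)
      rcases max_choice (M₁ ω : ℝ) (M₂ ω) with e | e <;> simpa only [Pi.sup_apply, e]
    obtain ⟨hR₁, hR₂, hr₁, hr₂, hr₁₂⟩ := hR
    obtain ⟨R', ⟨h₁, h₂, h₁', h₂', h₁₂'⟩, hd⟩ := exists_mem_rateRegion_of_slack
      (div_nonneg (integral_nonneg fun ω => nonneg (H₁ ω)) hl.le)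
      (div_nonneg (integral_nonneg fun ω => nonneg (H₂ ω)) hl.le)
      (div_le_div_of_nonneg_right (integral_mono i₁ i₁₂ le₁) hl.le) (by
        rw [← add_div, ← integral_add i₁ i₂]
        refine div_le_div_of_nonneg_right (integral_mono i₁₂ (i₁.add i₂) fun ω => ?_) hl.le
        simp only [← mul_add]
        rw [← Real.log_mul (by positivity) (by positivity)]
        refine mul_le_mul_of_nonneg_left (Real.log_le_log (by positivity) ?_) (by norm_num)
        nlinarith [mul_nonneg (sq_nonneg (H₁ ω)) (sq_nonneg (H₂ ω))])
      (show R ∈ rateRegion _ _ _ from ⟨hR₁, hR₂, hr₁.trans c₁, hr₂.trans c₂, hr₁₂.trans c₁₂⟩)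
      (by norm_num)
    rw [le_div_iff₀ hl] at h₁' h₂' h₁₂'
    exact ⟨R', mem_gaussianCapacityRegion hH₁ hH₂ hB₁ hB₂ h₁ h₂ h₁' h₂' h₁₂', hd⟩
  · refine exists_mem_rateRegion_of_slack (integral_nonneg fun ω => Nat.cast_nonneg _)
      (integral_nonneg fun ω => Nat.cast_nonneg _)
      (integral_mono hI₁ (hI₁.sup hI₂) fun ω => le_max_left _ _) ?_
      (gaussianCapacityRegion_subset hH₁ hH₂ hB₁ hB₂ hL₁ hL₂ hI₁ hI₂ hR) (by norm_num)
    rw [← integral_add hI₁ hI₂]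
    exact integral_mono (hI₁.sup hI₂) (hI₁.add hI₂) fun ω =>
      max_le (le_add_of_nonneg_right (Nat.cast_nonneg _))
        (le_add_of_nonneg_left (Nat.cast_nonneg _))

end Comparison

end FadingMAC

theorem mainTheorem2 {Ω : Type*} [MeasurableSpace Ω] (P : Measure Ω) [IsProbabilityMeasure P]
    (n₁ n₂ : ℕ) (M₁ M₂ : Ω → ℕ) (hM₁ : Measurable M₁) (hM₂ : Measurable M₂)
    (hle₁ : ∀ ω, M₁ ω ≤ n₁) (hle₂ : ∀ ω, M₂ ω ≤ n₂) :
    FadingMAC.detCapacityRegion P n₁ n₂ M₁ M₂ =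
      {R : ℝ × ℝ | 0 ≤ R.1 ∧ 0 ≤ R.2 ∧
        R.1 ≤ ∫ ω, (M₁ ω : ℝ) ∂P ∧
        R.2 ≤ ∫ ω, (M₂ ω : ℝ) ∂P ∧
        R.1 + R.2 ≤ ∫ ω, max (M₁ ω : ℝ) (M₂ ω : ℝ) ∂P} ∧
    ∀ H₁ H₂ : Ω → ℝ, Measurable H₁ → Measurable H₂ → (∀ ω, 0 ≤ H₁ ω) → (∀ ω, 0 ≤ H₂ ω) →
      FadingMAC.IsBitLevel H₁ M₁ → FadingMAC.IsBitLevel H₂ M₂ →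
      FadingMAC.WithinBits (3 / 2) (FadingMAC.detCapacityRegion P n₁ n₂ M₁ M₂)
        (FadingMAC.gaussianCapacityRegion P H₁ H₂) := by
  exact ⟨FadingMAC.detCapacityRegion_eq hM₁ hM₂ hle₁ hle₂, fun _ _ hH₁ hH₂ _ _ hL₁ hL₂ =>
    FadingMAC.withinBits_capacityRegions hM₁ hM₂ hle₁ hle₂ hH₁ hH₂ hL₁ hL₂⟩
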